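/- For each integer $n\ge 1$ let $\mathcal K_n$ be the complete graph on $[n]=\{1,\dots,n\}$, whose edges $e$ carry independent random weights $E_e$, each exponentially distributed with mean $n$. For $i,j\in[n]$ let $$d_w(i,j)=\min_{\pi}\sum_{e\in\pi}E_e ,$$ the minimum being over all paths $\pi$ from $i$ to $j$ in $\mathcal K_n$. Fix $m\ge 2$, and let $(\Lambda_\alpha)_{\alpha\in[m]}$ and $(\Lambda_{\alpha\beta})_{\alpha,\beta\in[m],\,\alpha<\beta}$ be random variables, all independent, each standard Gumbel, i.e. with cumulative distribution function $x\mapsto e^{-e^{-x}}$ on $\mathbb R$. Then, as $n\to\infty$ (with $n\ge m$), $$\bigl(d_w(\alpha,\beta)-\log n\bigr)_{\alpha,\beta\in[m],\,\alpha<\beta}\ \longrightarrow\ \bigl(\Lambda_\alpha+\Lambda_\beta-\Lambda_{\alpha\beta}\bigr)_{\alpha,\beta\in[m],\,\alpha<\beta}$$ jointly in distribution, i.e. as random vectors in $\mathbb R^{m(m-1)/2}$. -/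

import Mathlib

open MeasureTheory ProbabilityTheory Filter

noncomputable section

/-- The edges of the complete graph `K_n` on `n` vertices (the vertex set is `Fin n`). -/
abbrev CompleteEdge (n : ℕ) : Type := (⊤ : SimpleGraph (Fin n)).edgeSet

/-- The total weight of a walk: the sum of the weights of the edges that it traverses. -/
def walkWeight {n : ℕ} (w : CompleteEdge n → ℝ) {i j : Fin n}
    (p : (⊤ : SimpleGraph (Fin n)).Walk i j) : ℝ :=
  (p.darts.map fun d => w ⟨d.edge, d.edge_mem⟩).sum

/-- The distance `d_w(i, j)`: the weight of the smallest-weight path between `i` and `j` in `K_n`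
with edge weights `w`. There are finitely many paths, and at least one, so the infimum is
a minimum. -/
def weightDist {n : ℕ} (w : CompleteEdge n → ℝ) (i j : Fin n) : ℝ :=
  ⨅ p : (⊤ : SimpleGraph (Fin n)).Path i j, walkWeight w (p : (⊤ : SimpleGraph (Fin n)).Walk i j)

/-- The random variable `X` is standard Gumbel under `P`: its cumulative distribution function
is `x ↦ exp (-exp (-x))`. -/
def IsStandardGumbel {Ω : Type*} [MeasurableSpace Ω] (X : Ω → ℝ) (P : Measure Ω) : Prop :=
  AEMeasurable X P ∧ ∀ x : ℝ, P {ω | X ω ≤ x} = ENNReal.ofReal (Real.exp (-Real.exp (-x)))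

/-- The pairs `α < β` of indices in `[m]`. -/
abbrev OrderedPair (m : ℕ) : Type := {q : Fin m × Fin m // q.1 < q.2}

end

/-! Around the `m` roots, grow balls one after another, each by `a = steps n ≈ n^(2/3)` new
vertices, every ball avoiding the earlier balls and all other roots. By memorylessness the waiting
time before step `l + 1` of a ball is exponential with rate `(l + 1) (n - o(n)) / n`, independently
of the past. Hence the time `T_γ(j)` at which ball `γ` has made `j` steps is close to the Yule time
`∑_{l<j} ξ_{γ,l} / (l + 1)`, with `ξ` independent standard exponentials. The Yule time minus `log (j
+ 1)` converges almost surely; since its distribution function is `(1 - e^{-x})^j`, the limit `Z_γ`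
is standard Gumbel, and different balls give independent limits.

Once the balls are complete, the unrevealed excess of each edge between two balls is a fresh
exponential variable of mean `n`. For `γ < γ'`, an edge from any vertex of ball `γ` to the vertex
reached at step `k > 0` of ball `γ'` gives a path of length at most `T_γ(a) + T_γ'(k) + excess`. Say
that the pair collides if one of these values is below `t = log n + x`. Given the exploration, no
collision occurs with probability `exp (-R)`, where `R = (a + 1) / n * ∑_k (t - T_γ(a) - T_γ'(k))⁺`
is `collisionRate`, and different pairs are independent. As `∑_k (y - log k)⁺ ~ e^y`, the rate tends
to `exp (x - Z_γ - Z_γ')` (`tendsto_collisionRate`). Averaging `exp (-∑ rates)` over the `Z` gives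
the orthant probabilities of `Λ_α + Λ_β - Λ_αβ`, because a Gumbel variable is at most `y` with
probability `exp (-e^{-y})` (`pi_gumbelLaw_orthant`). The exponent 2/3 satisfies both constraints:
`a ≫ √n` makes the two radii add up to more than `log n`, and `a log n ≪ n` makes depletion and the
edges to the roots negligible.

The exploration is used only through a one-sided principle, `lintegral_expSeqLaw_le`: conditional
lower bounds integrate to lower bounds. Distances at least `t` exclude collisions, which bounds the
joint survival probability above. The converse implication is needed only for two balls, where a
potential bounds the distance below when all connecting edges are long (`Explored.le_weightDist`).
For `m` balls the inequality `1{no collision} + ∑_q 1{collision of q} ≤ 1{all far} + ∑_q 1{d_q <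
t_q}` then suffices: by the two-ball case both sums over pairs have the same limiting expectation,
so they cancel (`tendsto_weightLaw_real_farApart`). Convergence of all closed upper orthant
probabilities yields weak convergence (`tendsto_probabilityMeasure_of_tendsto_Ici`). -/

/-! ### First-passage distances on the complete graph and lower bounds by potentials. -/

section WeightDist

variable {n : ℕ}

/-- The weight of the edge between two vertices, and `0` on the diagonal. -/
noncomputable def edgeWeight (w : CompleteEdge n → ℝ) (x y : Fin n) : ℝ :=
  if h : x ≠ y then w ⟨s(x, y), by simpa using h⟩ else 0

theorem edgeWeight_of_ne (w : CompleteEdge n → ℝ) {x y : Fin n} (h : x ≠ y) :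
    edgeWeight w x y = w ⟨s(x, y), by simpa using h⟩ := by
  simp [edgeWeight, h]

theorem edgeWeight_comm (w : CompleteEdge n → ℝ) (x y : Fin n) :
    edgeWeight w x y = edgeWeight w y x := by
  by_cases h : x = y
  · rw [h]
  · rw [edgeWeight_of_ne w h, edgeWeight_of_ne w (Ne.symm h)]
    congr 2
    exact Sym2.eq_swap

theorem walkWeight_nil (w : CompleteEdge n → ℝ) (x : Fin n) :
    walkWeight w (SimpleGraph.Walk.nil : (⊤ : SimpleGraph (Fin n)).Walk x x) = 0 := by
  simp [walkWeight]

theorem walkWeight_cons (w : CompleteEdge n → ℝ) {x y z : Fin n}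
    (h : (⊤ : SimpleGraph (Fin n)).Adj x y) (p : (⊤ : SimpleGraph (Fin n)).Walk y z) :
    walkWeight w (SimpleGraph.Walk.cons h p) = edgeWeight w x y + walkWeight w p := by
  rw [edgeWeight_of_ne w (by simpa using h)]
  simp [walkWeight, SimpleGraph.Dart.edge]

theorem walkWeight_append (w : CompleteEdge n → ℝ) {x y z : Fin n}
    (p : (⊤ : SimpleGraph (Fin n)).Walk x y) (q : (⊤ : SimpleGraph (Fin n)).Walk y z) :
    walkWeight w (p.append q) = walkWeight w p + walkWeight w q := by
  simp [walkWeight]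

theorem walkWeight_bypass_le {w : CompleteEdge n → ℝ} (hw : ∀ e, 0 ≤ w e) {x y : Fin n}
    (p : (⊤ : SimpleGraph (Fin n)).Walk x y) : walkWeight w p.bypass ≤ walkWeight w p := by
  refine List.Sublist.sum_le_sum (p.darts_bypass_sublist_darts.map _) ?_
  intro a ha
  obtain ⟨d, -, rfl⟩ := List.mem_map.1 ha
  exact hw _

theorem weightDist_le_path (w : CompleteEdge n → ℝ) {x y : Fin n}
    (p : (⊤ : SimpleGraph (Fin n)).Path x y) : weightDist w x y ≤ walkWeight w p.1 :=
  ciInf_le (Set.finite_range _).bddBelow p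

theorem weightDist_le_walkWeight {w : CompleteEdge n → ℝ} (hw : ∀ e, 0 ≤ w e) {x y : Fin n}
    (p : (⊤ : SimpleGraph (Fin n)).Walk x y) : weightDist w x y ≤ walkWeight w p :=
  (weightDist_le_path w ⟨p.bypass, p.bypass_isPath⟩).trans (walkWeight_bypass_le hw p)

instance nonempty_path_top (x y : Fin n) : Nonempty ((⊤ : SimpleGraph (Fin n)).Path x y) :=
  ⟨((SimpleGraph.preconnected_top x y).some).toPath⟩

theorem exists_path_walkWeight_eq (w : CompleteEdge n → ℝ) (x y : Fin n) :
    ∃ p : (⊤ : SimpleGraph (Fin n)).Path x y, walkWeight w p.1 = weightDist w x y :=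
  exists_eq_ciInf_of_finite

theorem weightDist_triangle {w : CompleteEdge n → ℝ} (hw : ∀ e, 0 ≤ w e) (x y z : Fin n) :
    weightDist w x z ≤ weightDist w x y + weightDist w y z := by
  obtain ⟨p, hp⟩ := exists_path_walkWeight_eq w x y
  obtain ⟨q, hq⟩ := exists_path_walkWeight_eq w y z
  rw [← hp, ← hq, ← walkWeight_append]
  exact weightDist_le_walkWeight hw _

theorem weightDist_le_edgeWeight {w : CompleteEdge n → ℝ} (hw : ∀ e, 0 ≤ w e) (x y : Fin n) :
    weightDist w x y ≤ edgeWeight w x y := by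
  by_cases h : x = y
  · subst h
    simpa [edgeWeight, walkWeight_nil] using weightDist_le_walkWeight hw
      (SimpleGraph.Walk.nil : (⊤ : SimpleGraph (Fin n)).Walk x x)
  · have hxy : (⊤ : SimpleGraph (Fin n)).Adj x y := by simpa using h
    have := weightDist_le_walkWeight hw (SimpleGraph.Walk.cons hxy SimpleGraph.Walk.nil)
    rwa [walkWeight_cons, walkWeight_nil, add_zero] at this

theorem weightDist_comm (w : CompleteEdge n → ℝ) (x y : Fin n) :
    weightDist w x y = weightDist w y x := by
  have key : ∀ x y : Fin n, weightDist w x y ≤ weightDist w y x := by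
    intro x y
    obtain ⟨p, hp⟩ := exists_path_walkWeight_eq w y x
    rw [← hp]
    have h : walkWeight w p.1.reverse = walkWeight w p.1 := by
      simp [walkWeight, Function.comp_def]
    rw [← h]
    exact weightDist_le_path w ⟨p.1.reverse, p.2.reverse⟩
  exact le_antisymm (key x y) (key y x)

theorem potential_le_walkWeight {w : CompleteEdge n → ℝ} {Ψ : Fin n → ℝ}
    (h : ∀ x y, x ≠ y → Ψ x - Ψ y ≤ edgeWeight w x y) {x y : Fin n}
    (p : (⊤ : SimpleGraph (Fin n)).Walk x y) : Ψ x - Ψ y ≤ walkWeight w p := by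
  induction p with
  | nil => simp [walkWeight_nil]
  | cons hadj p ih =>
    rw [walkWeight_cons]
    linarith [h _ _ ((SimpleGraph.top_adj _ _).1 hadj)]

/-- A potential whose increments are bounded by the edge weights bounds the distance below. -/
theorem potential_le_weightDist {w : CompleteEdge n → ℝ} {Ψ : Fin n → ℝ}
    (h : ∀ x y, x ≠ y → Ψ x - Ψ y ≤ edgeWeight w x y) (x y : Fin n) :
    Ψ x - Ψ y ≤ weightDist w x y :=
  le_ciInf fun p => potential_le_walkWeight h p.1

theorem measurable_weightDist (x y : Fin n) :
    Measurable fun w : CompleteEdge n → ℝ => weightDist w x y := by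
  refine Measurable.iInf fun p => ?_
  unfold walkWeight
  generalize p.1.darts = l
  induction l with
  | nil => simp
  | cons d l ih =>
    simp only [List.map_cons, List.sum_cons]
    exact (measurable_pi_apply _).add ih

end WeightDist

/-! ### Memorylessness and the minimum of independent exponential variables. -/

section ExponentialMinimum

open scoped ENNReal

theorem expMeasure_eq_withDensity (r : ℝ) :
    expMeasure r = volume.withDensity (exponentialPDF r) := rfl

theorem measurable_exponentialPDF (r : ℝ) : Measurable (exponentialPDF r) :=
  (measurable_exponentialPDFReal r).ennreal_ofReal

theorem lintegral_expMeasure (r : ℝ) {g : ℝ → ℝ≥0∞} (hg : Measurable g) :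
    ∫⁻ y, g y ∂expMeasure r = ∫⁻ y, exponentialPDF r y * g y := by
  rw [expMeasure_eq_withDensity, lintegral_withDensity_eq_lintegral_mul _
    (measurable_exponentialPDF r) hg]
  rfl

theorem ae_nonneg_expMeasure (r : ℝ) : ∀ᵐ y ∂expMeasure r, 0 ≤ y := by
  rw [ae_iff]
  have : {y : ℝ | ¬ 0 ≤ y} = Set.Iio 0 := by ext; simp
  rw [this, expMeasure_eq_withDensity, withDensity_apply _ measurableSet_Iio]
  exact lintegral_exponentialPDF_of_nonpos le_rfl

/-- Memorylessness of the exponential law. -/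
theorem lintegral_expMeasure_Ioi {r s : ℝ} (hs : 0 ≤ s) {g : ℝ → ℝ≥0∞} (hg : Measurable g) :
    ∫⁻ y, (Set.Ioi s).indicator g y ∂expMeasure r
      = ENNReal.ofReal (Real.exp (-(r * s))) * ∫⁻ y, g (y + s) ∂expMeasure r := by
  have hgs : Measurable fun y => g (y + s) := hg.comp (measurable_id.add_const s)
  rw [lintegral_expMeasure r (hg.indicator measurableSet_Ioi), lintegral_expMeasure r hgs,
    ← lintegral_add_right_eq_self _ s,
    ← lintegral_const_mul _ (f := fun y => exponentialPDF r y * g (y + s))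
      ((measurable_exponentialPDF r).mul hgs)]
  refine lintegral_congr_ae ?_
  -- At `y = 0` the two integrands may differ: the open ray excludes `s`, while the density does not
  -- vanish at `0`.
  have h0 : ∀ᵐ y : ℝ, y ≠ 0 := by simp [ae_iff]
  filter_upwards [h0] with y hy
  rcases lt_or_gt_of_ne hy with h | h
  · have : y + s ∉ Set.Ioi s := by simp [h.le]
    simp [Set.indicator_of_notMem this, exponentialPDF_of_neg h]
  · have : y + s ∈ Set.Ioi s := by simp [h]
    rw [Set.indicator_of_mem this, exponentialPDF_of_nonneg h.le,
      exponentialPDF_of_nonneg (by linarith), ← mul_assoc,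
      ← ENNReal.ofReal_mul (Real.exp_pos _).le]
    congr 2
    rw [mul_left_comm, ← Real.exp_add]
    congr 2
    ring

/-- An exponential density tilted by an exponential is an exponential density of larger rate. -/
theorem lintegral_expMeasure_tilted {r c : ℝ} (hr : 0 < r) (hc : 0 < c) {g : ℝ → ℝ≥0∞}
    (hg : Measurable g) :
    ENNReal.ofReal c *
        ∫⁻ s, ENNReal.ofReal (Real.exp (-(r * s * (c - 1)))) * g s ∂expMeasure r
      = ∫⁻ y, g (y / (r * c)) ∂expMeasure 1 := by
  have hrc : 0 < r * c := mul_pos hr hc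
  have h1 : Measurable fun s => ENNReal.ofReal (Real.exp (-(r * s * (c - 1)))) := by fun_prop
  have hg2 : Measurable fun y => g (y / (r * c)) := hg.comp (measurable_id.div_const _)
  rw [lintegral_expMeasure r (g := fun s => ENNReal.ofReal (Real.exp (-(r * s * (c - 1)))) * g s)
    (h1.mul hg), lintegral_expMeasure 1 hg2]
  have h2 : ∀ φ : ℝ → ℝ≥0∞, ∫⁻ y, φ y = ENNReal.ofReal (r * c) * ∫⁻ y, φ (y * (r * c)) := by
    intro φ
    have h3 := Real.map_volume_mul_right hrc.ne'
    have h4 : MeasurableEmbedding fun y : ℝ => y * (r * c) :=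
      (Homeomorph.mulRight₀ (r * c) hrc.ne').measurableEmbedding
    rw [← h4.lintegral_map, h3, lintegral_smul_measure, smul_eq_mul, ← mul_assoc,
      ← ENNReal.ofReal_mul hrc.le, abs_of_pos (inv_pos.2 hrc), mul_inv_cancel₀ hrc.ne']
    simp
  rw [h2 (fun y => exponentialPDF 1 y * g (y / (r * c))), ← lintegral_const_mul _ (by
      exact (measurable_exponentialPDF r).mul (h1.mul hg)), ← lintegral_const_mul]
  · refine lintegral_congr fun y => ?_
    rw [mul_div_cancel_right₀ _ hrc.ne']
    rcases lt_or_ge y 0 with h | h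
    · rw [exponentialPDF_of_neg h, exponentialPDF_of_neg (mul_neg_of_neg_of_pos h hrc)]
      simp
    · rw [exponentialPDF_of_nonneg h, exponentialPDF_of_nonneg (by positivity), ← mul_assoc,
        ← mul_assoc, ← mul_assoc, ← ENNReal.ofReal_mul hc.le, ← ENNReal.ofReal_mul (by positivity),
        ← ENNReal.ofReal_mul hrc.le]
      congr 2
      rw [one_mul, mul_assoc c, mul_assoc r, ← Real.exp_add, one_mul, ← mul_assoc, mul_comm c r]
      congr 2
      ring
  · refine ((measurable_exponentialPDF 1).comp (measurable_id.mul_const _)).mul ?_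
    exact hg2.comp (measurable_id.mul_const _)

variable {ι : Type*} [Fintype ι] [DecidableEq ι]

/-- Fubini for a product measure, read as resampling the coordinate `e` independently of the others.
-/
theorem lintegral_pi_update {μ : ι → Measure ℝ} [∀ i, IsProbabilityMeasure (μ i)]
    {F : (ι → ℝ) → ℝ≥0∞} (hF : Measurable F) (e : ι) :
    ∫⁻ w, F w ∂Measure.pi μ
      = ∫⁻ w, ∫⁻ s, F (Function.update w e s) ∂μ e ∂Measure.pi μ := by
  have hG : Measurable fun w => ∫⁻ s, F (Function.update w e s) ∂μ e := by
    refine Measurable.lintegral_prod_right' (f := fun p : (ι → ℝ) × ℝ =>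
      F (Function.update p.1 e p.2)) ?_
    exact hF.comp measurable_update'
  rw [lintegral_eq_lmarginal_univ (fun _ => 0), lintegral_eq_lmarginal_univ (fun _ => 0),
    lmarginal_erase' _ hF (Finset.mem_univ e), lmarginal_erase' _ hG (Finset.mem_univ e)]
  simp

/-- Memorylessness for several coordinates of a product of exponential laws. -/
theorem lintegral_pi_expMeasure_shift {r : ℝ} (hr : 0 < r) {s : ℝ} (hs : 0 ≤ s)
    (D : Finset ι) {F : (ι → ℝ) → ℝ≥0∞} (hF : Measurable F) :
    ∫⁻ w, {w : ι → ℝ | ∀ i ∈ D, s < w i}.indicator F w ∂Measure.pi (fun _ => expMeasure r)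
      = ENNReal.ofReal (Real.exp (-(r * s * D.card))) *
        ∫⁻ w, F (fun i => w i + if i ∈ D then s else 0) ∂Measure.pi (fun _ => expMeasure r) := by
  have := isProbabilityMeasure_expMeasure hr
  induction D using Finset.induction_on generalizing F with
  | empty => simp
  | insert e D he ih =>
    have hset : MeasurableSet {w : ι → ℝ | s < w e} :=
      measurableSet_lt measurable_const (measurable_pi_apply e)
    have hFe := hF.indicator hset
    have h1 : {w : ι → ℝ | ∀ i ∈ insert e D, s < w i}.indicator F
        = {w : ι → ℝ | ∀ i ∈ D, s < w i}.indicator ({w : ι → ℝ | s < w e}.indicator F) := by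
      rw [Set.indicator_indicator]
      congr 1
      ext w
      simp [and_comm]
    have hsh : ∀ D : Finset ι, Measurable fun (w : ι → ℝ) i => w i + if i ∈ D then s else 0 := by
      intro D
      exact measurable_pi_lambda _ fun i => (measurable_pi_apply i).add_const _
    rw [h1, ih hFe, lintegral_pi_update (F := fun w => {w : ι → ℝ | s < w e}.indicator F
        fun i => w i + if i ∈ D then s else 0) (hFe.comp (hsh D)) e,
      lintegral_pi_update (F := fun w => F fun i => w i + if i ∈ insert e D then s else 0)
        (hF.comp (hsh (insert e D))) e, Finset.card_insert_of_notMem he]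
    have h2 : ∀ w : ι → ℝ,
        ∫⁻ y, {w : ι → ℝ | s < w e}.indicator F
          (fun i => Function.update w e y i + if i ∈ D then s else 0) ∂expMeasure r
        = ENNReal.ofReal (Real.exp (-(r * s))) *
          ∫⁻ y, F (fun i => Function.update w e y i + if i ∈ insert e D then s else 0)
            ∂expMeasure r := by
      intro w
      have h3 := lintegral_expMeasure_Ioi (r := r) hs
        (g := fun y => F (fun i => Function.update w e y i + if i ∈ D then s else 0))
        (hF.comp ((hsh D).comp (measurable_update w)))
      have h4 : ∀ y, (fun i => Function.update w e (y + s) i + if i ∈ D then s else 0)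
          = fun i => Function.update w e y i + if i ∈ insert e D then s else 0 := by
        intro y
        ext i
        by_cases hi : i = e
        · subst hi; simp [he]
        · simp [hi]
      simp only [h4] at h3
      rw [← h3]
      refine lintegral_congr fun y => ?_
      simp [Set.indicator, he]
    simp only [h2]
    rw [lintegral_const_mul, ← mul_assoc, ← ENNReal.ofReal_mul (Real.exp_pos _).le, ← Real.exp_add]
    · congr 4
      push_cast
      ring
    · refine Measurable.lintegral_prod_right' (f := fun p : (ι → ℝ) × ℝ =>
        F (fun i => Function.update p.1 e p.2 i + if i ∈ insert e D then s else 0)) ?_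
      exact (hF.comp (hsh (insert e D))).comp measurable_update'

/-- Conditioning independent exponential variables on their minimum over a set `C` of coordinates:
the waiting time until the minimum is exponential, and the excesses of the other coordinates are
again independent exponential variables. -/
theorem lintegral_expMeasure_le_lintegral_pi {r : ℝ} (hr : 0 < r) {C : Finset ι}
    (hC : C.Nonempty) {F : (ι → ℝ) → ℝ≥0∞} (hF : Measurable F) {g : ℝ → ℝ≥0∞}
    (hg : Measurable g)
    (h : ∀ s, 0 ≤ s → ∀ e ∈ C, g s ≤ ∫⁻ w, F (fun i => (if i ∈ C then s else 0) +
      if i = e then 0 else w i) ∂Measure.pi (fun _ => expMeasure r)) :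
    ∫⁻ y, g (y / (r * C.card)) ∂expMeasure 1
      ≤ ∫⁻ w, F w ∂Measure.pi (fun _ => expMeasure r) := by
  have := isProbabilityMeasure_expMeasure hr
  have hcard : (0 : ℝ) < C.card := by exact_mod_cast hC.card_pos
  -- `A e` is the event that `e` is the strict minimizer in `C`. Ties need no treatment: only a
  -- lower bound is claimed, so disjointness of these events is enough.
  set A : ι → Set (ι → ℝ) := fun e => {w | ∀ i ∈ C.erase e, w e < w i} with hA
  have hAm : ∀ e, MeasurableSet (A e) := by
    intro e
    have : A e = ⋂ i ∈ C.erase e, {w | w e < w i} := by ext; simp [hA]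
    rw [this]
    exact Finset.measurableSet_biInter _ fun i _ =>
      measurableSet_lt (measurable_pi_apply e) (measurable_pi_apply i)
  have hle : ∑ e ∈ C, ∫⁻ w, (A e).indicator F w ∂Measure.pi (fun _ => expMeasure r)
      ≤ ∫⁻ w, F w ∂Measure.pi (fun _ => expMeasure r) := by
    rw [← lintegral_finsetSum _ fun e _ => hF.indicator (hAm e)]
    refine lintegral_mono fun w => ?_
    by_cases hex : ∃ e ∈ C, w ∈ A e
    · obtain ⟨e, he, hw⟩ := hex
      rw [Finset.sum_eq_single_of_mem e he]
      · exact Set.indicator_le_self _ _ _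
      · intro e' he' hne
        refine Set.indicator_of_notMem (fun hw' => ?_) _
        exact lt_asymm (hw e' (Finset.mem_erase.2 ⟨hne, he'⟩))
          (hw' e (Finset.mem_erase.2 ⟨hne.symm, he⟩))
    · push Not at hex
      rw [Finset.sum_eq_zero fun e he => Set.indicator_of_notMem (hex e he) _]
      exact zero_le
  refine le_trans ?_ hle
  -- The factor `C.card` of the tilted density is spread over the possible minimizers. Given `w e =
  -- s`, the other `C.card - 1` coordinates exceed `s` with probability `exp (-r s (C.card - 1))`,
  -- which is exactly the tilt.
  rw [← lintegral_expMeasure_tilted hr hcard hg, ENNReal.ofReal_natCast, ← nsmul_eq_mul,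
    ← Finset.sum_const]
  refine Finset.sum_le_sum fun e he => ?_
  have hcard' : ((C.erase e).card : ℝ) = C.card - 1 := by
    rw [Finset.card_erase_of_mem he, Nat.cast_sub hC.card_pos, Nat.cast_one]
  have hup : Measurable fun p : (ι → ℝ) × ℝ => (A e).indicator F (Function.update p.1 e p.2) :=
    (hF.indicator (hAm e)).comp measurable_update'
  rw [lintegral_pi_update (hF.indicator (hAm e)) e, lintegral_lintegral_swap hup.aemeasurable]
  refine lintegral_mono_ae ?_
  filter_upwards [ae_nonneg_expMeasure r] with s hs
  have hFs : Measurable fun w => F (Function.update w e s) := hF.comp measurable_update_left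
  have h1 : ∀ w, (A e).indicator F (Function.update w e s)
      = {w : ι → ℝ | ∀ i ∈ C.erase e, s < w i}.indicator (fun w => F (Function.update w e s)) w := by
    intro w
    simp only [Set.indicator, hA, Set.mem_ofPred_eq, Function.update_self]
    refine if_congr (forall₂_congr fun i hi => ?_) rfl rfl
    rw [Function.update_of_ne (Finset.ne_of_mem_erase hi)]
  simp only [h1]
  rw [lintegral_pi_expMeasure_shift hr hs _ hFs, hcard']
  gcongr
  refine (h s hs e he).trans (le_of_eq (lintegral_congr fun w => ?_))
  congr 1
  ext i
  by_cases hi : i = e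
  · subst hi; simp [he]
  · simp [hi, add_comm]

end ExponentialMinimum

/-! ### Deterministic bookkeeping of the successive growth of disjoint balls. -/

section Exploration

variable {n : ℕ}

/-- The edge weights `off`, to which `w` is added on the edges outside `Z`. -/
noncomputable def reweight (off : CompleteEdge n → ℝ) (Z : Finset (Sym2 (Fin n)))
    (w : CompleteEdge n → ℝ) (e : CompleteEdge n) : ℝ :=
  off e + if (e : Sym2 (Fin n)) ∈ Z then 0 else w e

/-- The sum of the first `i` waiting times in the exploration of the ball number `γ`. -/
noncomputable def arrival (τ : ℕ × ℕ → ℝ) (γ i : ℕ) : ℝ := ∑ l ∈ Finset.range i, τ (γ, l)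

/-- The vertex `y` is none of the vertices `b γ i` with `γ < m` and `i ≤ κ γ`. -/
def Unexplored (m : ℕ) (κ : ℕ → ℕ) (b : ℕ → ℕ → Fin n) (y : Fin n) : Prop :=
  ∀ γ < m, ∀ i ≤ κ γ, b γ i ≠ y

/-- The pair joins an explored vertex of the ball number `α` to an unexplored vertex. -/
def IsBoundary (m : ℕ) (κ : ℕ → ℕ) (b : ℕ → ℕ → Fin n) (α : ℕ) (p : Sym2 (Fin n)) : Prop :=
  ∃ i ≤ κ α, ∃ y, Unexplored m κ b y ∧ p = s(b α i, y)

open Classical in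
/-- The boundary edges of the ball number `α`. -/
noncomputable def boundary (m : ℕ) (κ : ℕ → ℕ) (b : ℕ → ℕ → Fin n) (α : ℕ) :
    Finset (CompleteEdge n) :=
  Finset.univ.filter fun e => IsBoundary m κ b α e

/-- The state of a successive exploration of disjoint balls around the roots `ρ 0, …, ρ (m - 1)`:
the ball number `γ` consists of the vertices `b γ 0, …, b γ (κ γ)`, which are reached after the
waiting times `τ (γ, l)`. The weight of an edge is `off` on the edges in `Z`, and known to be
at least `off` on the other edges. -/
structure Explored (ρ : ℕ → Fin n) (m : ℕ) (κ : ℕ → ℕ) (τ : ℕ × ℕ → ℝ)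
    (off : CompleteEdge n → ℝ) (Z : Finset (Sym2 (Fin n))) (b : ℕ → ℕ → Fin n) : Prop where
  inj : ∀ γ < m, ∀ γ' < m, ∀ i ≤ κ γ, ∀ i' ≤ κ γ', b γ i = b γ' i' → γ = γ' ∧ i = i'
  root : ∀ γ < m, b γ 0 = ρ γ
  off_nonneg : ∀ e, 0 ≤ off e
  wait_nonneg : ∀ γ < m, ∀ l < κ γ, 0 ≤ τ (γ, l)
  outside : ∀ x y, Unexplored m κ b x → Unexplored m κ b y → x ≠ y →
    edgeWeight off x y = 0 ∧ s(x, y) ∉ Z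
  weight_boundary : ∀ γ < m, ∀ i ≤ κ γ, ∀ y, Unexplored m κ b y →
    edgeWeight off (b γ i) y = arrival τ γ (κ γ) - arrival τ γ i ∧ s(b γ i, y) ∉ Z
  -- All roots count as explored from the start, so an edge from ball `γ` to a later root was never
  -- a boundary edge and nothing is known about it. Any other vertex of ball `γ'` was unexplored
  -- while ball `γ` grew, so its edge to `b γ i` has been observed since the arrival of `b γ i`.
  cross : ∀ γ γ', γ < γ' → γ' < m → ∀ i ≤ κ γ, ∀ i' ≤ κ γ',
    edgeWeight off (b γ i) (b γ' i') =
      (if i' = 0 then 0 else arrival τ γ (κ γ) - arrival τ γ i) ∧ s(b γ i, b γ' i') ∉ Z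
  inside : ∀ γ < m, ∀ i' ≤ κ γ, ∀ i < i',
    arrival τ γ i' - arrival τ γ i ≤ edgeWeight off (b γ i) (b γ i')
  tree : ∀ γ < m, ∀ i' ≤ κ γ, 0 < i' → ∃ i < i', s(b γ i, b γ i') ∈ Z ∧
    edgeWeight off (b γ i) (b γ i') = arrival τ γ i' - arrival τ γ i

theorem edgeWeight_add_ite (off : CompleteEdge n → ℝ) (p : Sym2 (Fin n) → Prop)
    [DecidablePred p] (s : ℝ) {x y : Fin n} (hxy : x ≠ y) :
    edgeWeight (fun e => off e + if p e then s else 0) x y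
      = edgeWeight off x y + if p s(x, y) then s else 0 := by
  simp only [edgeWeight_of_ne _ hxy]

theorem arrival_update_of_le (κ : ℕ → ℕ) (τ : ℕ × ℕ → ℝ) (α : ℕ) (s : ℝ) {γ i : ℕ}
    (hi : i ≤ κ γ) : arrival (Function.update τ (α, κ α) s) γ i = arrival τ γ i := by
  refine Finset.sum_congr rfl fun l hl => ?_
  rw [Function.update_of_ne]
  rintro h
  obtain ⟨rfl, rfl⟩ := Prod.mk.inj h
  exact absurd (Finset.mem_range.1 hl) (by omega)

theorem arrival_update_succ (κ : ℕ → ℕ) (τ : ℕ × ℕ → ℝ) (α : ℕ) (s : ℝ) :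
    arrival (Function.update τ (α, κ α) s) α (κ α + 1) = arrival τ α (κ α) + s := by
  have := arrival_update_of_le κ τ α s (le_refl (κ α))
  unfold arrival at this ⊢
  rw [Finset.sum_range_succ, this, Function.update_self]

open Classical in
/-- One step of the exploration: the vertex `y` is added to the ball number `α`, through the edge
from `b α j`, after the waiting time `s`. -/
theorem Explored.step {ρ : ℕ → Fin n} {m : ℕ} {κ : ℕ → ℕ} {τ : ℕ × ℕ → ℝ}
    {off : CompleteEdge n → ℝ} {Z : Finset (Sym2 (Fin n))} {b : ℕ → ℕ → Fin n}
    (h : Explored ρ m κ τ off Z b) {α : ℕ} (hα : α < m)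
    (hlater : ∀ γ, α < γ → γ < m → κ γ = 0) {s : ℝ} (hs : 0 ≤ s) {j : ℕ} (hj : j ≤ κ α)
    {v : Fin n} (hv : Unexplored m κ b v) :
    Explored ρ m (Function.update κ α (κ α + 1)) (Function.update τ (α, κ α) s)
      (fun e => off e + if IsBoundary m κ b α e then s else 0) (insert s(b α j, v) Z)
      (Function.update b α (Function.update (b α) (κ α + 1) v)) := by
  set κ' := Function.update κ α (κ α + 1) with hκ'
  set τ' := Function.update τ (α, κ α) s with hτ'
  set b' := Function.update b α (Function.update (b α) (κ α + 1) v) with hb'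
  have hκα : κ' α = κ α + 1 := by simp [hκ']
  have hκne : ∀ γ, γ ≠ α → κ' γ = κ γ := fun γ hγ => by simp [hκ', hγ]
  have hκle : ∀ γ, κ γ ≤ κ' γ := by
    intro γ
    by_cases hγ : γ = α
    · subst hγ; omega
    · rw [hκne γ hγ]
  have bold : ∀ γ i, i ≤ κ γ → b' γ i = b γ i := by
    intro γ i hi
    by_cases hγ : γ = α
    · subst hγ
      simp only [hb', Function.update_self]
      rw [Function.update_of_ne (by omega)]
    · simp [hb', hγ]
  have bnew : b' α (κ α + 1) = v := by simp [hb']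
  have aold : ∀ γ i, i ≤ κ γ → arrival τ' γ i = arrival τ γ i := fun γ i hi =>
    arrival_update_of_le κ τ α s hi
  have anew : arrival τ' α (κ α + 1) = arrival τ α (κ α) + s := arrival_update_succ κ τ α s
  have clock : ∀ γ, γ ≠ α → arrival τ' γ (κ' γ) = arrival τ γ (κ γ) := fun γ hγ => by
    rw [hκne γ hγ, aold γ _ le_rfl]
  have clockα : arrival τ' α (κ' α) = arrival τ α (κ α) + s := by rw [hκα, anew]
  have cases' : ∀ γ i, i ≤ κ' γ → i ≤ κ γ ∨ (γ = α ∧ i = κ α + 1) := by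
    intro γ i hi
    by_cases hγ : γ = α
    · subst hγ; omega
    · left; rwa [hκne γ hγ] at hi
  have unold : ∀ y, Unexplored m κ' b' y → Unexplored m κ b y ∧ y ≠ v := by
    intro y hy
    refine ⟨fun γ hγ i hi => ?_, ?_⟩
    · rw [← bold γ i hi]; exact hy γ hγ i (hi.trans (hκle γ))
    · rintro rfl
      exact hy α hα (κ α + 1) hκα.ge bnew
  have cut_bd : ∀ γ < m, ∀ i ≤ κ γ, ∀ y, Unexplored m κ b y →
      (IsBoundary m κ b α s(b γ i, y) ↔ γ = α) := by
    intro γ hγ i hi y hy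
    constructor
    · rintro ⟨i', hi', y', hy', he⟩
      rcases Sym2.eq_iff.1 he with ⟨h1, -⟩ | ⟨h1, -⟩
      · exact (h.inj γ hγ α hα i hi i' hi' h1).1
      · exact absurd h1 (hy' γ hγ i hi)
    · rintro rfl
      exact ⟨i, hi, y, hy, rfl⟩
  have cut_in : ∀ γ < m, ∀ i ≤ κ γ, ∀ γ' < m, ∀ i' ≤ κ γ',
      ¬ IsBoundary m κ b α s(b γ i, b γ' i') := by
    rintro γ hγ i hi γ' hγ' i' hi' ⟨k, hk, y, hy, he⟩
    rcases Sym2.eq_iff.1 he with ⟨-, h1⟩ | ⟨h1, -⟩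
    · exact hy _ hγ' _ hi' h1
    · exact hy _ hγ _ hi h1
  have cut_out : ∀ x y, Unexplored m κ b x → Unexplored m κ b y →
      ¬ IsBoundary m κ b α s(x, y) := by
    rintro x y hx hy ⟨k, hk, z, hz, he⟩
    rcases Sym2.eq_iff.1 he with ⟨h1, -⟩ | ⟨-, h1⟩
    · exact hx _ hα _ hk h1.symm
    · exact hy _ hα _ hk h1.symm
  have ew : ∀ x y, x ≠ y →
      edgeWeight (fun e : CompleteEdge n => off e + if IsBoundary m κ b α e then s else 0) x y
        = edgeWeight off x y + if IsBoundary m κ b α s(x, y) then s else 0 :=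
    fun x y hxy => edgeWeight_add_ite off _ s hxy
  have ne_in : ∀ γ < m, ∀ i ≤ κ γ, ∀ γ' < m, ∀ i' ≤ κ γ', (γ ≠ γ' ∨ i ≠ i') →
      b γ i ≠ b γ' i' := by
    intro γ hγ i hi γ' hγ' i' hi' hne he
    have := h.inj γ hγ γ' hγ' i hi i' hi' he
    tauto
  refine ⟨?_, ?_, ?_, ?_, ?_, ?_, ?_, ?_, ?_⟩
  · intro γ hγ γ' hγ' i hi i' hi' he
    rcases cases' γ i hi with h1 | ⟨rfl, rfl⟩ <;> rcases cases' γ' i' hi' with h2 | ⟨rfl, rfl⟩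
    · rw [bold _ _ h1, bold _ _ h2] at he
      exact h.inj γ hγ γ' hγ' i h1 i' h2 he
    · rw [bold _ _ h1, bnew] at he
      exact absurd he (hv γ hγ i h1)
    · rw [bold _ _ h2, bnew] at he
      exact absurd he.symm (hv γ' hγ' i' h2)
    · exact ⟨rfl, rfl⟩
  · intro γ hγ
    rw [bold γ 0 (Nat.zero_le _), h.root γ hγ]
  · intro e
    have := h.off_nonneg e
    split_ifs <;> linarith
  · intro γ hγ l hl
    by_cases heq : (γ, l) = (α, κ α)
    · rw [hτ', heq, Function.update_self]; exact hs
    · rw [hτ', Function.update_of_ne heq]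
      refine h.wait_nonneg γ hγ l ?_
      rcases cases' γ (l + 1) hl with h1 | ⟨rfl, h1⟩
      · omega
      · exact absurd (by rw [Nat.succ_injective h1]) heq
  · intro x y hx hy hxy
    obtain ⟨hx1, hx2⟩ := unold x hx
    obtain ⟨hy1, hy2⟩ := unold y hy
    obtain ⟨h1, h2⟩ := h.outside x y hx1 hy1 hxy
    refine ⟨by rw [ew x y hxy, h1, if_neg (cut_out x y hx1 hy1), add_zero], fun hmem => ?_⟩
    rcases Finset.mem_insert.1 hmem with he | he
    · rcases Sym2.eq_iff.1 he with ⟨-, h3⟩ | ⟨h3, -⟩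
      · exact hy2 h3
      · exact hx2 h3
    · exact h2 he
  · intro γ hγ i hi y hy
    obtain ⟨hy1, hy2⟩ := unold y hy
    rcases cases' γ i hi with h1 | ⟨rfl, rfl⟩
    · obtain ⟨h2, h3⟩ := h.weight_boundary γ hγ i h1 y hy1
      rw [bold γ i h1, ew _ _ (hy1 γ hγ i h1), h2, aold γ i h1]
      refine ⟨?_, fun hmem => ?_⟩
      · by_cases hγα : γ = α
        · subst hγα
          rw [if_pos ((cut_bd γ hγ i h1 y hy1).2 rfl), clockα]
          ring
        · rw [if_neg (fun hc => hγα ((cut_bd γ hγ i h1 y hy1).1 hc)), clock γ hγα, add_zero]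
      · rcases Finset.mem_insert.1 hmem with he | he
        · rcases Sym2.eq_iff.1 he with ⟨-, h4⟩ | ⟨h4, -⟩
          · exact hy2 h4
          · exact hv γ hγ i h1 h4
        · exact h3 he
    · obtain ⟨h2, h3⟩ := h.outside v y hv hy1 hy2.symm
      rw [bnew, ew _ _ hy2.symm, h2, if_neg (cut_out v y hv hy1), hκα]
      refine ⟨by ring, fun hmem => ?_⟩
      rcases Finset.mem_insert.1 hmem with he | he
      · rcases Sym2.eq_iff.1 he with ⟨-, h4⟩ | ⟨-, h4⟩
        · exact hy2 h4
        · exact hy1 γ hγ j hj h4.symm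
      · exact h3 he
  · intro γ γ' hlt hγ' i hi i' hi'
    have hγ := hlt.trans hγ'
    rcases cases' γ i hi with h1 | ⟨rfl, rfl⟩ <;> rcases cases' γ' i' hi' with h2 | ⟨rfl, rfl⟩
    · obtain ⟨h3, h4⟩ := h.cross γ γ' hlt hγ' i h1 i' h2
      rw [bold _ _ h1, bold _ _ h2, ew _ _ (ne_in γ hγ i h1 γ' hγ' i' h2 (Or.inl hlt.ne)), h3,
        if_neg (cut_in γ hγ i h1 γ' hγ' i' h2), add_zero, aold γ i h1]
      refine ⟨?_, fun hmem => ?_⟩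
      · by_cases hγα : γ = α
        · subst hγα
          have : i' = 0 := by have := hlater γ' hlt hγ'; omega
          simp [this]
        · rw [clock γ hγα]
      · rcases Finset.mem_insert.1 hmem with he | he
        · rcases Sym2.eq_iff.1 he with ⟨-, h5⟩ | ⟨h5, -⟩
          · exact hv _ hγ' _ h2 h5
          · exact hv _ hγ _ h1 h5
        · exact h4 he
    · obtain ⟨h3, h4⟩ := h.weight_boundary γ hγ i h1 v hv
      rw [bold _ _ h1, bnew, ew _ _ (hv γ hγ i h1), h3,
        if_neg (fun hc => hlt.ne ((cut_bd γ hγ i h1 v hv).1 hc)), add_zero, aold γ i h1,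
        clock γ hlt.ne, if_neg (Nat.succ_ne_zero _)]
      refine ⟨rfl, fun hmem => ?_⟩
      rcases Finset.mem_insert.1 hmem with he | he
      · rcases Sym2.eq_iff.1 he with ⟨h5, -⟩ | ⟨h5, -⟩
        · exact hlt.ne (h.inj γ hγ γ' hγ' i h1 j hj h5).1
        · exact hv _ hγ _ h1 h5
      · exact h4 he
    -- The new vertex of ball `α` faces a later ball, which is still only its root. Their edge was a
    -- boundary edge of that root, whose clock has not started, so its offset is `0`.
    · have hi0 : i' = 0 := by have := hlater γ' hlt hγ'; omega
      obtain ⟨h3, h4⟩ := h.weight_boundary γ' hγ' i' h2 v hv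
      have hne := hv γ' hγ' i' h2
      have hκ0 := hlater γ' hlt hγ'
      rw [bold _ _ h2, bnew, ew _ _ hne.symm, edgeWeight_comm, h3, Sym2.eq_swap,
        if_neg (fun hc => hlt.ne' ((cut_bd γ' hγ' i' h2 v hv).1 hc)), if_pos hi0, hκ0, hi0]
      refine ⟨by ring, fun hmem => ?_⟩
      rw [hi0] at h4
      rcases Finset.mem_insert.1 hmem with he | he
      · rcases Sym2.eq_iff.1 he with ⟨h5, -⟩ | ⟨h5, -⟩
        · exact hlt.ne' (h.inj γ' hγ' γ hγ 0 (Nat.zero_le _) j hj h5).1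
        · exact hv _ hγ' _ (Nat.zero_le _) h5
      · exact h4 he
    · exact absurd rfl hlt.ne
  · intro γ hγ i' hi' i hlt
    have h1 : i ≤ κ γ := by
      rcases cases' γ i' hi' with h1 | ⟨rfl, rfl⟩ <;> omega
    rcases cases' γ i' hi' with h2 | ⟨rfl, rfl⟩
    · rw [bold _ _ h1, bold _ _ h2, aold _ _ h1, aold _ _ h2,
        ew _ _ (ne_in γ hγ i h1 γ hγ i' h2 (Or.inr hlt.ne)),
        if_neg (cut_in γ hγ i h1 γ hγ i' h2), add_zero]
      exact h.inside γ hγ i' h2 i hlt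
    · rw [bold _ _ h1, bnew, aold _ _ h1, anew, ew _ _ (hv γ hγ i h1),
        (h.weight_boundary γ hγ i h1 v hv).1, if_pos ((cut_bd γ hγ i h1 v hv).2 rfl)]
      linarith
  · intro γ hγ i' hi' hpos
    rcases cases' γ i' hi' with h2 | ⟨rfl, rfl⟩
    · obtain ⟨i, hlt, hZ, he⟩ := h.tree γ hγ i' h2 hpos
      have h1 : i ≤ κ γ := by omega
      refine ⟨i, hlt, ?_, ?_⟩
      · rw [bold _ _ h1, bold _ _ h2]
        exact Finset.mem_insert_of_mem hZ
      · rw [bold _ _ h1, bold _ _ h2, aold _ _ h1, aold _ _ h2,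
          ew _ _ (ne_in γ hγ i h1 γ hγ i' h2 (Or.inr hlt.ne)),
          if_neg (cut_in γ hγ i h1 γ hγ i' h2), add_zero, he]
    · refine ⟨j, by omega, ?_, ?_⟩
      · rw [bold _ _ hj, bnew]
        exact Finset.mem_insert_self _ _
      · rw [bold _ _ hj, bnew, aold _ _ hj, anew, ew _ _ (hv γ hγ j hj),
          (h.weight_boundary γ hγ j hj v hv).1, if_pos ((cut_bd γ hγ j hj v hv).2 rfl)]
        ring

theorem Explored.init {ρ : ℕ → Fin n} {m : ℕ} (hρ : ∀ γ < m, ∀ γ' < m, ρ γ = ρ γ' → γ = γ')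
    (τ : ℕ × ℕ → ℝ) :
    Explored ρ m (fun _ => 0) τ (fun _ => 0) ∅ (fun γ _ => ρ γ) := by
  have h0 : ∀ x y : Fin n, edgeWeight (fun _ => 0) x y = 0 := fun x y => by simp [edgeWeight]
  refine ⟨?_, fun _ _ => rfl, fun _ => le_rfl, fun _ _ l hl => absurd hl (Nat.not_lt_zero l),
    fun x y _ _ _ => ⟨h0 x y, by simp⟩, ?_, ?_, ?_, ?_⟩
  · intro γ hγ γ' hγ' i hi i' hi' he
    exact ⟨hρ γ hγ γ' hγ' he, by omega⟩
  · intro γ hγ i hi y hy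
    have : i = 0 := by omega
    simp [h0, this]
  · intro γ γ' _ _ i _ i' hi'
    have : i' = 0 := by omega
    simp [h0, this]
  · intro γ _ i' hi' i hi
    omega
  · intro γ _ i' hi' hpos
    omega

/-- The number of unexplored vertices. -/
theorem Explored.card_unexplored {ρ : ℕ → Fin n} {m : ℕ}
    {κ : ℕ → ℕ} {τ : ℕ × ℕ → ℝ}
    {off : CompleteEdge n → ℝ} {Z : Finset (Sym2 (Fin n))} {b : ℕ → ℕ → Fin n}
    (h : Explored ρ m κ τ off Z b) [DecidablePred (Unexplored m κ b)] :
    (Finset.univ.filter (Unexplored m κ b)).card + ∑ γ ∈ Finset.range m, (κ γ + 1) = n := by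
  classical
  set S := (Finset.range m).sigma fun γ => Finset.range (κ γ + 1) with hS
  have hcard : S.card = ∑ γ ∈ Finset.range m, (κ γ + 1) := by simp [hS]
  have hinj : Set.InjOn (fun p : (_ : ℕ) × ℕ => b p.1 p.2) S := by
    rintro ⟨γ, i⟩ hp ⟨γ', i'⟩ hp' he
    simp only [hS, Finset.coe_sigma, Set.mem_sigma_iff, Finset.mem_coe, Finset.mem_range] at hp hp'
    obtain ⟨h1, h2⟩ := h.inj γ hp.1 γ' hp'.1 i (by omega) i' (by omega) he
    simp [h1, h2]
  have himg : Finset.univ.filter (Unexplored m κ b)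
      = (S.image fun p : (_ : ℕ) × ℕ => b p.1 p.2)ᶜ := by
    ext y
    simp only [Finset.mem_filter, Finset.mem_univ, true_and, Finset.mem_compl, Finset.mem_image,
      hS, Finset.mem_sigma, Finset.mem_range, Unexplored, Sigma.exists, not_exists, not_and]
    constructor
    · rintro h1 γ i ⟨hγ, hi⟩
      exact h1 γ hγ i (by omega)
    · intro h1 γ hγ i hi
      exact h1 γ i ⟨hγ, by omega⟩
  rw [himg, ← hcard, ← Finset.card_image_of_injOn hinj, Finset.card_compl_add_card,
    Fintype.card_fin]

theorem mem_boundary {m : ℕ} {κ : ℕ → ℕ} {b : ℕ → ℕ → Fin n} {α : ℕ} {e : CompleteEdge n} :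
    e ∈ boundary m κ b α ↔ IsBoundary m κ b α e := by
  simp [boundary]

/-- The number of boundary edges of a ball. -/
theorem Explored.card_boundary {ρ : ℕ → Fin n} {m : ℕ} {κ : ℕ → ℕ} {τ : ℕ × ℕ → ℝ}
    {off : CompleteEdge n → ℝ} {Z : Finset (Sym2 (Fin n))} {b : ℕ → ℕ → Fin n}
    (h : Explored ρ m κ τ off Z b) {α : ℕ} (hα : α < m) [DecidablePred (Unexplored m κ b)] :
    (boundary m κ b α).card
      = (κ α + 1) * (Finset.univ.filter (Unexplored m κ b)).card := by
  classical
  rw [← Finset.card_map (Function.Embedding.subtype _), ← Finset.card_range (κ α + 1),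
    ← Finset.card_product]
  symm
  refine Finset.card_bij (fun p _ => s(b α p.1, p.2)) ?_ ?_ ?_
  · rintro ⟨i, y⟩ hp
    simp only [Finset.mem_product, Finset.mem_range, Finset.mem_filter, Finset.mem_univ,
      true_and] at hp
    have hi : i ≤ κ α := by omega
    simp only [Finset.mem_map, Function.Embedding.subtype_apply, mem_boundary]
    exact ⟨⟨s(b α i, y), by simpa using hp.2 α hα i hi⟩, ⟨i, hi, y, hp.2, rfl⟩, rfl⟩
  · rintro ⟨i, y⟩ hp ⟨i', y'⟩ hp' he
    simp only [Finset.mem_product, Finset.mem_range, Finset.mem_filter, Finset.mem_univ,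
      true_and] at hp hp'
    rcases Sym2.eq_iff.1 he with ⟨h1, h2⟩ | ⟨h1, h2⟩
    · exact Prod.ext (h.inj α hα α hα i (by omega) i' (by omega) h1).2 h2
    · exact absurd h1 (hp'.2 α hα i (by omega))
  · intro p hp
    simp only [Finset.mem_map, Function.Embedding.subtype_apply, mem_boundary] at hp
    obtain ⟨e, ⟨i, hi, y, hy, he⟩, rfl⟩ := hp
    refine ⟨(i, y), ?_, he.symm⟩
    simp only [Finset.mem_product, Finset.mem_range, Finset.mem_filter, Finset.mem_univ, true_and]
    exact ⟨by omega, hy⟩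

end Exploration

/-! ### Integrating over the exploration, with independent standard exponential waiting times. -/

section Chain

open scoped ENNReal

variable {n : ℕ}

/-- The law of the edge weights. -/
noncomputable def weightLaw (n : ℕ) : Measure (CompleteEdge n → ℝ) :=
  Measure.pi fun _ => expMeasure (1 / (n : ℝ))

/-- The ball sizes when the balls with number less than `α` are complete, with `a` steps each,
and the ball number `α` has made `j` steps. -/
def ballSteps (a α j γ : ℕ) : ℕ := if γ < α then a else if γ = α then j else 0

/-- The waiting times in the successive exploration of `m` balls with `a` steps each,
in terms of standard exponential variables. -/
noncomputable def waiting (n m a : ℕ) (ξ : ℕ × ℕ → ℝ) (p : ℕ × ℕ) : ℝ :=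
  ξ p / (1 / (n : ℝ) * ((p.2 + 1) * (n - m - p.1 * a - p.2)))

theorem measurable_reweight (off : CompleteEdge n → ℝ) (Z : Finset (Sym2 (Fin n))) :
    Measurable (reweight off Z) := by
  refine measurable_pi_lambda _ fun e => ?_
  unfold reweight
  split_ifs
  · exact measurable_const
  · exact (measurable_pi_apply e).const_add _

theorem ballSteps_succ (a α j : ℕ) :
    Function.update (ballSteps a α j) α (ballSteps a α j α + 1) = ballSteps a α (j + 1) := by
  ext γ
  by_cases h : γ = α
  · subst h; simp [ballSteps]
  · simp [ballSteps, h]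

theorem ballSteps_complete (a α : ℕ) : ballSteps a α a = ballSteps a (α + 1) 0 := by
  ext γ
  unfold ballSteps
  split_ifs <;> omega

theorem sum_ballSteps {m α : ℕ} (hα : α < m) (a j : ℕ) :
    ∑ γ ∈ Finset.range m, (ballSteps a α j γ + 1) = α * a + j + m := by
  rw [Finset.sum_add_distrib, Finset.sum_const, Finset.card_range, smul_eq_mul, mul_one]
  congr 1
  rw [← Finset.sum_range_add_sum_Ico _ hα.le, Finset.sum_eq_sum_Ico_succ_bot hα,
    Finset.sum_congr rfl (g := fun _ => a)
      (fun γ hγ => by simp [ballSteps, Finset.mem_range.1 hγ]),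
    Finset.sum_eq_zero (s := Finset.Ico (α + 1) m) (fun γ hγ => by
      have := (Finset.mem_Ico.1 hγ).1
      unfold ballSteps
      split_ifs <;> omega)]
  simp [ballSteps]

theorem waiting_update (m a : ℕ) (ξ : ℕ × ℕ → ℝ) (p : ℕ × ℕ) (y : ℝ) :
    waiting n m a (Function.update ξ p y)
      = Function.update (waiting n m a ξ) p
        (y / (1 / (n : ℝ) * ((p.2 + 1) * (n - m - p.1 * a - p.2)))) := by
  ext q
  by_cases h : q = p
  · subst h; simp [waiting]
  · simp [waiting, h]

/-- The next vertex of ball `α` is found at the minimum of the weight excesses over its boundary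
edges. There are `(j + 1) (n - m - α a - j)` of them, which is the rate by which `waiting` divides
`ξ (α, j)`. Whichever edge is minimal, `Explored.step` gives an admissible state with fresh
excesses, so the bound assumed for later states applies. -/
theorem Explored.lintegral_step {ρ : ℕ → Fin n} {m a α j : ℕ} (hα : α < m) (hj : j < a)
    (hn : m + m * a ≤ n) {ξ : ℕ × ℕ → ℝ} {off : CompleteEdge n → ℝ} {Z : Finset (Sym2 (Fin n))}
    {b : ℕ → ℕ → Fin n} (h : Explored ρ m (ballSteps a α j) (waiting n m a ξ) off Z b)
    {F : (CompleteEdge n → ℝ) → ℝ≥0∞} (hF : Measurable F) {G : (ℕ × ℕ → ℝ) → ℝ≥0∞}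
    (hG : Measurable G)
    (H : ∀ ξ' off' Z' b', Explored ρ m (ballSteps a α (j + 1)) (waiting n m a ξ') off' Z' b' →
      G ξ' ≤ ∫⁻ w, F (reweight off' Z' w) ∂weightLaw n) :
    ∫⁻ y, G (Function.update ξ (α, j) y) ∂expMeasure 1
      ≤ ∫⁻ w, F (reweight off Z w) ∂weightLaw n := by
  classical
  have hαa : α * a + a ≤ m * a := by
    calc α * a + a = (α + 1) * a := by ring
      _ ≤ m * a := Nat.mul_le_mul_right _ hα
  have hn0 : (0 : ℝ) < n := by
    have : 0 < n := by omega
    exact_mod_cast this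
  set C := _root_.boundary m (ballSteps a α j) b α with hC
  have hstep : ballSteps a α j α = j := by simp [ballSteps]
  have hU := h.card_unexplored
  rw [sum_ballSteps hα] at hU
  have hcard := h.card_boundary hα
  rw [hstep, ← hC] at hcard
  set u := (Finset.univ.filter (Unexplored m (ballSteps a α j) b)).card with hu
  have hu0 : 0 < u := by omega
  have hCpos : 0 < C.card := by rw [hcard]; positivity
  have hCne : C.Nonempty := Finset.card_pos.1 hCpos
  have hrate : (1 / (n : ℝ)) * C.card = 1 / (n : ℝ) * ((j + 1) * (n - m - α * a - j)) := by
    rw [hcard]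
    have : (u : ℝ) = n - m - α * a - j := by
      rw [← hU]; push_cast; ring
    rw [← this]
    push_cast
    rfl
  have hratepos : 0 < (1 / (n : ℝ)) * C.card := by
    have : (0 : ℝ) < C.card := by exact_mod_cast hCpos
    positivity
  have key := lintegral_expMeasure_le_lintegral_pi (one_div_pos.2 hn0) hCne
    (F := fun w => F (reweight off Z w)) (hF.comp (measurable_reweight off Z))
    (g := fun s => G (Function.update ξ (α, j) (s * (1 / (n : ℝ) * C.card))))
    (hG.comp ((measurable_update ξ).comp (measurable_id.mul_const _))) ?_
  · simp only [div_mul_cancel₀ _ hratepos.ne'] at key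
    exact key
  · intro s hs e he
    obtain ⟨i, hi, y, hy, hey⟩ := mem_boundary.1 he
    have hlater : ∀ γ, α < γ → γ < m → ballSteps a α j γ = 0 := by
      intro γ h1 _
      unfold ballSteps
      split_ifs <;> omega
    have h' := h.step hα hlater hs hi hy
    rw [ballSteps_succ, hstep] at h'
    have hw : Function.update (waiting n m a ξ) (α, j) s
        = waiting n m a (Function.update ξ (α, j) (s * (1 / (n : ℝ) * C.card))) := by
      rw [waiting_update, hrate, mul_div_cancel_right₀]
      rw [← hrate]
      exact hratepos.ne'
    rw [hw] at h'
    refine (H _ _ _ _ h').trans (le_of_eq (lintegral_congr fun w => ?_))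
    congr 1
    ext e'
    -- Boundary edges are never in `Z`, so they still carry a fresh excess, into which the waiting
    -- time can be absorbed.
    have hZ : e' ∈ C → (e' : Sym2 (Fin n)) ∉ Z := by
      intro he'
      obtain ⟨i', hi', y', hy', hey'⟩ := mem_boundary.1 he'
      rw [hey']
      exact (h.weight_boundary α hα i' hi' y' hy').2
    have hee : (e' : Sym2 (Fin n)) = s(b α i, y) ↔ e' = e := by
      rw [← hey]
      exact Subtype.coe_injective.eq_iff
    have hmem : IsBoundary m (ballSteps a α j) b α e' ↔ e' ∈ C := mem_boundary.symm
    simp only [reweight, Finset.mem_insert, hee, hmem]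
    by_cases h1 : e' = e
    · subst h1
      simp [he, hZ he]
    · by_cases h2 : e' ∈ C
      · simp [h1, h2, hZ h2, add_assoc]
      · by_cases h3 : (e' : Sym2 (Fin n)) ∈ Z <;> simp [h1, h2, h3]

/-- Backward induction on the number `k` of steps left in ball `α`: the bound holds when the ball is
complete, and each earlier step integrates out one more waiting time. -/
theorem Explored.lmarginal_ball {ρ : ℕ → Fin n} {m a α : ℕ} (hα : α < m) (hn : m + m * a ≤ n)
    {F : (CompleteEdge n → ℝ) → ℝ≥0∞} (hF : Measurable F) {G : (ℕ × ℕ → ℝ) → ℝ≥0∞}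
    (hG : Measurable G)
    (H : ∀ ξ off Z b, Explored ρ m (ballSteps a α a) (waiting n m a ξ) off Z b →
      G ξ ≤ ∫⁻ w, F (reweight off Z w) ∂weightLaw n) (k : ℕ) :
    ∀ j, j + k = a → ∀ ξ off Z b, Explored ρ m (ballSteps a α j) (waiting n m a ξ) off Z b →
      lmarginal (fun _ => expMeasure 1) ({α} ×ˢ Finset.Ico j a) G ξ
        ≤ ∫⁻ w, F (reweight off Z w) ∂weightLaw n := by
  have := isProbabilityMeasure_expMeasure one_pos
  induction k with
  | zero =>
    intro j hj ξ off Z b h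
    obtain rfl : j = a := by omega
    simpa using H ξ off Z b h
  | succ k ih =>
    intro j hj ξ off Z b h
    have hja : j < a := by omega
    have hset : ({α} ×ˢ Finset.Ico j a : Finset (ℕ × ℕ))
        = insert (α, j) ({α} ×ˢ Finset.Ico (j + 1) a) := by
      ext ⟨x, y⟩
      simp only [Finset.mem_product, Finset.mem_singleton, Finset.mem_Ico, Finset.mem_insert,
        Prod.mk.injEq]
      omega
    rw [hset, lmarginal_insert _ hG (by simp)]
    exact h.lintegral_step hα hja hn hF (hG.lmarginal _) (ih (j + 1) (by omega))

theorem Explored.lmarginal_balls {ρ : ℕ → Fin n} {m a : ℕ} (hn : m + m * a ≤ n)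
    {F : (CompleteEdge n → ℝ) → ℝ≥0∞} (hF : Measurable F) {G : (ℕ × ℕ → ℝ) → ℝ≥0∞}
    (hG : Measurable G)
    (H : ∀ ξ off Z b, Explored ρ m (ballSteps a m 0) (waiting n m a ξ) off Z b →
      G ξ ≤ ∫⁻ w, F (reweight off Z w) ∂weightLaw n) (k : ℕ) :
    ∀ α, α + k = m → ∀ ξ off Z b, Explored ρ m (ballSteps a α 0) (waiting n m a ξ) off Z b →
      lmarginal (fun _ => expMeasure 1) (Finset.Ico α m ×ˢ Finset.range a) G ξ
        ≤ ∫⁻ w, F (reweight off Z w) ∂weightLaw n := by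
  have := isProbabilityMeasure_expMeasure one_pos
  induction k with
  | zero =>
    intro α hα ξ off Z b h
    obtain rfl : α = m := by omega
    simpa using H ξ off Z b h
  | succ k ih =>
    intro α hα ξ off Z b h
    have hset : (Finset.Ico α m ×ˢ Finset.range a : Finset (ℕ × ℕ))
        = ({α} ×ˢ Finset.Ico 0 a) ∪ (Finset.Ico (α + 1) m ×ˢ Finset.range a) := by
      ext ⟨x, y⟩
      simp only [Finset.mem_product, Finset.mem_singleton, Finset.mem_Ico, Finset.mem_union,
        Finset.mem_range]
      omega
    have hdisj : Disjoint ({α} ×ˢ Finset.Ico 0 a : Finset (ℕ × ℕ))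
        (Finset.Ico (α + 1) m ×ˢ Finset.range a) := by
      rw [Finset.disjoint_left]
      rintro ⟨x, y⟩ h1 h2
      simp only [Finset.mem_product, Finset.mem_singleton, Finset.mem_Ico] at h1 h2
      omega
    rw [hset, lmarginal_union _ _ hG hdisj]
    refine Explored.lmarginal_ball (by omega) hn hF (hG.lmarginal _) ?_ a 0 (by omega) ξ off Z b h
    intro ξ' off' Z' b' h'
    rw [ballSteps_complete] at h'
    exact ih (α + 1) (by omega) ξ' off' Z' b' h'

/-- The law of a family of independent standard exponential variables. -/
noncomputable def expSeqLaw : Measure (ℕ × ℕ → ℝ) := Measure.infinitePi fun _ => expMeasure 1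

instance : IsProbabilityMeasure (expMeasure 1) := isProbabilityMeasure_expMeasure one_pos

instance : IsProbabilityMeasure expSeqLaw := by unfold expSeqLaw; infer_instance

/-- Lower bounds, given the result of the exploration, integrate to lower bounds. -/
theorem lintegral_expSeqLaw_le {ρ : ℕ → Fin n} {m a : ℕ} (hn : m + m * a ≤ n)
    (hρ : ∀ γ < m, ∀ γ' < m, ρ γ = ρ γ' → γ = γ')
    {F : (CompleteEdge n → ℝ) → ℝ≥0∞} (hF : Measurable F) {G : (ℕ × ℕ → ℝ) → ℝ≥0∞}
    (hG : Measurable G)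
    (hloc : ∀ ξ ξ', (∀ γ < m, ∀ l < a, ξ (γ, l) = ξ' (γ, l)) → G ξ = G ξ')
    (H : ∀ ξ off Z b, Explored ρ m (ballSteps a m 0) (waiting n m a ξ) off Z b →
      G ξ ≤ ∫⁻ w, F (reweight off Z w) ∂weightLaw n) :
    ∫⁻ ξ, G ξ ∂expSeqLaw ≤ ∫⁻ w, F w ∂weightLaw n := by
  have h0 : Explored ρ m (ballSteps a 0 0) (waiting n m a 0) (fun _ => 0) ∅ (fun γ _ => ρ γ) := by
    have : ballSteps a 0 0 = fun _ => 0 := by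
      ext γ; simp [ballSteps]
    rw [this]
    exact Explored.init hρ _
  have h1 := Explored.lmarginal_balls hn hF hG H m 0 (by omega) 0 _ _ _ h0
  have h2 : ∀ w : CompleteEdge n → ℝ, reweight (fun _ => 0) ∅ w = w := by
    intro w; ext e; simp [reweight]
  simp only [h2] at h1
  refine le_trans (le_of_eq ?_) h1
  unfold lmarginal expSeqLaw
  -- By `hloc` only the finitely many waiting times of the exploration matter; the base value `0` of
  -- the other coordinates is arbitrary.
  rw [← lintegral_restrict_infinitePi (fun _ : ℕ × ℕ => expMeasure 1)
    (s := Finset.Ico 0 m ×ˢ Finset.range a) (f := fun y =>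
      G (Function.updateFinset 0 (Finset.Ico 0 m ×ˢ Finset.range a) y))]
  · refine lintegral_congr fun ξ => hloc _ _ fun γ hγ l hl => ?_
    simp [Function.updateFinset, hγ, hl]
  · exact hG.comp measurable_updateFinset

end Chain

/-! ### Fresh edges between complete balls, and what they imply for the distance of the roots. -/

section Collision

open scoped ENNReal

variable {n : ℕ}

theorem expMeasure_Ici {r : ℝ} (hr : 0 < r) (t : ℝ) :
    expMeasure r (Set.Ici t) = ENNReal.ofReal (Real.exp (-(r * max t 0))) := by
  have := isProbabilityMeasure_expMeasure hr
  rcases le_total t 0 with h | h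
  · rw [max_eq_right h, mul_zero, neg_zero, Real.exp_zero, ENNReal.ofReal_one,
      ← prob_compl_eq_zero_iff measurableSet_Ici]
    refine measure_mono_null ?_ (ae_iff.1 (ae_nonneg_expMeasure r))
    intro y hy
    simp only [Set.mem_compl_iff, Set.mem_Ici, not_le] at hy
    simpa using hy.trans_le h
  · rw [max_eq_left h]
    have h1 := lintegral_expMeasure_Ioi (r := r) h (g := fun _ => 1) measurable_const
    rw [lintegral_indicator measurableSet_Ioi] at h1
    simp only [lintegral_const, measure_univ, Measure.restrict_apply, MeasurableSet.univ,
      Set.univ_inter, mul_one, one_mul] at h1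
    rw [← h1, expMeasure_eq_withDensity]
    exact (measure_congr (Ioi_ae_eq_Ici (μ := volume.withDensity (exponentialPDF r)))).symm

/-- Independence turns the survival probabilities of distinct coordinates into a product. The
positive part appears because a threshold below `0` is no constraint. -/
theorem pi_expMeasure_thresholds {ι K : Type*} [Fintype ι] [Fintype K] {r : ℝ} (hr : 0 < r)
    {edge : K → ι} (hinj : Function.Injective edge) (thr : K → ℝ) :
    Measure.pi (fun _ : ι => expMeasure r) {w | ∀ k, thr k ≤ w (edge k)}
      = ENNReal.ofReal (Real.exp (-(r * ∑ k, max (thr k) 0))) := by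
  have := isProbabilityMeasure_expMeasure hr
  have hset : {w : ι → ℝ | ∀ k, thr k ≤ w (edge k)}
      = Set.univ.pi fun e => {y | ∀ k, edge k = e → thr k ≤ y} := by
    ext w
    simp only [Set.mem_ofPred_eq, Set.mem_pi, Set.mem_univ, true_implies]
    exact ⟨fun h e k hk => hk ▸ h k, fun h k => h _ k rfl⟩
  rw [hset, Measure.pi_pi, Finset.mul_sum, ← Finset.sum_neg_distrib, Real.exp_sum,
    ENNReal.ofReal_prod_of_nonneg fun _ _ => (Real.exp_pos _).le]
  symm
  refine Fintype.prod_of_injective edge hinj _ _ ?_ ?_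
  · intro e he
    have : {y : ℝ | ∀ k, edge k = e → thr k ≤ y} = Set.univ := by
      ext y
      simp only [Set.mem_ofPred_eq, Set.mem_univ, iff_true]
      exact fun k hk => absurd ⟨k, hk⟩ he
    rw [this, measure_univ]
  · intro k
    rw [← expMeasure_Ici hr]
    congr 1
    ext y
    simp only [Set.mem_ofPred_eq, Set.mem_Ici]
    exact ⟨fun h k' hk' => hinj hk' ▸ h, fun h => h k rfl⟩

theorem weightLaw_thresholds {K : Type*} [Fintype K] (hn : 0 < n) {u v : K → Fin n}
    (hne : ∀ k, u k ≠ v k) (hinj : ∀ k k', s(u k, v k) = s(u k', v k') → k = k') (thr : K → ℝ) :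
    weightLaw n {w | ∀ k, thr k ≤ edgeWeight w (u k) (v k)}
      = ENNReal.ofReal (Real.exp (-(1 / (n : ℝ) * ∑ k, max (thr k) 0))) := by
  have hn0 : (0 : ℝ) < n := by exact_mod_cast hn
  rw [← pi_expMeasure_thresholds (ι := CompleteEdge n) (one_div_pos.2 hn0)
    (edge := fun k => ⟨s(u k, v k), by simpa using hne k⟩) ?_ thr]
  · simp only [edgeWeight_of_ne _ (hne _)]
    rfl
  · intro k k' h
    exact hinj k k' (congrArg Subtype.val h)

theorem ae_nonneg_weightLaw (hn : 0 < n) : ∀ᵐ w ∂weightLaw n, ∀ e, 0 ≤ w e := by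
  have hn0 : (0 : ℝ) < n := by exact_mod_cast hn
  have := isProbabilityMeasure_expMeasure (one_div_pos.2 hn0)
  rw [ae_all_iff]
  intro e
  exact (measurePreserving_eval (fun _ : CompleteEdge n => expMeasure (1 / (n : ℝ)))
    e).quasiMeasurePreserving.ae (ae_nonneg_expMeasure _)

theorem isProbabilityMeasure_weightLaw (hn : 0 < n) : IsProbabilityMeasure (weightLaw n) := by
  have hn0 : (0 : ℝ) < n := by exact_mod_cast hn
  have := isProbabilityMeasure_expMeasure (one_div_pos.2 hn0)
  unfold weightLaw
  infer_instance

theorem edgeWeight_reweight (off : CompleteEdge n → ℝ) (Z : Finset (Sym2 (Fin n)))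
    (w : CompleteEdge n → ℝ) (x y : Fin n) :
    edgeWeight (reweight off Z w) x y
      = edgeWeight off x y + if s(x, y) ∈ Z then 0 else edgeWeight w x y := by
  by_cases h : x = y
  · subst h; simp [edgeWeight]
  · simp only [edgeWeight_of_ne _ h, reweight]

theorem edgeWeight_nonneg {w : CompleteEdge n → ℝ} (hw : ∀ e, 0 ≤ w e) (x y : Fin n) :
    0 ≤ edgeWeight w x y := by
  by_cases h : x = y
  · subst h; simp [edgeWeight]
  · rw [edgeWeight_of_ne _ h]; exact hw _

theorem reweight_nonneg {off : CompleteEdge n → ℝ} (hoff : ∀ e, 0 ≤ off e)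
    (Z : Finset (Sym2 (Fin n))) {w : CompleteEdge n → ℝ} (hw : ∀ e, 0 ≤ w e)
    (e : CompleteEdge n) : 0 ≤ reweight off Z w e := by
  unfold reweight
  have := hoff e
  have := hw e
  split_ifs <;> linarith

theorem arrival_zero (τ : ℕ × ℕ → ℝ) (γ : ℕ) : arrival τ γ 0 = 0 := by simp [arrival]

section State

variable {ρ : ℕ → Fin n} {m : ℕ} {κ : ℕ → ℕ} {τ : ℕ × ℕ → ℝ} {off : CompleteEdge n → ℝ}
  {Z : Finset (Sym2 (Fin n))} {b : ℕ → ℕ → Fin n}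

theorem Explored.arrival_mono (h : Explored ρ m κ τ off Z b) {γ : ℕ} (hγ : γ < m) {i i' : ℕ}
    (hi : i ≤ i') (hi' : i' ≤ κ γ) : arrival τ γ i ≤ arrival τ γ i' := by
  refine Finset.sum_le_sum_of_subset_of_nonneg (Finset.range_mono hi) ?_
  intro l hl _
  exact h.wait_nonneg γ hγ l (lt_of_lt_of_le (Finset.mem_range.1 hl) hi')

theorem Explored.arrival_nonneg (h : Explored ρ m κ τ off Z b) {γ : ℕ} (hγ : γ < m) {i : ℕ}
    (hi : i ≤ κ γ) : 0 ≤ arrival τ γ i := by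
  rw [← arrival_zero τ γ]
  exact h.arrival_mono hγ (Nat.zero_le _) hi

theorem Explored.weightDist_le_arrival (h : Explored ρ m κ τ off Z b) {w : CompleteEdge n → ℝ}
    (hw : ∀ e, 0 ≤ w e) {γ : ℕ} (hγ : γ < m) (i : ℕ) (hi : i ≤ κ γ) :
    weightDist (reweight off Z w) (ρ γ) (b γ i) ≤ arrival τ γ i := by
  induction i using Nat.strong_induction_on with
  | _ i ih =>
    have hr := reweight_nonneg h.off_nonneg Z hw
    rcases Nat.eq_zero_or_pos i with rfl | hpos
    · rw [h.root γ hγ, arrival_zero]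
      refine (weightDist_le_edgeWeight hr _ _).trans (le_of_eq ?_)
      simp [edgeWeight]
    · obtain ⟨i', hlt, hZ, he⟩ := h.tree γ hγ i hi hpos
      have h1 := ih i' hlt (by omega)
      have h2 := weightDist_le_edgeWeight hr (b γ i') (b γ i)
      rw [edgeWeight_reweight, if_pos hZ, he] at h2
      have h3 := weightDist_triangle hr (ρ γ) (b γ i') (b γ i)
      linarith

/-- The known part of the edge weight, the time since the arrival of `b γ i`, adds to that arrival
to give the full radius of ball `γ`. So the bound involves `i` only through the fresh excess, and
all vertices of ball `γ` are equivalent for collisions. -/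
theorem Explored.weightDist_le_cross (h : Explored ρ m κ τ off Z b) {w : CompleteEdge n → ℝ}
    (hw : ∀ e, 0 ≤ w e) {γ γ' : ℕ} (hlt : γ < γ') (hγ' : γ' < m) {i i' : ℕ} (hi : i ≤ κ γ)
    (hi' : i' ≤ κ γ') (hpos : 0 < i') :
    weightDist (reweight off Z w) (ρ γ) (ρ γ')
      ≤ edgeWeight w (b γ i) (b γ' i') + arrival τ γ (κ γ) + arrival τ γ' i' := by
  have hr := reweight_nonneg h.off_nonneg Z hw
  have hγ := hlt.trans hγ'
  obtain ⟨h1, h2⟩ := h.cross γ γ' hlt hγ' i hi i' hi'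
  have h3 := weightDist_le_edgeWeight hr (b γ i) (b γ' i')
  rw [edgeWeight_reweight, if_neg h2, h1, if_neg hpos.ne'] at h3
  have h4 := weightDist_triangle hr (ρ γ) (b γ i) (ρ γ')
  have h5 := weightDist_triangle hr (b γ i) (b γ' i') (ρ γ')
  have h6 := h.weightDist_le_arrival hw hγ i hi
  have h7 := h.weightDist_le_arrival hw hγ' i' hi'
  rw [weightDist_comm] at h7
  linarith

open Classical in
/-- If all edges between the two balls are long, then the two roots are far apart. -/
theorem Explored.le_weightDist (h : Explored ρ 2 κ τ off Z b) {w : CompleteEdge n → ℝ}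
    (hw : ∀ e, 0 ≤ w e) {t : ℝ} (ht : arrival τ 0 (κ 0) ≤ t)
    (ht' : t ≤ arrival τ 0 (κ 0) + arrival τ 1 (κ 1))
    (hroot : ∀ i ≤ κ 0, t - arrival τ 0 i ≤ edgeWeight w (b 0 i) (b 1 0))
    (hcross : ∀ i ≤ κ 0, ∀ k ≤ κ 1, 0 < k →
      t - arrival τ 0 (κ 0) - arrival τ 1 k ≤ edgeWeight w (b 0 i) (b 1 k)) :
    t ≤ weightDist (reweight off Z w) (ρ 0) (ρ 1) := by
  have h02 : 0 < 2 := by norm_num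
  have h12 : 1 < 2 := by norm_num
  set c := t - arrival τ 0 (κ 0) with hc
  -- The potential falls from `t` at root 0 to `c` at the rim of ball 0, equals the arrival time in
  -- ball 1 truncated at `c`, and is `c` on unexplored vertices, since `ht'` says `c ≤ arrival τ 1
  -- (κ 1)`. Its values at the two roots are `t` and `0`, so it remains to check that it is
  -- 1-Lipschitz for the edge weights.
  set Ψ : Fin n → ℝ := fun x =>
    if h0 : ∃ i ≤ κ 0, b 0 i = x then t - arrival τ 0 h0.choose
    else if h1 : ∃ k ≤ κ 1, b 1 k = x then min (arrival τ 1 h1.choose) c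
    else min (arrival τ 1 (κ 1)) c with hΨ
  have Ψ0 : ∀ i ≤ κ 0, Ψ (b 0 i) = t - arrival τ 0 i := by
    intro i hi
    have h0 : ∃ i' ≤ κ 0, b 0 i' = b 0 i := ⟨i, hi, rfl⟩
    have := (h.inj 0 h02 0 h02 _ h0.choose_spec.1 i hi h0.choose_spec.2).2
    simp only [hΨ, dif_pos h0, this]
  have Ψ1 : ∀ k ≤ κ 1, Ψ (b 1 k) = min (arrival τ 1 k) c := by
    intro k hk
    have h0 : ¬ ∃ i' ≤ κ 0, b 0 i' = b 1 k := by
      rintro ⟨i, hi, he⟩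
      exact absurd (h.inj 0 h02 1 h12 i hi k hk he).1 (by norm_num)
    have h1 : ∃ k' ≤ κ 1, b 1 k' = b 1 k := ⟨k, hk, rfl⟩
    have := (h.inj 1 h12 1 h12 _ h1.choose_spec.1 k hk h1.choose_spec.2).2
    simp only [hΨ, dif_neg h0, dif_pos h1, this]
  have Ψ2 : ∀ x, Unexplored 2 κ b x → Ψ x = min (arrival τ 1 (κ 1)) c := by
    intro x hx
    have h0 : ¬ ∃ i' ≤ κ 0, b 0 i' = x := fun ⟨i, hi, he⟩ => hx 0 h02 i hi he
    have h1 : ¬ ∃ i' ≤ κ 1, b 1 i' = x := fun ⟨i, hi, he⟩ => hx 1 h12 i hi he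
    simp only [hΨ, dif_neg h0, dif_neg h1]
  have cls : ∀ x, (∃ i ≤ κ 0, x = b 0 i) ∨ (∃ k ≤ κ 1, x = b 1 k) ∨ Unexplored 2 κ b x := by
    intro x
    by_cases h0 : ∃ i ≤ κ 0, x = b 0 i
    · exact Or.inl h0
    by_cases h1 : ∃ k ≤ κ 1, x = b 1 k
    · exact Or.inr (Or.inl h1)
    refine Or.inr (Or.inr fun γ hγ i hi he => ?_)
    interval_cases γ
    · exact h0 ⟨i, hi, he.symm⟩
    · exact h1 ⟨i, hi, he.symm⟩
  have hr := reweight_nonneg h.off_nonneg Z hw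
  set W := edgeWeight (reweight off Z w) with hW
  have W0 : ∀ x y, 0 ≤ W x y := edgeWeight_nonneg hr
  have Wle : ∀ x y, edgeWeight off x y ≤ W x y := by
    intro x y
    rw [hW, edgeWeight_reweight]
    have := edgeWeight_nonneg hw x y
    split_ifs <;> linarith
  have min1 := min_le_left (α := ℝ)
  have min2 := min_le_right (α := ℝ)
  have m0 : ∀ i ≤ κ 0, arrival τ 0 i ≤ arrival τ 0 (κ 0) := fun i hi =>
    h.arrival_mono h02 hi le_rfl
  have m1 : ∀ i ≤ κ 1, arrival τ 1 i ≤ arrival τ 1 (κ 1) := fun i hi =>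
    h.arrival_mono h12 hi le_rfl
  have lip : ∀ p q W : ℝ, p ≤ q → q - p ≤ W → |min p c - min q c| ≤ W := by
    intro p q W hpq hqp
    rw [abs_le]
    rcases le_total p c with h1 | h1 <;> rcases le_total q c with h2 | h2 <;>
      simp only [min_eq_left, min_eq_right, h1, h2] <;> constructor <;> linarith
  have key : ∀ x y, x ≠ y → |Ψ x - Ψ y| ≤ W x y := by
    have sym : ∀ x y, |Ψ y - Ψ x| ≤ W y x → |Ψ x - Ψ y| ≤ W x y := by
      intro x y hxy
      rwa [abs_sub_comm, hW, edgeWeight_comm]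
    have k00 : ∀ i ≤ κ 0, ∀ i' ≤ κ 0, i < i' → |Ψ (b 0 i) - Ψ (b 0 i')| ≤ W (b 0 i) (b 0 i') := by
      intro i hi i' hi' hlt
      have h1 := (h.inside 0 h02 i' hi' i hlt).trans (Wle _ _)
      have h2 := h.arrival_mono h02 hlt.le hi'
      rw [Ψ0 i hi, Ψ0 i' hi', abs_le]
      constructor <;> linarith
    have k11 : ∀ i ≤ κ 1, ∀ i' ≤ κ 1, i < i' → |Ψ (b 1 i) - Ψ (b 1 i')| ≤ W (b 1 i) (b 1 i') := by
      intro i hi i' hi' hlt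
      have h1 := (h.inside 1 h12 i' hi' i hlt).trans (Wle _ _)
      rw [Ψ1 i hi, Ψ1 i' hi']
      exact lip _ _ _ (h.arrival_mono h12 hlt.le hi') h1
    -- Only these edges could make the potential drop too fast; for them the hypotheses on the fresh
    -- excesses are used. Edges to root 1 have no offset and need the separate hypothesis `hroot`.
    have k01 : ∀ i ≤ κ 0, ∀ k ≤ κ 1, |Ψ (b 0 i) - Ψ (b 1 k)| ≤ W (b 0 i) (b 1 k) := by
      intro i hi k hk
      obtain ⟨h1, h2⟩ := h.cross 0 1 (by norm_num) h12 i hi k hk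
      have h3 : W (b 0 i) (b 1 k) = _ := edgeWeight_reweight _ _ _ _ _
      rw [if_neg h2, h1] at h3
      have h4 := m0 i hi
      have h5 := W0 (b 0 i) (b 1 k)
      have h6 := edgeWeight_nonneg hw (b 0 i) (b 1 k)
      rw [Ψ0 i hi, Ψ1 k hk, abs_le]
      have h7 := min2 (arrival τ 1 k) c
      refine ⟨by linarith, ?_⟩
      rcases Nat.eq_zero_or_pos k with rfl | hpos
      · have h8 := hroot i hi
        rw [if_pos rfl] at h3
        rw [arrival_zero, min_eq_left (by linarith)]
        linarith
      · have h8 := hcross i hi k hk hpos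
        rw [if_neg hpos.ne'] at h3
        rcases le_total (arrival τ 1 k) c with h9 | h9
        · rw [min_eq_left h9]; linarith
        · rw [min_eq_right h9]; linarith
    have k02 : ∀ i ≤ κ 0, ∀ y, Unexplored 2 κ b y → |Ψ (b 0 i) - Ψ y| ≤ W (b 0 i) y := by
      intro i hi y hy
      have h1 := (h.weight_boundary 0 h02 i hi y hy).1
      have h2 := Wle (b 0 i) y
      have h4 := m0 i hi
      rw [Ψ0 i hi, Ψ2 y hy, min_eq_right (by linarith), abs_le]
      constructor <;> linarith
    have k12 : ∀ k ≤ κ 1, ∀ y, Unexplored 2 κ b y → |Ψ (b 1 k) - Ψ y| ≤ W (b 1 k) y := by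
      intro k hk y hy
      have h1 := (h.weight_boundary 1 h12 k hk y hy).1
      rw [Ψ1 k hk, Ψ2 y hy]
      exact lip _ _ _ (m1 k hk) (h1 ▸ Wle _ _)
    intro x y hxy
    rcases cls x with ⟨i, hi, rfl⟩ | ⟨k, hk, rfl⟩ | hx <;>
      rcases cls y with ⟨i', hi', rfl⟩ | ⟨k', hk', rfl⟩ | hy
    · rcases lt_trichotomy i i' with hlt | rfl | hlt
      · exact k00 i hi i' hi' hlt
      · exact absurd rfl hxy
      · exact sym _ _ (k00 i' hi' i hi hlt)
    · exact k01 i hi k' hk'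
    · exact k02 i hi y hy
    · exact sym _ _ (k01 i' hi' k hk)
    · rcases lt_trichotomy k k' with hlt | rfl | hlt
      · exact k11 k hk k' hk' hlt
      · exact absurd rfl hxy
      · exact sym _ _ (k11 k' hk' k hk hlt)
    · exact k12 k hk y hy
    · exact sym _ _ (k02 i' hi' x hx)
    · exact sym _ _ (k12 k' hk' x hx)
    · rw [Ψ2 x hx, Ψ2 y hy, sub_self, abs_zero]
      exact W0 x y
  have := potential_le_weightDist (fun x y hxy => (le_abs_self _).trans (key x y hxy)) (ρ 0) (ρ 1)
  rw [← h.root 0 h02, ← h.root 1 h12, Ψ0 0 (Nat.zero_le _), Ψ1 0 (Nat.zero_le _), arrival_zero,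
    arrival_zero, min_eq_left (by linarith)] at this
  rw [← h.root 0 h02, ← h.root 1 h12]
  linarith

end State

end Collision

/-! ### Conditional collision probabilities and the resulting bounds on survival. -/

section CollisionRate

open scoped ENNReal

variable {n : ℕ}

/-- The conditional rate at which the balls number `γ` and `γ'` are joined within distance `t`. -/
noncomputable def collisionRate (n a : ℕ) (τ : ℕ × ℕ → ℝ) (t : ℝ) (γ γ' : ℕ) : ℝ :=
  (a + 1) / n * ∑ k ∈ Finset.range a, max (t - arrival τ γ a - arrival τ γ' (k + 1)) 0

theorem collisionRate_nonneg (n a : ℕ) (τ : ℕ × ℕ → ℝ) (t : ℝ) (γ γ' : ℕ) :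
    0 ≤ collisionRate n a τ t γ γ' :=
  mul_nonneg (by positivity) (Finset.sum_nonneg fun _ _ => le_max_right _ _)

theorem measurable_arrival_waiting (n m a γ i : ℕ) :
    Measurable fun ξ => arrival (waiting n m a ξ) γ i :=
  Finset.measurable_sum _ fun _ _ => (measurable_pi_apply _).div_const _

theorem measurable_collisionRate (n m a : ℕ) (t : ℝ) (γ γ' : ℕ) :
    Measurable fun ξ => collisionRate n a (waiting n m a ξ) t γ γ' := by
  unfold collisionRate
  refine (Finset.measurable_sum _ fun k _ => ?_).const_mul _
  exact (((measurable_arrival_waiting n m a γ a).const_sub t).sub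
    (measurable_arrival_waiting n m a γ' (k + 1))).max measurable_const

theorem arrival_waiting_congr (n : ℕ) {m a : ℕ} {ξ ξ' : ℕ × ℕ → ℝ}
    (h : ∀ γ < m, ∀ l < a, ξ (γ, l) = ξ' (γ, l)) {γ i : ℕ} (hγ : γ < m) (hi : i ≤ a) :
    arrival (waiting n m a ξ) γ i = arrival (waiting n m a ξ') γ i := by
  refine Finset.sum_congr rfl fun l hl => ?_
  unfold waiting
  rw [h γ hγ l (lt_of_lt_of_le (Finset.mem_range.1 hl) hi)]

theorem collisionRate_congr (n : ℕ) {m a : ℕ} {ξ ξ' : ℕ × ℕ → ℝ}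
    (h : ∀ γ < m, ∀ l < a, ξ (γ, l) = ξ' (γ, l)) (t : ℝ) {γ γ' : ℕ} (hγ : γ < m) (hγ' : γ' < m) :
    collisionRate n a (waiting n m a ξ) t γ γ' = collisionRate n a (waiting n m a ξ') t γ γ' := by
  unfold collisionRate
  rw [arrival_waiting_congr n h hγ le_rfl]
  congr 1
  refine Finset.sum_congr rfl fun k hk => ?_
  rw [arrival_waiting_congr n h hγ' (Finset.mem_range.1 hk)]

theorem ballSteps_of_lt {a m γ : ℕ} (h : γ < m) : ballSteps a m 0 γ = a := by
  simp [ballSteps, h]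

/-- Explored vertices are pairwise distinct, and an edge joining two different balls determines its
endpoints since the balls are ordered. So distinct indices give distinct edges, with independent
excesses. -/
theorem Explored.weightLaw_cross {ρ : ℕ → Fin n} {m : ℕ} {κ : ℕ → ℕ} {τ : ℕ × ℕ → ℝ}
    {off : CompleteEdge n → ℝ} {Z : Finset (Sym2 (Fin n))} {b : ℕ → ℕ → Fin n}
    (h : Explored ρ m κ τ off Z b) (hn : 0 < n) {K : Type*} [Fintype K] (γ i γ' i' : K → ℕ)
    (hlt : ∀ p, γ p < γ' p) (hγ' : ∀ p, γ' p < m) (hi : ∀ p, i p ≤ κ (γ p))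
    (hi' : ∀ p, i' p ≤ κ (γ' p))
    (hinj : ∀ p p', γ p = γ p' → i p = i p' → γ' p = γ' p' → i' p = i' p' → p = p')
    (thr : K → ℝ) :
    weightLaw n {w | ∀ p, thr p ≤ edgeWeight w (b (γ p) (i p)) (b (γ' p) (i' p))}
      = ENNReal.ofReal (Real.exp (-(1 / (n : ℝ) * ∑ p, max (thr p) 0))) := by
  refine weightLaw_thresholds hn ?_ ?_ thr
  · intro p he
    exact (hlt p).ne (h.inj _ ((hlt p).trans (hγ' p)) _ (hγ' p) _ (hi p) _ (hi' p) he).1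
  · intro p p' he
    rcases Sym2.eq_iff.1 he with ⟨h1, h2⟩ | ⟨h1, h2⟩
    · obtain ⟨h3, h4⟩ := h.inj _ ((hlt p).trans (hγ' p)) _ ((hlt p').trans (hγ' p')) _ (hi p) _
        (hi p') h1
      obtain ⟨h5, h6⟩ := h.inj _ (hγ' p) _ (hγ' p') _ (hi' p) _ (hi' p') h2
      exact hinj p p' h3 h4 h5 h6
    · have h3 := (h.inj _ ((hlt p).trans (hγ' p)) _ (hγ' p') _ (hi p) _ (hi' p') h1).1
      have h4 := (h.inj _ (hγ' p) _ ((hlt p').trans (hγ' p')) _ (hi' p) _ (hi p') h2).1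
      have := hlt p
      have := hlt p'
      omega

/-- All edges between the two balls are long. -/
def noCollision (a : ℕ) (τ : ℕ × ℕ → ℝ) (b : ℕ → ℕ → Fin n) (t : ℝ) (γ γ' : ℕ) :
    Set (CompleteEdge n → ℝ) :=
  {w | ∀ p : Fin (a + 1) × Fin a,
    t - arrival τ γ a - arrival τ γ' (p.2 + 1) ≤ edgeWeight w (b γ p.1) (b γ' (p.2 + 1))}

theorem sum_thresholds (n a : ℕ) (τ : ℕ × ℕ → ℝ) (t : ℝ) (γ γ' : ℕ) :
    1 / (n : ℝ) * ∑ p : Fin (a + 1) × Fin a,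
      max (t - arrival τ γ a - arrival τ γ' (p.2 + 1)) 0 = collisionRate n a τ t γ γ' := by
  rw [Fintype.sum_prod_type]
  simp only [Finset.sum_const, Finset.card_univ, Fintype.card_fin, nsmul_eq_mul]
  rw [Fin.sum_univ_eq_sum_range
    (fun k => max (t - arrival τ γ a - arrival τ γ' (k + 1)) 0), collisionRate]
  push_cast
  ring

section Complete

variable {ρ : ℕ → Fin n} {m a : ℕ} {τ : ℕ × ℕ → ℝ} {off : CompleteEdge n → ℝ}
  {Z : Finset (Sym2 (Fin n))} {b : ℕ → ℕ → Fin n}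

theorem Explored.weightLaw_noCollision (h : Explored ρ m (ballSteps a m 0) τ off Z b)
    (hn : 0 < n) {γ γ' : ℕ} (hlt : γ < γ') (hγ' : γ' < m) (t : ℝ) :
    weightLaw n (noCollision a τ b t γ γ')
      = ENNReal.ofReal (Real.exp (-collisionRate n a τ t γ γ')) := by
  rw [← sum_thresholds]
  refine h.weightLaw_cross hn (K := Fin (a + 1) × Fin a) (fun _ => γ) (fun p => p.1) (fun _ => γ')
    (fun p => p.2 + 1) (fun _ => hlt) (fun _ => hγ') ?_ ?_ ?_ _
  · intro p
    rw [ballSteps_of_lt (hlt.trans hγ')]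
    omega
  · intro p
    rw [ballSteps_of_lt hγ']
    omega
  · rintro ⟨i, k⟩ ⟨i', k'⟩ - h1 - h2
    simp only at h1 h2
    exact Prod.ext (Fin.ext h1) (Fin.ext (by simpa using h2))

theorem Explored.weightLaw_iInter_noCollision (h : Explored ρ m (ballSteps a m 0) τ off Z b)
    (hn : 0 < n) (t : OrderedPair m → ℝ) :
    weightLaw n (⋂ q : OrderedPair m, noCollision a τ b (t q) q.1.1 q.1.2)
      = ENNReal.ofReal (Real.exp
        (-∑ q : OrderedPair m, collisionRate n a τ (t q) q.1.1 q.1.2)) := by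
  have hset : (⋂ q : OrderedPair m, noCollision a τ b (t q) q.1.1 q.1.2)
      = {w | ∀ p : OrderedPair m × Fin (a + 1) × Fin a,
        t p.1 - arrival τ p.1.1.1 a - arrival τ p.1.1.2 (p.2.2 + 1)
          ≤ edgeWeight w (b p.1.1.1 p.2.1) (b p.1.1.2 (p.2.2 + 1))} := by
    ext w
    simp only [noCollision, Set.mem_iInter, Set.mem_ofPred_eq]
    exact ⟨fun h p => h p.1 p.2, fun h q p => h (q, p)⟩
  rw [hset, h.weightLaw_cross hn (fun p : OrderedPair m × Fin (a + 1) × Fin a => p.1.1.1)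
    (fun p => p.2.1) (fun p => p.1.1.2) (fun p => p.2.2 + 1) (fun p => p.1.2)
    (fun p => p.1.1.2.2)]
  · rw [Fintype.sum_prod_type, Finset.mul_sum]
    simp only [sum_thresholds]
  · intro p
    rw [ballSteps_of_lt p.1.1.1.2]
    omega
  · intro p
    rw [ballSteps_of_lt p.1.1.2.2]
    omega
  · rintro ⟨q, i, k⟩ ⟨q', i', k'⟩ h1 h2 h3 h4
    simp only at h1 h2 h3 h4
    exact Prod.ext (Subtype.ext (Prod.ext (Fin.ext h1) (Fin.ext h3)))
      (Prod.ext (Fin.ext h2) (Fin.ext (by simpa using h4)))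

theorem Explored.mem_noCollision (h : Explored ρ m (ballSteps a m 0) τ off Z b)
    {w : CompleteEdge n → ℝ} (hw : ∀ e, 0 ≤ w e) {γ γ' : ℕ} (hlt : γ < γ') (hγ' : γ' < m) {t : ℝ}
    (ht : t ≤ weightDist (reweight off Z w) (ρ γ) (ρ γ')) : w ∈ noCollision a τ b t γ γ' := by
  intro p
  have h1 := h.weightDist_le_cross hw hlt hγ' (i := p.1) (i' := p.2 + 1)
    (by rw [ballSteps_of_lt (hlt.trans hγ')]; omega) (by rw [ballSteps_of_lt hγ']; omega)
    (Nat.succ_pos _)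
  rw [ballSteps_of_lt (hlt.trans hγ')] at h1
  linarith

theorem measurableSet_noCollision (t : ℝ) (γ γ' : ℕ) :
    MeasurableSet (noCollision a τ b t γ γ') := by
  have : noCollision a τ b t γ γ' = ⋂ p : Fin (a + 1) × Fin a,
      {w | t - arrival τ γ a - arrival τ γ' (p.2 + 1)
        ≤ edgeWeight w (b γ p.1) (b γ' (p.2 + 1))} := by
    ext w
    simp [noCollision]
  rw [this]
  refine MeasurableSet.iInter fun p => measurableSet_le measurable_const ?_
  by_cases hp : b γ p.1 = b γ' (p.2 + 1)
  · simp [edgeWeight, hp]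
  · simp only [edgeWeight_of_ne _ hp]
    exact measurable_pi_apply _

theorem weightLaw_compl (hn : 0 < n) {s : Set (CompleteEdge n → ℝ)} (hs : MeasurableSet s)
    {c : ℝ} (hc : 0 ≤ c) (h : weightLaw n s = ENNReal.ofReal c) :
    weightLaw n sᶜ = ENNReal.ofReal (1 - c) := by
  have := isProbabilityMeasure_weightLaw hn
  rw [prob_compl_eq_one_sub hs, h, ENNReal.ofReal_sub _ hc, ENNReal.ofReal_one]

end Complete

/-- The vectors of edge weights for which all distances between the roots are large. -/
def farApart (ρ : ℕ → Fin n) {m : ℕ} (t : OrderedPair m → ℝ) : Set (CompleteEdge n → ℝ) :=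
  {w | ∀ q : OrderedPair m, t q ≤ weightDist w (ρ q.1.1) (ρ q.1.2)}

theorem measurableSet_le_weightDist (t : ℝ) (x y : Fin n) :
    MeasurableSet {w : CompleteEdge n → ℝ | t ≤ weightDist w x y} :=
  measurableSet_le measurable_const (measurable_weightDist x y)

theorem measurableSet_farApart (ρ : ℕ → Fin n) {m : ℕ} (t : OrderedPair m → ℝ) :
    MeasurableSet (farApart ρ t) := by
  have : farApart ρ t = ⋂ q : OrderedPair m, {w | t q ≤ weightDist w (ρ q.1.1) (ρ q.1.2)} := by
    ext w; simp [farApart]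
  rw [this]
  exact MeasurableSet.iInter fun q => measurableSet_le_weightDist _ _ _

/-- Large distances exclude all collisions, so a collision of some pair puts the weights in the
complement of `farApart`. Passing to complements makes the one-sided principle give an upper bound
on joint survival. -/
theorem lintegral_le_weightLaw_compl_farApart {ρ : ℕ → Fin n} {m a : ℕ} (hn0 : 0 < n)
    (hn : m + m * a ≤ n) (hρ : ∀ γ < m, ∀ γ' < m, ρ γ = ρ γ' → γ = γ') (t : OrderedPair m → ℝ) :
    ∫⁻ ξ, ENNReal.ofReal (1 - Real.exp (-∑ q : OrderedPair m,
        collisionRate n a (waiting n m a ξ) (t q) q.1.1 q.1.2)) ∂expSeqLaw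
      ≤ weightLaw n (farApart ρ t)ᶜ := by
  have hmeas := (measurableSet_farApart ρ t).compl
  rw [← lintegral_indicator_one hmeas]
  refine lintegral_expSeqLaw_le hn hρ (measurable_one.indicator hmeas) ?_ ?_ ?_
  · exact (measurable_const.sub (Real.measurable_exp.comp (Finset.measurable_sum _
      fun q _ => measurable_collisionRate n m a (t q) q.1.1 q.1.2).neg)).ennreal_ofReal
  · intro ξ ξ' hξ
    rw [Finset.sum_congr rfl fun q _ => collisionRate_congr n hξ (t q) q.1.1.2 q.1.2.2]
  · intro ξ off Z b h
    rw [← weightLaw_compl hn0 (MeasurableSet.iInter fun q => measurableSet_noCollision _ _ _)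
      (Real.exp_pos _).le (h.weightLaw_iInter_noCollision hn0 t),
      ← lintegral_indicator_one (MeasurableSet.iInter fun q =>
        measurableSet_noCollision _ _ _).compl]
    refine lintegral_mono_ae ?_
    filter_upwards [ae_nonneg_weightLaw hn0] with w hw
    by_cases hfar : reweight off Z w ∈ farApart ρ t
    · have : w ∈ ⋂ q : OrderedPair m, noCollision a (waiting n m a ξ) b (t q) q.1.1 q.1.2 :=
        Set.mem_iInter.2 fun q => h.mem_noCollision hw q.2 q.1.2.2 (hfar q)
      rw [Set.indicator_of_notMem (by simpa using this)]
      exact zero_le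
    · rw [Set.indicator_of_mem (show reweight off Z w ∈ (farApart ρ t)ᶜ from hfar)]
      exact Set.indicator_le_self' (fun _ _ => zero_le) _

/-- Absence of collisions is not shown to imply large distances when there are more than two balls,
so the possible failure is charged to the pairs. If nothing collides, either all distances are large
or some `d_q < t q`, and the right side counts at least one; a collision of `q` always forces `d_q <
t q`. The added sums are removed later, using the limits for single pairs. -/
theorem lintegral_le_weightLaw_farApart_add {ρ : ℕ → Fin n} {m a : ℕ} (hn0 : 0 < n)
    (hn : m + m * a ≤ n) (hρ : ∀ γ < m, ∀ γ' < m, ρ γ = ρ γ' → γ = γ') (t : OrderedPair m → ℝ) :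
    ∫⁻ ξ, (ENNReal.ofReal (Real.exp (-∑ q : OrderedPair m,
        collisionRate n a (waiting n m a ξ) (t q) q.1.1 q.1.2)) + ∑ q : OrderedPair m,
        ENNReal.ofReal (1 - Real.exp (-collisionRate n a (waiting n m a ξ) (t q) q.1.1 q.1.2)))
          ∂expSeqLaw
      ≤ weightLaw n (farApart ρ t) + ∑ q : OrderedPair m,
          weightLaw n {w | t q ≤ weightDist w (ρ q.1.1) (ρ q.1.2)}ᶜ := by
  have hmeas := measurableSet_farApart ρ t
  have hmeas' : ∀ q : OrderedPair m, MeasurableSet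
      {w : CompleteEdge n → ℝ | t q ≤ weightDist w (ρ q.1.1) (ρ q.1.2)}ᶜ :=
    fun q => (measurableSet_le_weightDist _ _ _).compl
  have hF : ∀ q : OrderedPair m, Measurable
      ({w : CompleteEdge n → ℝ | t q ≤ weightDist w (ρ q.1.1) (ρ q.1.2)}ᶜ.indicator
        (1 : (CompleteEdge n → ℝ) → ℝ≥0∞)) := fun q => measurable_one.indicator (hmeas' q)
  have hsum : weightLaw n (farApart ρ t) + ∑ q : OrderedPair m,
        weightLaw n {w | t q ≤ weightDist w (ρ q.1.1) (ρ q.1.2)}ᶜ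
      = ∫⁻ w, ((farApart ρ t).indicator 1 w + ∑ q : OrderedPair m,
        {w | t q ≤ weightDist w (ρ q.1.1) (ρ q.1.2)}ᶜ.indicator 1 w) ∂weightLaw n := by
    rw [lintegral_add_left (measurable_one.indicator hmeas), lintegral_finsetSum _ fun q _ => hF q,
      lintegral_indicator_one hmeas]
    simp only [lintegral_indicator_one (hmeas' _)]
  rw [hsum]
  refine lintegral_expSeqLaw_le hn hρ ((measurable_one.indicator hmeas).add
    (Finset.measurable_sum _ fun q _ => hF q)) ?_ ?_ ?_
  · refine (Real.measurable_exp.comp (Finset.measurable_sum _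
      fun q _ => measurable_collisionRate n m a (t q) q.1.1 q.1.2).neg).ennreal_ofReal.add
      (Finset.measurable_sum _ fun q _ => ?_)
    exact (measurable_const.sub (Real.measurable_exp.comp
      (measurable_collisionRate n m a (t q) q.1.1 q.1.2).neg)).ennreal_ofReal
  · intro ξ ξ' hξ
    simp only [collisionRate_congr n hξ (t _) (Fin.is_lt _) (Fin.is_lt _)]
  · intro ξ off Z b h
    set X : OrderedPair m → Set (CompleteEdge n → ℝ) := fun q =>
      noCollision a (waiting n m a ξ) b (t q) q.1.1 q.1.2 with hX
    have hXm : ∀ q, MeasurableSet (X q) := fun q => measurableSet_noCollision _ _ _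
    have hXi : MeasurableSet (⋂ q, X q) := MeasurableSet.iInter hXm
    have h1 : ∀ q, weightLaw n (X q)ᶜ = ENNReal.ofReal
        (1 - Real.exp (-collisionRate n a (waiting n m a ξ) (t q) q.1.1 q.1.2)) := fun q =>
      weightLaw_compl hn0 (hXm q) (Real.exp_pos _).le
        (h.weightLaw_noCollision hn0 q.2 q.1.2.2 (t q))
    rw [← h.weightLaw_iInter_noCollision hn0 t, ← lintegral_indicator_one hXi]
    simp only [← h1, ← lintegral_indicator_one (hXm _).compl]
    rw [← lintegral_finsetSum _ fun q _ => measurable_one.indicator (hXm q).compl,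
      ← lintegral_add_left (measurable_one.indicator hXi)]
    refine lintegral_mono_ae ?_
    filter_upwards [ae_nonneg_weightLaw hn0] with w hw
    have hq : ∀ q, (X q)ᶜ.indicator (1 : (CompleteEdge n → ℝ) → ℝ≥0∞) w
        ≤ {w | t q ≤ weightDist w (ρ q.1.1) (ρ q.1.2)}ᶜ.indicator 1 (reweight off Z w) := by
      intro q
      by_cases hd : t q ≤ weightDist (reweight off Z w) (ρ q.1.1) (ρ q.1.2)
      · have := h.mem_noCollision hw q.2 q.1.2.2 hd
        rw [Set.indicator_of_notMem (by simpa using this)]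
        exact zero_le
      · rw [Set.indicator_of_mem (s := {w | t q ≤ weightDist w (ρ q.1.1) (ρ q.1.2)}ᶜ)
          (by exact hd)]
        exact Set.indicator_le_self' (fun _ _ => zero_le) _
    -- Without collisions all pair indicators on the left vanish and the left side is `1`. Otherwise
    -- its first term vanishes and the pair indicators are compared one by one.
    by_cases hw1 : w ∈ ⋂ q, X q
    · have h2 : ∀ q, (X q)ᶜ.indicator (1 : (CompleteEdge n → ℝ) → ℝ≥0∞) w = 0 := fun q =>
        Set.indicator_of_notMem (by simpa using Set.mem_iInter.1 hw1 q) _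
      rw [Set.indicator_of_mem hw1, Finset.sum_eq_zero fun q _ => h2 q, add_zero]
      change _ ≤ (farApart ρ t).indicator (1 : (CompleteEdge n → ℝ) → ℝ≥0∞) (reweight off Z w) + ∑ q : OrderedPair m,
        {w | t q ≤ weightDist w (ρ q.1.1) (ρ q.1.2)}ᶜ.indicator 1 (reweight off Z w)
      by_cases hfar : reweight off Z w ∈ farApart ρ t
      · rw [Set.indicator_of_mem hfar]
        exact le_self_add
      · have : ∃ q : OrderedPair m,
            ¬ t q ≤ weightDist (reweight off Z w) (ρ q.1.1) (ρ q.1.2) := by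
          simpa [farApart] using hfar
        obtain ⟨q, hq⟩ := this
        refine le_trans ?_ le_add_self
        refine le_trans ?_ (Finset.single_le_sum (fun _ _ => zero_le) (Finset.mem_univ q))
        rw [Set.indicator_of_mem (by exact hq)]
        exact le_rfl
    · rw [Set.indicator_of_notMem hw1, zero_add]
      exact (Finset.sum_le_sum fun q _ => hq q).trans le_add_self

/-- The exploration of two balls has reached far enough to decide whether the distance of the
roots is at least `t`. -/
def exploredEnough (n a : ℕ) (t : ℝ) : Set (ℕ × ℕ → ℝ) :=
  {ξ | arrival (waiting n 2 a ξ) 0 a ≤ t ∧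
    t ≤ arrival (waiting n 2 a ξ) 0 a + arrival (waiting n 2 a ξ) 1 a}

/-- This is the converse bound for a single pair. The edges to root 1, which `collisionRate` omits,
must now be long as well; their `a + 1` thresholds are at most `t`, which costs the extra term `(a +
1) / n * max t 0`. -/
theorem lintegral_le_weightLaw_le_weightDist {ρ : ℕ → Fin n} {a : ℕ}
    (hn : 2 + 2 * a ≤ n) (hρ : ∀ γ < 2, ∀ γ' < 2, ρ γ = ρ γ' → γ = γ') (t : ℝ) :
    ∫⁻ ξ, (exploredEnough n a t).indicator (fun ξ => ENNReal.ofReal (Real.exp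
        (-(collisionRate n a (waiting n 2 a ξ) t 0 1 + (a + 1) / n * max t 0)))) ξ ∂expSeqLaw
      ≤ weightLaw n {w | t ≤ weightDist w (ρ 0) (ρ 1)} := by
  have hn0 : 0 < n := by omega
  have hmeas := measurableSet_le_weightDist t (ρ 0) (ρ 1)
  have hA := fun γ => measurable_arrival_waiting n 2 a γ a
  rw [← lintegral_indicator_one hmeas]
  refine lintegral_expSeqLaw_le hn hρ (measurable_one.indicator hmeas) ?_ ?_ ?_
  · refine Measurable.indicator ?_ ?_
    · exact (Real.measurable_exp.comp
        ((measurable_collisionRate n 2 a t 0 1).add_const _).neg).ennreal_ofReal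
    · exact (measurableSet_le (hA 0) measurable_const).inter
        (measurableSet_le measurable_const ((hA 0).add (hA 1)))
  · intro ξ ξ' hξ
    have h0 : (0 : ℕ) < 2 := by norm_num
    have h1 : (1 : ℕ) < 2 := by norm_num
    have hmem : ξ ∈ exploredEnough n a t ↔ ξ' ∈ exploredEnough n a t := by
      simp only [exploredEnough, Set.mem_ofPred_eq, arrival_waiting_congr n hξ h0 le_rfl,
        arrival_waiting_congr n hξ h1 le_rfl]
    by_cases hξ' : ξ' ∈ exploredEnough n a t
    · rw [Set.indicator_of_mem (hmem.2 hξ'), Set.indicator_of_mem hξ',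
        collisionRate_congr n hξ t h0 h1]
    · rw [Set.indicator_of_notMem (fun hc => hξ' (hmem.1 hc)), Set.indicator_of_notMem hξ']
  · intro ξ off Z b h
    have hκ0 : ballSteps a 2 0 0 = a := ballSteps_of_lt (by norm_num)
    have hκ1 : ballSteps a 2 0 1 = a := ballSteps_of_lt (by norm_num)
    by_cases hξ : ξ ∈ exploredEnough n a t
    · set τ := waiting n 2 a ξ with hτ
      set thr : Fin (a + 1) × Fin (a + 1) → ℝ := fun p =>
        if p.2 = 0 then t - arrival τ 0 p.1 else t - arrival τ 0 a - arrival τ 1 p.2 with hthr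
      have hlaw := h.weightLaw_cross hn0 (K := Fin (a + 1) × Fin (a + 1)) (fun _ => 0)
        (fun p => p.1) (fun _ => 1) (fun p => p.2) (fun _ => one_pos) (fun _ => by norm_num)
        (fun p => by rw [hκ0]; omega) (fun p => by rw [hκ1]; omega)
        (fun p p' _ h1 _ h2 => Prod.ext (Fin.ext h1) (Fin.ext h2)) thr
      have hsum : 1 / (n : ℝ) * ∑ p, max (thr p) 0
          ≤ collisionRate n a τ t 0 1 + (a + 1) / n * max t 0 := by
        have h1 : ∀ i : Fin (a + 1), ∑ k : Fin (a + 1), max (thr (i, k)) 0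
            ≤ max t 0 + ∑ k : Fin a, max (t - arrival τ 0 a - arrival τ 1 (k + 1)) 0 := by
          intro i
          rw [Fin.sum_univ_succ]
          refine add_le_add ?_ (le_of_eq ?_)
          · have := h.arrival_nonneg (γ := 0) (by norm_num) (i := i) (by rw [hκ0]; omega)
            simp only [hthr, if_true]
            exact max_le_max (by linarith) le_rfl
          · simp [hthr]
        rw [Fintype.sum_prod_type]
        refine (mul_le_mul_of_nonneg_left (Finset.sum_le_sum fun i _ => h1 i)
          (by positivity)).trans (le_of_eq ?_)
        rw [Finset.sum_const, Finset.card_univ, Fintype.card_fin, nsmul_eq_mul,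
          Fin.sum_univ_eq_sum_range
            (fun k => max (t - arrival τ 0 a - arrival τ 1 (k + 1)) 0), collisionRate]
        push_cast
        ring
      rw [Set.indicator_of_mem hξ]
      calc ENNReal.ofReal (Real.exp (-(collisionRate n a τ t 0 1 + (a + 1) / n * max t 0)))
          ≤ ENNReal.ofReal (Real.exp (-(1 / (n : ℝ) * ∑ p, max (thr p) 0))) :=
            ENNReal.ofReal_le_ofReal (Real.exp_le_exp.2 (neg_le_neg hsum))
        _ = weightLaw n {w | ∀ p, thr p ≤ edgeWeight w (b 0 p.1) (b 1 p.2)} := hlaw.symm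
        _ ≤ weightLaw n {w | reweight off Z w ∈ {w | t ≤ weightDist w (ρ 0) (ρ 1)}} := by
            refine measure_mono_ae ?_
            filter_upwards [ae_nonneg_weightLaw hn0] with w hw hwt
            refine h.le_weightDist hw (by rw [hκ0]; exact hξ.1) (by rw [hκ0, hκ1]; exact hξ.2)
              ?_ ?_
            · intro i hi
              rw [hκ0] at hi
              simpa [hthr] using hwt (⟨i, by omega⟩, 0)
            · intro i hi k hk hpos
              rw [hκ0] at hi ⊢
              rw [hκ1] at hk
              have := hwt (⟨i, by omega⟩, ⟨k, by omega⟩)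
              simpa [hthr, hpos.ne'] using this
        _ = ∫⁻ w, {w | t ≤ weightDist w (ρ 0) (ρ 1)}.indicator 1 (reweight off Z w)
              ∂weightLaw n := by
            exact (lintegral_indicator_one ((measurable_reweight off Z) hmeas)).symm
    · rw [Set.indicator_of_notMem hξ]
      exact zero_le

end CollisionRate

/-! ### Asymptotics of sums of positive parts, by elementary forms of Stirling's formula. -/

section Asymptotics

open scoped Topology Nat

theorem sum_sub_log (y : ℝ) (M : ℕ) :
    ∑ k ∈ Finset.range M, (y - Real.log (k + 1)) = M * y - Real.log (M !) := by
  induction M with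
  | zero => simp
  | succ M ih =>
    rw [Finset.sum_range_succ, ih, Nat.factorial_succ, Nat.cast_mul,
      Real.log_mul (by positivity) (by positivity)]
    push_cast
    ring

/-- The positive terms are those with `k + 1 ≤ e^y`. With `M = ⌊e^y⌋` they sum to `M y - log M!`,
the logarithm of `(e^y)^M / M!`, which is one term of the series of `exp (e^y)`. -/
theorem sum_max_sub_log_le (y : ℝ) (N : ℕ) :
    ∑ k ∈ Finset.range N, max (y - Real.log (k + 1)) 0 ≤ Real.exp y := by
  set M := ⌊Real.exp y⌋₊ with hM
  have h1 : ∑ k ∈ Finset.range N, max (y - Real.log (k + 1)) 0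
      ≤ ∑ k ∈ Finset.range M, (y - Real.log (k + 1)) := by
    have hpos : ∀ k < M, 0 ≤ y - Real.log (k + 1) := by
      intro k hk
      have h2 : ((k + 1 : ℕ) : ℝ) ≤ Real.exp y :=
        (Nat.le_floor_iff (Real.exp_pos y).le).1 hk
      push_cast at h2
      have := Real.log_le_log (by positivity) h2
      rw [Real.log_exp] at this
      linarith
    have hneg : ∀ k, M ≤ k → y - Real.log (k + 1) ≤ 0 := by
      intro k hk
      have h2 : Real.exp y < ((k + 1 : ℕ) : ℝ) :=
        (Nat.floor_lt (Real.exp_pos y).le).1 (by omega)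
      push_cast at h2
      have := Real.log_le_log (Real.exp_pos y) h2.le
      rw [Real.log_exp] at this
      linarith
    rw [← Finset.sum_filter_add_sum_filter_not (Finset.range N) (· < M),
      Finset.sum_eq_zero (s := (Finset.range N).filter fun k => ¬ k < M), add_zero]
    · refine (Finset.sum_congr rfl fun k hk => max_eq_left
        (hpos k (Finset.mem_filter.1 hk).2)).trans_le ?_
      refine Finset.sum_le_sum_of_subset_of_nonneg ?_ fun k hk _ =>
        hpos k (Finset.mem_range.1 hk)
      intro k hk
      exact Finset.mem_range.2 (Finset.mem_filter.1 hk).2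
    · intro k hk
      exact max_eq_right (hneg k (by simpa using (Finset.mem_filter.1 hk).2))
  refine h1.trans ?_
  rw [sum_sub_log]
  have h2 := Real.pow_div_factorial_le_exp (Real.exp y) (Real.exp_pos y).le M
  have h3 := Real.log_le_log (by positivity) h2
  rw [Real.log_exp, Real.log_div (by positivity) (by positivity), Real.log_pow, Real.log_exp] at h3
  exact h3

theorem log_factorial_le {M : ℕ} (hM : 1 ≤ M) :
    Real.log (M !) ≤ (M + 1) * Real.log M - M + 1 := by
  induction M, hM using Nat.le_induction with
  | base => simp
  | succ M hM ih =>
    have hM0 : (0 : ℝ) < M := by exact_mod_cast hM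
    rw [Nat.factorial_succ, Nat.cast_mul, Real.log_mul (by positivity) (by positivity)]
    have h1 := Real.one_sub_inv_le_log_of_pos (x := (M + 1) / M) (by positivity)
    rw [Real.log_div (by positivity) hM0.ne', inv_div] at h1
    have h2 : (1 : ℝ) - M / (M + 1) = 1 / (M + 1) := by field_simp; ring
    rw [h2, div_le_iff₀ (by positivity)] at h1
    push_cast
    nlinarith

/-- With `log M ≤ y` and the crude Stirling bound, `M y - log M!` is at least `M - 1 - y`, and `M >
e^y - 1`. -/
theorem le_sum_sub_log {y : ℝ} (hy : 0 ≤ y) :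
    Real.exp y - 2 - y ≤ ∑ k ∈ Finset.range ⌊Real.exp y⌋₊, (y - Real.log (k + 1)) := by
  set M := ⌊Real.exp y⌋₊ with hM
  have hM1 : 1 ≤ M := (Nat.one_le_floor_iff _).2 (Real.one_le_exp hy)
  have hM0 : (0 : ℝ) < M := by exact_mod_cast hM1
  have h1 : (M : ℝ) ≤ Real.exp y := Nat.floor_le (Real.exp_pos y).le
  have h2 : Real.exp y < M + 1 := Nat.lt_floor_add_one _
  have h3 := Real.log_le_log hM0 h1
  rw [Real.log_exp] at h3
  have h4 := log_factorial_le hM1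
  rw [sum_sub_log]
  nlinarith [mul_nonneg hM0.le (sub_nonneg.2 h3)]

/-- The asymptotics of the collision rate, when the arrival times are asymptotically logarithmic. -/
theorem tendsto_exp_neg_mul_sum_max {T : ℕ → ℝ} {Z : ℝ} (hT0 : ∀ j, 0 ≤ T j)
    (hT : Tendsto (fun j : ℕ => T j - Real.log (j + 1)) atTop (𝓝 Z)) {a : ℕ → ℕ} {c s : ℕ → ℝ}
    {B : ℕ → ℕ → ℝ} (hc : Tendsto (fun n => (c n - 1) * (Real.log (a n + 1) + 1)) atTop (𝓝 0))
    (hB : ∀ᶠ n in atTop, ∀ j ≤ a n, T j ≤ B n j ∧ B n j ≤ c n * T j)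
    (hc1 : ∀ᶠ n in atTop, 1 ≤ c n)
    (hs : Tendsto s atTop atTop)
    (has : Tendsto (fun n => Real.log (a n + 1) - s n) atTop atTop) :
    Tendsto (fun n => Real.exp (-s n) *
      ∑ k ∈ Finset.range (a n), max (s n - B n (k + 1)) 0) atTop (𝓝 (Real.exp (-Z))) := by
  have hse : Tendsto (fun n => s n * Real.exp (-s n)) atTop (𝓝 0) := by
    have := (Real.tendsto_pow_mul_exp_neg_atTop_nhds_zero 1).comp hs
    simpa [Function.comp_def] using this
  have he : Tendsto (fun n => Real.exp (-s n)) atTop (𝓝 0) :=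
    Real.tendsto_exp_neg_atTop_nhds_zero.comp hs
  have hexp : Tendsto (fun η : ℝ => Real.exp (η - Z)) (𝓝 0) (𝓝 (Real.exp (-Z))) := by
    have : Continuous fun η : ℝ => Real.exp (η - Z) := by fun_prop
    simpa using this.tendsto 0
  have hexp' : Tendsto (fun η : ℝ => Real.exp (-Z - η)) (𝓝 0) (𝓝 (Real.exp (-Z))) := by
    have : Continuous fun η : ℝ => Real.exp (-Z - η) := by fun_prop
    simpa using this.tendsto 0
  have near : ∀ η > 0, ∃ K : ℕ, ∀ j ≥ K, |T j - Real.log (j + 1) - Z| < η := by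
    intro η hη
    obtain ⟨K, hK⟩ := Metric.tendsto_atTop.1 hT η hη
    exact ⟨K, fun j hj => by have := hK j hj; rwa [Real.dist_eq] at this⟩
  rw [tendsto_order]
  constructor
  · intro l hl
    obtain ⟨η, hη, hlη⟩ : ∃ η > 0, l < Real.exp (-Z - η) := by
      have h1 : ∀ᶠ η in 𝓝[>] (0 : ℝ), l < Real.exp (-Z - η) :=
        (hexp'.mono_left nhdsWithin_le_nhds).eventually_const_lt hl
      obtain ⟨η, h2, h3⟩ := (h1.and self_mem_nhdsWithin).exists
      exact ⟨η, h3, h2⟩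
    -- Half of `η` bounds the deviation of `T j` from `log (j + 1) + Z`; the other half bounds the
    -- slowdown error `(c n - 1) * T j`. The indices below `K` are not controlled and cost only a
    -- multiple of `y`, negligible against `e^y`.
    obtain ⟨K, hK⟩ := near (η / 2) (by positivity)
    set D := |Z| + η + 1 with hD
    have hlim : Tendsto (fun n => Real.exp (-Z - η)
        - ((K + 2 : ℝ) * (s n * Real.exp (-s n))
          + (2 + (K + 2) * |(-Z - η)|) * Real.exp (-s n))) atTop (𝓝 (Real.exp (-Z - η))) := by
      have := (hse.const_mul (K + 2 : ℝ)).add (he.const_mul (2 + (K + 2) * |(-Z - η)|))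
      simpa using this.const_sub (Real.exp (-Z - η))
    have hcD : Tendsto (fun n => (c n - 1) * (Real.log (a n + 1) + 1) * D) atTop (𝓝 0) := by
      simpa using hc.mul_const D
    filter_upwards [hlim.eventually_const_lt hlη, hB, hc1,
      hs.eventually_ge_atTop (Z + η), has.eventually_ge_atTop (- Z - η),
      hcD.eventually_lt_const (show (0 : ℝ) < η / 2 by positivity)] with n h1 h2 h3 h4 h5 h6
    refine h1.trans_le ?_
    set y := s n - Z - η with hy
    have hy0 : 0 ≤ y := by linarith
    set M := ⌊Real.exp y⌋₊ with hM
    -- By `has`, all positive terms of the comparison sum lie within the explored range.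
    have hMa : M ≤ a n + 1 := by
      have h7 : Real.exp y ≤ a n + 1 := by
        rw [← Real.le_log_iff_exp_le (by positivity)]
        linarith
      have h8 : M ≤ ⌊((a n + 1 : ℕ) : ℝ)⌋₊ := Nat.floor_le_floor (by push_cast; exact h7)
      rwa [Nat.floor_natCast] at h8
    have hbound : ∀ j, K ≤ j → j ≤ a n → B n j ≤ Real.log (j + 1) + Z + η := by
      intro j hj hja
      have h7 := (h2 j hja).2
      have h8 := (abs_lt.1 (hK j hj)).2
      have hlogj : Real.log (j + 1) ≤ Real.log (a n + 1) :=
        Real.log_le_log (by positivity) (by exact_mod_cast Nat.succ_le_succ hja)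
      have hlog0 : 0 ≤ Real.log (a n + 1) := Real.log_nonneg (by simp)
      have h9 : T j ≤ (Real.log (a n + 1) + 1) * D := by
        have := le_abs_self Z
        have := abs_nonneg Z
        nlinarith
      have h10 := mul_le_mul_of_nonneg_left h9 (sub_nonneg.2 h3)
      linarith
    have hM1 : 1 ≤ M := (Nat.one_le_floor_iff _).2 (Real.one_le_exp hy0)
    -- The sum runs over `B n (k + 1)`, comparable to `log (k + 2)`, so it matches the comparison
    -- sum without its first term `y`.
    have hterm : ∀ k ∈ Finset.range (M - 1),
        (y - Real.log ((k + 1 : ℕ) + 1)) - (if k < K then y else 0)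
          ≤ max (s n - B n (k + 1)) 0 := by
      intro k hk
      have hk' := Finset.mem_range.1 hk
      by_cases hkK : k < K
      · rw [if_pos hkK]
        refine le_trans ?_ (le_max_right _ _)
        have : 0 ≤ Real.log ((k + 1 : ℕ) + 1) :=
          Real.log_nonneg (le_add_of_nonneg_left (Nat.cast_nonneg _))
        linarith
      · rw [if_neg hkK]
        refine le_trans ?_ (le_max_left _ _)
        have := hbound (k + 1) (by omega) (by omega)
        linarith
    have hcount : ∑ k ∈ Finset.range (M - 1), (if k < K then y else 0) ≤ K * y := by
      rw [← Finset.sum_filter, Finset.sum_const, nsmul_eq_mul]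
      refine mul_le_mul_of_nonneg_right ?_ hy0
      have : (Finset.range (M - 1)).filter (· < K) ⊆ Finset.range K := fun k hk =>
        Finset.mem_range.2 (Finset.mem_filter.1 hk).2
      exact_mod_cast (Finset.card_le_card this).trans (Finset.card_range K).le
    have hsum : Real.exp y - 2 - y - (K + 1) * y
        ≤ ∑ k ∈ Finset.range (a n), max (s n - B n (k + 1)) 0 := by
      have h7 := le_sum_sub_log hy0
      rw [← hM, ← Nat.sub_add_cancel hM1, Finset.sum_range_succ'] at h7
      have h8 := Finset.sum_le_sum hterm
      rw [Finset.sum_sub_distrib] at h8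
      have h9 : ∑ k ∈ Finset.range (M - 1), max (s n - B n (k + 1)) 0
          ≤ ∑ k ∈ Finset.range (a n), max (s n - B n (k + 1)) 0 :=
        Finset.sum_le_sum_of_subset_of_nonneg (Finset.range_mono (by omega))
          fun _ _ _ => le_max_right _ _
      simp only [Nat.cast_zero, zero_add, Real.log_one, sub_zero] at h7
      linarith
    have hys : y ≤ s n + |(-Z - η)| := by
      have := le_abs_self (-Z - η)
      linarith
    calc Real.exp (-Z - η) - ((K + 2 : ℝ) * (s n * Real.exp (-s n))
          + (2 + (K + 2) * |(-Z - η)|) * Real.exp (-s n))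
        = Real.exp (-s n) * (Real.exp y - 2 - (K + 2) * (s n + |(-Z - η)|)) := by
          have : Real.exp (-Z - η) = Real.exp (-s n) * Real.exp y := by
            rw [← Real.exp_add]; congr 1; rw [hy]; ring
          rw [this]; ring
      _ ≤ Real.exp (-s n) * (Real.exp y - 2 - y - (K + 1) * y) := by
          refine mul_le_mul_of_nonneg_left ?_ (Real.exp_pos _).le
          have := mul_le_mul_of_nonneg_left hys (show (0 : ℝ) ≤ K + 2 by positivity)
          linarith
      _ ≤ _ := mul_le_mul_of_nonneg_left hsum (Real.exp_pos _).le
  · intro u hu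
    obtain ⟨η, hη, huη⟩ : ∃ η > 0, Real.exp (η - Z) < u := by
      have h1 : ∀ᶠ η in 𝓝[>] (0 : ℝ), Real.exp (η - Z) < u :=
        (hexp.mono_left nhdsWithin_le_nhds).eventually_lt_const hu
      obtain ⟨η, h2, h3⟩ := (h1.and self_mem_nhdsWithin).exists
      exact ⟨η, h3, h2⟩
    obtain ⟨K, hK⟩ := near η hη
    have hlim : Tendsto (fun n => K * (s n * Real.exp (-s n)) + Real.exp (η - Z)) atTop
        (𝓝 (Real.exp (η - Z))) := by
      simpa using (hse.const_mul (K : ℝ)).add_const (Real.exp (η - Z))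
    filter_upwards [hlim.eventually_lt_const huη, hB, hs.eventually_ge_atTop 0] with n h1 h2 h3
    refine lt_of_le_of_lt ?_ h1
    have h4 : ∀ k ∈ Finset.range (a n), max (s n - B n (k + 1)) 0
        ≤ (if k < K then s n else 0)
          + max (s n - Z + η - Real.log ((k + 1 : ℕ) + 1)) 0 := by
      intro k hk
      have h5 := (h2 (k + 1) (Finset.mem_range.1 hk)).1
      by_cases hkK : k < K
      · rw [if_pos hkK]
        have := hT0 (k + 1)
        refine max_le ?_ ?_
        · have := le_max_right (s n - Z + η - Real.log ((k + 1 : ℕ) + 1)) 0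
          linarith
        · positivity
      · rw [if_neg hkK, zero_add]
        have h6 := (abs_lt.1 (hK (k + 1) (by omega))).1
        exact max_le_max (by linarith) le_rfl
    have h5 : ∑ k ∈ Finset.range (a n), (if k < K then s n else 0) ≤ K * s n := by
      rw [← Finset.sum_filter, Finset.sum_const, nsmul_eq_mul]
      refine mul_le_mul_of_nonneg_right ?_ h3
      have : (Finset.range (a n)).filter (· < K) ⊆ Finset.range K := fun k hk =>
        Finset.mem_range.2 (Finset.mem_filter.1 hk).2
      exact_mod_cast (Finset.card_le_card this).trans (Finset.card_range K).le
    have h6 : ∑ k ∈ Finset.range (a n), max (s n - Z + η - Real.log ((k + 1 : ℕ) + 1)) 0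
        ≤ Real.exp (s n - Z + η) := by
      refine le_trans ?_ (sum_max_sub_log_le (s n - Z + η) (a n + 1))
      rw [Finset.sum_range_succ']
      exact le_add_of_nonneg_right (le_max_right _ _)
    have h7 : ∑ k ∈ Finset.range (a n), max (s n - B n (k + 1)) 0
        ≤ K * s n + Real.exp (s n - Z + η) := by
      refine (Finset.sum_le_sum h4).trans ?_
      rw [Finset.sum_add_distrib]
      exact add_le_add h5 h6
    calc Real.exp (-s n) * ∑ k ∈ Finset.range (a n), max (s n - B n (k + 1)) 0
        ≤ Real.exp (-s n) * (K * s n + Real.exp (s n - Z + η)) :=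
          mul_le_mul_of_nonneg_left h7 (Real.exp_pos _).le
      _ = K * (s n * Real.exp (-s n)) + Real.exp (η - Z) := by
          rw [mul_add, ← Real.exp_add]
          ring_nf

end Asymptotics

/-! ### The choice of about `n^(2/3)` steps, and limits along a fixed family of waiting times. -/

section Steps

open scoped Topology

/-- The number of steps in the exploration of each ball. -/
noncomputable def steps (n : ℕ) : ℕ := ⌊(n : ℝ) ^ (2 / 3 : ℝ)⌋₊

theorem two_thirds_log_le_log_steps {n : ℕ} (hn : 1 ≤ n) :
    2 / 3 * Real.log n ≤ Real.log (steps n + 1) := by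
  have hn0 : (0 : ℝ) < n := by exact_mod_cast hn
  rw [← Real.log_rpow hn0]
  exact Real.log_le_log (by positivity) (Nat.lt_floor_add_one _).le

theorem steps_add_one_le {n : ℕ} (hn : 1 ≤ n) :
    (steps n + 1 : ℝ) ≤ 2 * (n : ℝ) ^ (2 / 3 : ℝ) := by
  have h1 : (1 : ℝ) ≤ (n : ℝ) ^ (2 / 3 : ℝ) :=
    Real.one_le_rpow (by exact_mod_cast hn) (by norm_num)
  have h2 : (steps n : ℝ) ≤ (n : ℝ) ^ (2 / 3 : ℝ) := Nat.floor_le (by positivity)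
  linarith

theorem log_steps_le {n : ℕ} (hn : 1 ≤ n) :
    Real.log (steps n + 1) ≤ Real.log 2 + 2 / 3 * Real.log n := by
  have hn0 : (0 : ℝ) < n := by exact_mod_cast hn
  rw [← Real.log_rpow hn0, ← Real.log_mul (by norm_num) (by positivity)]
  exact Real.log_le_log (by positivity) (steps_add_one_le hn)

theorem steps_add_one_div_le {n : ℕ} (hn : 1 ≤ n) :
    (steps n + 1 : ℝ) / n ≤ 2 * Real.exp (-(1 / 3 * Real.log n)) := by
  have hn0 : (0 : ℝ) < n := by exact_mod_cast hn
  rw [div_le_iff₀ hn0]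
  refine (steps_add_one_le hn).trans (le_of_eq ?_)
  rw [Real.rpow_def_of_pos hn0]
  nth_rewrite 3 [← Real.exp_log hn0]
  rw [mul_assoc, ← Real.exp_add]
  congr 2
  ring

theorem tendsto_log_natCast : Tendsto (fun n : ℕ => Real.log n) atTop atTop :=
  Real.tendsto_log_atTop.comp tendsto_natCast_atTop_atTop

theorem tendsto_steps : Tendsto steps atTop atTop :=
  tendsto_nat_floor_atTop.comp
    ((tendsto_rpow_atTop (by norm_num)).comp tendsto_natCast_atTop_atTop)

theorem tendsto_steps_div_mul_log :
    Tendsto (fun n : ℕ => (steps n + 1 : ℝ) / n * (Real.log n + 2)) atTop (𝓝 0) := by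
  have h1 : Tendsto (fun n : ℕ => 1 / 3 * Real.log n) atTop atTop :=
    tendsto_log_natCast.const_mul_atTop (by norm_num)
  have h2 := (Real.tendsto_pow_mul_exp_neg_atTop_nhds_zero 1).comp h1
  have h3 := Real.tendsto_exp_neg_atTop_nhds_zero.comp h1
  have h4 := (h2.const_mul 6).add (h3.const_mul 4)
  simp only [mul_zero, add_zero] at h4
  refine tendsto_of_tendsto_of_tendsto_of_le_of_le' tendsto_const_nhds h4 ?_ ?_
  · filter_upwards [eventually_ge_atTop 1] with n hn
    have : 0 ≤ Real.log n := Real.log_natCast_nonneg n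
    positivity
  · filter_upwards [eventually_ge_atTop 1] with n hn
    have : 0 ≤ Real.log n := Real.log_natCast_nonneg n
    refine (mul_le_mul_of_nonneg_right (steps_add_one_div_le hn) (by positivity)).trans
      (le_of_eq ?_)
    simp only [Function.comp_apply, pow_one]
    ring

theorem tendsto_steps_div : Tendsto (fun n : ℕ => (steps n + 1 : ℝ) / n) atTop (𝓝 0) := by
  refine squeeze_zero' (Eventually.of_forall fun n => by positivity) ?_ tendsto_steps_div_mul_log
  filter_upwards with n
  have : 0 ≤ Real.log n := Real.log_natCast_nonneg n
  exact le_mul_of_one_le_right (by positivity) (by linarith)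

theorem eventually_mul_steps_lt (m : ℕ) :
    ∀ᶠ n : ℕ in atTop, (m : ℝ) * (steps n + 1) < n := by
  have h := tendsto_steps_div.const_mul (m : ℝ)
  rw [mul_zero] at h
  filter_upwards [h.eventually_lt_const one_pos, eventually_ge_atTop 1] with n h1 hn
  have hn0 : (0 : ℝ) < n := by exact_mod_cast hn
  rw [← mul_div_assoc, div_lt_one hn0] at h1
  exact h1

theorem eventually_add_mul_steps_le (m : ℕ) : ∀ᶠ n : ℕ in atTop, m + m * steps n ≤ n := by
  filter_upwards [eventually_mul_steps_lt m] with n h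
  have : m * (steps n + 1) < n := by exact_mod_cast h
  linarith

/-- The maximal slowdown of the exploration by the depletion of the vertices. -/
noncomputable def slowdown (m n : ℕ) : ℝ := n / (n - m * (steps n + 1))

theorem one_le_slowdown {m n : ℕ} (h : (m : ℝ) * (steps n + 1) < n) : 1 ≤ slowdown m n := by
  rw [slowdown, one_le_div (by linarith)]
  have : (0 : ℝ) ≤ m * (steps n + 1) := by positivity
  linarith

theorem tendsto_slowdown (m : ℕ) : Tendsto (slowdown m) atTop (𝓝 1) := by
  have h : Tendsto (fun n : ℕ => (1 - (m : ℝ) * ((steps n + 1 : ℝ) / n))⁻¹) atTop (𝓝 1) := by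
    have := ((tendsto_steps_div.const_mul (m : ℝ)).const_sub 1).inv₀ (by simp)
    simpa using this
  refine h.congr' ?_
  filter_upwards [eventually_mul_steps_lt m, eventually_ge_atTop 1] with n h1 hn
  have hn0 : (0 : ℝ) < n := by exact_mod_cast hn
  rw [slowdown, inv_eq_one_div, div_eq_div_iff]
  · field_simp
  · have : (m : ℝ) * ((steps n + 1) / n) < 1 := by
      rw [← mul_div_assoc, div_lt_one hn0]; exact h1
    linarith
  · linarith

/-- The relative slowdown is of order `steps n / n`, so over times of order `log n` depletion shifts
the arrivals only by `o(1)`. -/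
theorem tendsto_slowdown_sub_one_mul_log (m : ℕ) :
    Tendsto (fun n => (slowdown m n - 1) * (Real.log (steps n + 1) + 1)) atTop (𝓝 0) := by
  have h := ((tendsto_steps_div_mul_log.const_mul (m : ℝ)).mul (tendsto_slowdown m))
  simp only [mul_zero, zero_mul] at h
  refine tendsto_of_tendsto_of_tendsto_of_le_of_le' tendsto_const_nhds h ?_ ?_
  · filter_upwards [eventually_mul_steps_lt m] with n h1
    have h2 := one_le_slowdown h1
    have h3 : 0 ≤ Real.log (steps n + 1 : ℝ) := Real.log_nonneg (by simp)
    exact mul_nonneg (by linarith) (by linarith)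
  · filter_upwards [eventually_mul_steps_lt m, eventually_ge_atTop 1] with n h1 hn
    have hn0 : (0 : ℝ) < n := by exact_mod_cast hn
    have h2 : slowdown m n - 1 = m * ((steps n + 1) / n) * slowdown m n := by
      have : (n : ℝ) - m * (steps n + 1) ≠ 0 := by linarith
      rw [slowdown]
      field_simp
      ring
    have h3 : Real.log (steps n + 1) + 1 ≤ Real.log n + 2 := by
      have := log_steps_le hn
      have := Real.log_two_lt_d9
      have : 0 ≤ Real.log n := Real.log_natCast_nonneg n
      linarith
    have h4 := one_le_slowdown h1
    calc (slowdown m n - 1) * (Real.log (steps n + 1) + 1)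
        = m * ((steps n + 1) / n) * slowdown m n * (Real.log (steps n + 1) + 1) := by rw [h2]
      _ ≤ m * ((steps n + 1) / n) * slowdown m n * (Real.log n + 2) :=
          mul_le_mul_of_nonneg_left h3 (by positivity)
      _ = _ := by ring

/-- The arrival times in the absence of depletion: a Yule process. -/
noncomputable def yuleTime (ξ : ℕ × ℕ → ℝ) (γ j : ℕ) : ℝ :=
  ∑ l ∈ Finset.range j, ξ (γ, l) / (l + 1)

theorem yuleTime_nonneg {ξ : ℕ × ℕ → ℝ} (hξ : ∀ p, 0 ≤ ξ p) (γ j : ℕ) : 0 ≤ yuleTime ξ γ j :=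
  Finset.sum_nonneg fun l _ => div_nonneg (hξ _) (by positivity)

/-- Each waiting time is `n / D` times its Yule counterpart, where the number `D` of unexplored
vertices lies between `n - m (steps n + 1)` and `n`. -/
theorem arrival_waiting_bounds {m n : ℕ} (h : (m : ℝ) * (steps n + 1) < n) {ξ : ℕ × ℕ → ℝ}
    (hξ : ∀ p, 0 ≤ ξ p) {γ j : ℕ} (hγ : γ < m) (hj : j ≤ steps n) :
    yuleTime ξ γ j ≤ arrival (waiting n m (steps n) ξ) γ j ∧
      arrival (waiting n m (steps n) ξ) γ j ≤ slowdown m n * yuleTime ξ γ j := by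
  unfold yuleTime arrival
  rw [Finset.mul_sum]
  have key : ∀ l ∈ Finset.range j, ξ (γ, l) / (l + 1) ≤ waiting n m (steps n) ξ (γ, l) ∧
      waiting n m (steps n) ξ (γ, l) ≤ slowdown m n * (ξ (γ, l) / (l + 1)) := by
    intro l hl
    have hl' : (l : ℝ) ≤ steps n := by
      exact_mod_cast (Finset.mem_range.1 hl).le.trans hj
    have hγ' : (γ : ℝ) * steps n ≤ (m - 1) * steps n := by
      refine mul_le_mul_of_nonneg_right ?_ (by positivity)
      have : (γ : ℝ) + 1 ≤ m := by exact_mod_cast hγ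
      linarith
    have hγ0 : (0 : ℝ) ≤ γ * steps n := by positivity
    have hl0 : (0 : ℝ) ≤ l := by positivity
    have hm0 : (0 : ℝ) ≤ m := by positivity
    have hn0 : (0 : ℝ) < n := lt_of_le_of_lt (by positivity) h
    set D : ℝ := n - m - γ * steps n - l with hD
    have hD1 : n - m * (steps n + 1) ≤ D := by rw [hD]; linarith
    have hD0 : 0 < D := by linarith
    have hDn : D ≤ n := by rw [hD]; linarith
    have hw : waiting n m (steps n) ξ (γ, l) = n / D * (ξ (γ, l) / (l + 1)) := by
      simp only [waiting, ← hD]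
      field_simp
    have hx : 0 ≤ ξ (γ, l) / (l + 1) := div_nonneg (hξ _) (by positivity)
    rw [hw]
    constructor
    · exact le_mul_of_one_le_left hx ((one_le_div hD0).2 hDn)
    · refine mul_le_mul_of_nonneg_right ?_ hx
      exact div_le_div_of_nonneg_left hn0.le (by linarith) hD1
  exact ⟨Finset.sum_le_sum fun l hl => (key l hl).1, Finset.sum_le_sum fun l hl => (key l hl).2⟩

variable {m : ℕ} {ξ : ℕ × ℕ → ℝ} {Z : ℕ → ℝ}

theorem tendsto_arrival_sub_log (hξ : ∀ p, 0 ≤ ξ p) {γ : ℕ} (hγ : γ < m)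
    (hZ : Tendsto (fun j : ℕ => yuleTime ξ γ j - Real.log (j + 1)) atTop (𝓝 (Z γ))) :
    Tendsto (fun n : ℕ => arrival (waiting n m (steps n) ξ) γ (steps n) - Real.log (steps n + 1))
      atTop (𝓝 (Z γ)) := by
  have h1 := hZ.comp tendsto_steps
  have h2 : Tendsto (fun n : ℕ => (yuleTime ξ γ (steps n) - Real.log (steps n + 1))
      + (slowdown m n - 1) * yuleTime ξ γ (steps n)) atTop (𝓝 (Z γ)) := by
    have h3 : Tendsto (fun n : ℕ => (slowdown m n - 1) *
        (yuleTime ξ γ (steps n) - Real.log (steps n + 1) - 1)) atTop (𝓝 0) := by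
      have := ((tendsto_slowdown m).sub_const 1).mul (h1.sub_const 1)
      simpa using this
    have h4 := h1.add (h3.add (tendsto_slowdown_sub_one_mul_log m))
    simp only [add_zero] at h4
    refine h4.congr fun n => ?_
    simp only [Function.comp_apply]
    ring
  refine tendsto_of_tendsto_of_tendsto_of_le_of_le' h1 h2 ?_ ?_
  · filter_upwards [eventually_mul_steps_lt m] with n h
    have := (arrival_waiting_bounds h hξ hγ le_rfl).1
    simp only [Function.comp_apply]
    linarith
  · filter_upwards [eventually_mul_steps_lt m] with n h
    have := (arrival_waiting_bounds h hξ hγ le_rfl).2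
    linarith

/-- With `s = log n + x - T_γ(a)`, the rate is `(a + 1) / n` times a sum asymptotic to `e^{s - Z
γ'}`. Since `s` is about `(1/3) log n` and `log (a + 1)` about `(2/3) log n`, both `s` and `log (a +
1) - s` tend to infinity, as the asymptotics require. -/
theorem tendsto_collisionRate (hξ : ∀ p, 0 ≤ ξ p)
    (hZ : ∀ γ < m, Tendsto (fun j : ℕ => yuleTime ξ γ j - Real.log (j + 1)) atTop (𝓝 (Z γ)))
    {γ γ' : ℕ} (hγ : γ < m) (hγ' : γ' < m) (x : ℝ) :
    Tendsto (fun n : ℕ => collisionRate n (steps n) (waiting n m (steps n) ξ) (Real.log n + x) γ γ')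
      atTop (𝓝 (Real.exp (x - Z γ - Z γ'))) := by
  have hA := tendsto_arrival_sub_log (m := m) hξ hγ (hZ γ hγ)
  set A : ℕ → ℝ := fun n => arrival (waiting n m (steps n) ξ) γ (steps n) with hAdef
  set s : ℕ → ℝ := fun n => Real.log n + x - A n with hs
  have hs1 : Tendsto s atTop atTop := by
    have h1 : Tendsto (fun n : ℕ => 1 / 3 * Real.log n
        + (x - Real.log 2 - (A n - Real.log (steps n + 1)))) atTop atTop :=
      (tendsto_log_natCast.const_mul_atTop (by norm_num)).atTop_add (hA.const_sub _)
    refine tendsto_atTop_mono' _ ?_ h1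
    filter_upwards [eventually_ge_atTop 1] with n hn
    have := log_steps_le hn
    simp only [hs]
    linarith
  have hs2 : Tendsto (fun n => Real.log (steps n + 1) - s n) atTop atTop := by
    have h1 : Tendsto (fun n : ℕ => 1 / 3 * Real.log n
        + ((A n - Real.log (steps n + 1)) - x)) atTop atTop :=
      (tendsto_log_natCast.const_mul_atTop (by norm_num)).atTop_add (hA.sub_const _)
    refine tendsto_atTop_mono' _ ?_ h1
    filter_upwards [eventually_ge_atTop 1] with n hn
    have := two_thirds_log_le_log_steps hn
    simp only [hs]
    linarith
  have hmain := tendsto_exp_neg_mul_sum_max (yuleTime_nonneg hξ γ') (hZ γ' hγ')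
    (B := fun n => arrival (waiting n m (steps n) ξ) γ') (tendsto_slowdown_sub_one_mul_log m)
    (by filter_upwards [eventually_mul_steps_lt m] with n h j hj
        exact arrival_waiting_bounds h hξ hγ' hj)
    (by filter_upwards [eventually_mul_steps_lt m] with n h using one_le_slowdown h) hs1 hs2
  have hE : Tendsto (fun n => Real.exp (x - (A n - Real.log (steps n + 1)))) atTop
      (𝓝 (Real.exp (x - Z γ))) := (Real.continuous_exp.tendsto _).comp (hA.const_sub x)
  have h := hE.mul hmain
  rw [← Real.exp_add, show x - Z γ + -Z γ' = x - Z γ - Z γ' by ring] at h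
  refine h.congr' ?_
  filter_upwards [eventually_ge_atTop 1] with n hn
  have hn0 : (0 : ℝ) < n := by exact_mod_cast hn
  -- The normalization `e^{-s}`, multiplied by the factor converging to `e^{x - Z γ}`, is exactly
  -- the prefactor of the rate.
  have h1 : Real.exp (x - (A n - Real.log (steps n + 1))) * Real.exp (-s n)
      = (steps n + 1) / n := by
    rw [← Real.exp_add, show x - (A n - Real.log (steps n + 1)) + -s n
      = Real.log (steps n + 1) - Real.log n by simp only [hs]; ring, Real.exp_sub,
      Real.exp_log (by positivity), Real.exp_log hn0]
  rw [← mul_assoc, h1, collisionRate]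

/-- Each radius is about `(2/3) log n`: one is below `log n + x`, the sum of the two is above it. -/
theorem eventually_mem_exploredEnough (hξ : ∀ p, 0 ≤ ξ p)
    (hZ : ∀ γ < 2, Tendsto (fun j : ℕ => yuleTime ξ γ j - Real.log (j + 1)) atTop (𝓝 (Z γ)))
    (x : ℝ) : ∀ᶠ n : ℕ in atTop, ξ ∈ exploredEnough n (steps n) (Real.log n + x) := by
  have h0 := tendsto_arrival_sub_log (m := 2) hξ (by norm_num) (hZ 0 (by norm_num))
  have h1 := tendsto_arrival_sub_log (m := 2) hξ (by norm_num) (hZ 1 (by norm_num))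
  have hl : Tendsto (fun n : ℕ => 1 / 3 * Real.log n) atTop atTop :=
    tendsto_log_natCast.const_mul_atTop (by norm_num)
  have ha := hl.atTop_add ((h0.neg.add_const (x - Real.log 2)))
  have hb := hl.atTop_add ((h0.add h1).sub_const x)
  filter_upwards [eventually_ge_atTop 1, ha.eventually_ge_atTop 0, hb.eventually_ge_atTop 0] with
    n hn h2 h3
  have h4 := log_steps_le hn
  have h5 := two_thirds_log_le_log_steps hn
  exact ⟨by linarith, by linarith⟩

theorem tendsto_steps_div_mul_max (x : ℝ) :
    Tendsto (fun n : ℕ => (steps n + 1 : ℝ) / n * max (Real.log n + x) 0) atTop (𝓝 0) := by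
  have h1 := tendsto_steps_div_mul_log.add (tendsto_steps_div.mul_const |x|)
  simp only [zero_mul, add_zero] at h1
  refine tendsto_of_tendsto_of_tendsto_of_le_of_le tendsto_const_nhds h1 ?_ ?_
  · intro n
    positivity
  · intro n
    have h2 : 0 ≤ Real.log n := Real.log_natCast_nonneg n
    have h3 : max (Real.log n + x) 0 ≤ (Real.log n + 2) + |x| :=
      max_le (by linarith [le_abs_self x]) (by positivity)
    refine (mul_le_mul_of_nonneg_left h3 (by positivity)).trans (le_of_eq ?_)
    ring

end Steps

/-! ### Moments of the standard exponential law. -/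

section ExponentialMoments

open scoped Topology

theorem toReal_exponentialPDF_one_smul (f : ℝ → ℝ) :
    (fun x => (exponentialPDF 1 x).toReal • f x) =
      (Set.Ici 0).indicator fun x => Real.exp (-x) * f x := by
  funext x
  rw [exponentialPDF_eq]
  by_cases hx : 0 ≤ x
  · rw [Set.indicator_of_mem (Set.mem_Ici.2 hx), if_pos hx, ENNReal.toReal_ofReal (by positivity)]
    simp
  · rw [Set.indicator_of_notMem (by simpa using hx), if_neg hx]
    simp

theorem integrable_expMeasure_one {f : ℝ → ℝ}
    (hf : IntegrableOn (fun x => Real.exp (-x) * f x) (Set.Ioi 0)) :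
    Integrable f (expMeasure 1) := by
  rw [expMeasure_eq_withDensity, integrable_withDensity_iff_integrable_smul'
    (measurable_exponentialPDF 1) (ae_of_all _ fun x => ENNReal.ofReal_lt_top),
    toReal_exponentialPDF_one_smul, integrable_indicator_iff measurableSet_Ici,
    integrableOn_Ici_iff_integrableOn_Ioi]
  exact hf

theorem integral_expMeasure_one (f : ℝ → ℝ) :
    ∫ x, f x ∂expMeasure 1 = ∫ x in Set.Ioi 0, Real.exp (-x) * f x := by
  rw [expMeasure_eq_withDensity, integral_withDensity_eq_integral_toReal_smul
    (measurable_exponentialPDF 1) (ae_of_all _ fun x => ENNReal.ofReal_lt_top),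
    toReal_exponentialPDF_one_smul, integral_indicator measurableSet_Ici,
    integral_Ici_eq_integral_Ioi]

theorem integral_id_expMeasure_one : ∫ x, x ∂expMeasure 1 = 1 := by
  rw [integral_expMeasure_one]
  have h := Real.Gamma_eq_integral (s := 2) two_pos
  rw [Real.Gamma_two] at h
  rw [h]
  refine setIntegral_congr_fun measurableSet_Ioi fun x _ => ?_
  norm_num

theorem memLp_id_expMeasure_one : MemLp (fun x : ℝ => x) 2 (expMeasure 1) := by
  rw [memLp_two_iff_integrable_sq (by fun_prop)]
  refine integrable_expMeasure_one ?_
  refine (Real.GammaIntegral_convergent (s := 3) (by norm_num)).congr_fun (fun x _ => ?_)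
    measurableSet_Ioi
  norm_num

end ExponentialMoments

/-! ### Almost sure convergence of centred Yule times. -/

section Convergence

open scoped Topology

variable {Ω : Type*} [MeasurableSpace Ω] {μ : Measure Ω} [IsProbabilityMeasure μ]

/-- A series of independent centered variables with summable variances converges almost surely. -/
theorem ae_exists_tendsto_sum_of_summable_variance {Y : ℕ → Ω → ℝ} (hm : ∀ l, Measurable (Y l))
    (hY : ∀ l, MemLp (Y l) 2 μ) (h0 : ∀ l, μ[Y l] = 0) (hind : iIndepFun Y μ)
    (hsum : Summable fun l => Var[Y l; μ]) :
    ∀ᵐ ω ∂μ, ∃ c, Tendsto (fun j => ∑ l ∈ Finset.range j, Y l ω) atTop (𝓝 c) := by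
  have hs : ∀ l, StronglyMeasurable (Y l) := fun l => (hm l).stronglyMeasurable
  let ℱ := Filtration.natural Y hs
  have hadp : ∀ l, StronglyMeasurable[ℱ l] (Y l) := Filtration.stronglyAdapted_natural hs
  have hint : ∀ l, Integrable (Y l) μ := fun l => (hY l).integrable one_le_two
  have hmart : Martingale (fun j => ∑ l ∈ Finset.range (j + 1), Y l) ℱ μ := by
    refine martingale_nat (fun j => ?_) (fun j => integrable_finsetSum' _ fun l _ => hint l)
      fun j => ?_
    · refine Finset.stronglyMeasurable_sum _ fun l hl => ?_
      exact (hadp l).mono (ℱ.mono (by simpa [Nat.lt_succ_iff] using hl))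
    · have hmeas : StronglyMeasurable[ℱ j] (∑ l ∈ Finset.range (j + 1), Y l) :=
        Finset.stronglyMeasurable_sum _ fun l hl =>
          (hadp l).mono (ℱ.mono (by simpa [Nat.lt_succ_iff] using hl))
      rw [Finset.sum_range_succ _ (j + 1)]
      refine EventuallyEq.symm ((condExp_add (integrable_finsetSum' _ fun l _ => hint l)
        (hint (j + 1)) _).trans ?_)
      rw [condExp_of_stronglyMeasurable (ℱ.le j) hmeas (integrable_finsetSum' _ fun l _ => hint l)]
      filter_upwards [hind.condExp_natural_ae_eq_of_lt hs (Nat.lt_succ_self j)] with ω hω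
      rw [Pi.add_apply, hω, h0, add_zero]
  -- Variances of independent terms add up, which bounds the partial sums in `L²` and hence in `L¹`;
  -- martingale convergence then applies.
  have hbdd : ∀ j, eLpNorm (∑ l ∈ Finset.range (j + 1), Y l) 1 μ ≤
      (Real.sqrt (∑' l, Var[Y l; μ])).toNNReal := fun j => by
    have hL2 : MemLp (∑ l ∈ Finset.range (j + 1), Y l) 2 μ := memLp_finsetSum' _ fun l _ => hY l
    refine (eLpNorm_le_eLpNorm_of_exponent_le one_le_two hL2.1).trans ?_
    have hmean : μ[∑ l ∈ Finset.range (j + 1), Y l] = 0 := by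
      simp only [Finset.sum_apply]
      rw [integral_finsetSum _ fun l _ => hint l]
      exact Finset.sum_eq_zero fun l _ => h0 l
    have hvar : ∫ ω, (∑ l ∈ Finset.range (j + 1), Y l) ω ^ 2 ∂μ ≤ ∑' l, Var[Y l; μ] := by
      rw [← variance_of_integral_eq_zero hL2.1.aemeasurable hmean,
        IndepFun.variance_sum (fun l _ => hY l) fun a _ b _ hab => hind.indepFun hab]
      exact hsum.sum_le_tsum _ fun l _ => variance_nonneg _ _
    rw [hL2.eLpNorm_eq_integral_rpow_norm (by norm_num) (by norm_num)]
    refine ENNReal.ofReal_le_ofReal ?_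
    rw [Real.sqrt_eq_rpow]
    norm_num
    exact Real.rpow_le_rpow (integral_nonneg fun ω => sq_nonneg _) (by simpa using hvar)
      (by norm_num)
  filter_upwards [hmart.submartingale.exists_ae_tendsto_of_bdd hbdd] with ω ⟨c, hc⟩
  refine ⟨c, (tendsto_add_atTop_iff_nat 1).1 ?_⟩
  simpa using hc

theorem ae_exists_tendsto_sum_div_sub_log {X : ℕ → Ω → ℝ} (hm : ∀ l, Measurable (X l))
    (hX : ∀ l, HasLaw (X l) (expMeasure 1) μ) (hind : iIndepFun X μ) :
    ∀ᵐ ω ∂μ, ∃ c, Tendsto (fun j : ℕ => ∑ l ∈ Finset.range j, X l ω / (l + 1) - Real.log (j + 1))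
      atTop (𝓝 c) := by
  have hL2 : ∀ l, MemLp (X l) 2 μ := fun l => by
    have h := memLp_id_expMeasure_one
    rw [← (hX l).map_eq] at h
    exact h.comp_of_map (hX l).aemeasurable
  have hmean : ∀ l, μ[X l] = 1 := fun l => by
    rw [(hX l).integral_eq, integral_id_expMeasure_one]
  have hvar : ∀ l, Var[X l; μ] = Var[id; expMeasure 1] := fun l => (hX l).variance_eq
  have key := ae_exists_tendsto_sum_of_summable_variance (μ := μ)
    (Y := fun (l : ℕ) ω => (X l ω - 1) * (l + 1 : ℝ)⁻¹) (fun l => by fun_prop)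
    (fun l => ((hL2 l).sub (memLp_const 1)).mul_const _) (fun l => ?_)
    (hind.comp (fun (l : ℕ) x => (x - 1) * (l + 1 : ℝ)⁻¹) fun l => by fun_prop) ?_
  · filter_upwards [key] with ω ⟨c, hc⟩
    -- The means `1 / (l + 1)` removed by centring sum to the harmonic numbers, whose difference
    -- from the logarithm tends to Euler's constant.
    refine ⟨c + Real.eulerMascheroniConstant, ?_⟩
    have h := hc.add Real.tendsto_harmonic_sub_log_add_one
    refine h.congr fun j => ?_
    have : (harmonic j : ℝ) = ∑ l ∈ Finset.range j, ((l : ℝ) + 1)⁻¹ := by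
      simp [harmonic]
    rw [this, ← add_sub_assoc, ← Finset.sum_add_distrib]
    congr 1
    refine Finset.sum_congr rfl fun l _ => ?_
    ring
  · rw [integral_mul_const, integral_sub ((hL2 l).integrable one_le_two) (integrable_const _),
      hmean]
    simp
  · have : ∀ l : ℕ, Var[fun ω => (X l ω - 1) * (l + 1 : ℝ)⁻¹; μ] =
        ((l + 1 : ℝ)⁻¹) ^ 2 * Var[id; expMeasure 1] := fun l => by
      rw [variance_mul_const, variance_sub_const (hm l).aestronglyMeasurable, hvar, mul_comm]
    simp_rw [this]
    refine Summable.mul_right _ ?_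
    have h := (summable_nat_add_iff 1).2 (Real.summable_nat_pow_inv.2 one_lt_two)
    simpa using h

end Convergence

/-! ### Exact distribution of Yule times and its Gumbel limit. -/

section YuleDistribution

open scoped Topology

variable {Ω : Type*} [MeasurableSpace Ω] {μ : Measure Ω} [IsProbabilityMeasure μ]

theorem measure_add_div_le {T X : Ω → ℝ} (hT : Measurable T) (hX : Measurable X)
    (hXlaw : HasLaw X (expMeasure 1) μ) (hind : IndepFun T X μ) (c x : ℝ) :
    μ {ω | T ω + X ω / c ≤ x} = ∫⁻ y, μ {ω | T ω ≤ x - y / c} ∂expMeasure 1 := by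
  have hs : MeasurableSet {p : ℝ × ℝ | p.1 + p.2 / c ≤ x} :=
    measurableSet_le (by fun_prop) measurable_const
  have h := hind.map_prod_eq_prod_map_map hT.aemeasurable hX.aemeasurable
  have h1 : μ {ω | T ω + X ω / c ≤ x} = μ.map (fun ω => (T ω, X ω)) {p | p.1 + p.2 / c ≤ x} := by
    rw [Measure.map_apply (by fun_prop) hs]; rfl
  have : IsProbabilityMeasure (μ.map T) := Measure.isProbabilityMeasure_map hT.aemeasurable
  rw [h1, h, hXlaw.map_eq, Measure.prod_apply_symm hs]
  refine lintegral_congr fun y => ?_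
  rw [Measure.map_apply hT (hs.preimage (by fun_prop))]
  congr 1
  ext ω
  simp [le_sub_iff_add_le]

theorem integral_exp_mul_sub_pow (j : ℕ) (x : ℝ) :
    ∫ y in (0 : ℝ)..(j + 1) * x,
        Real.exp (-y) * (1 - Real.exp (-(x - y / (j + 1)))) ^ j =
      (1 - Real.exp (-x)) ^ (j + 1) := by
  have hj : (j + 1 : ℝ) ≠ 0 := by positivity
  -- Since `e^{-y}` is the `(j + 1)`-st power of `e^{-y/(j+1)}`, the integrand is an exact
  -- derivative.
  have hderiv : ∀ y : ℝ, HasDerivAt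
      (fun y : ℝ => -(Real.exp (-(y / (j + 1))) - Real.exp (-x)) ^ (j + 1))
      (Real.exp (-y) * (1 - Real.exp (-(x - y / (j + 1)))) ^ j) y := fun y => by
    have h1 : HasDerivAt (fun y : ℝ => -(y / (j + 1))) (-(1 / (j + 1 : ℝ))) y :=
      ((hasDerivAt_id y).div_const _).neg
    have h2 := ((h1.exp.sub_const (Real.exp (-x))).pow (j + 1)).neg
    refine h2.congr_deriv ?_
    have e1 : Real.exp (-y) = Real.exp (-(y / (j + 1))) ^ j * Real.exp (-(y / (j + 1))) := by
      rw [← pow_succ, ← Real.exp_nat_mul]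
      congr 1
      push_cast
      field_simp
    have e2 : Real.exp (-(y / (j + 1))) * Real.exp (-(x - y / (j + 1))) = Real.exp (-x) := by
      rw [← Real.exp_add]; congr 1; ring
    rw [e1, ← e2]
    have e3 : ∀ A B : ℝ, A ^ j * A * (1 - B) ^ j = (A - A * B) ^ j * A := fun A B => by
      rw [show A - A * B = A * (1 - B) by ring, mul_pow]; ring
    rw [e3]
    push_cast
    field_simp
  rw [intervalIntegral.integral_eq_sub_of_hasDerivAt (fun y _ => hderiv y)
    (Continuous.intervalIntegrable (by fun_prop) _ _)]
  rw [mul_div_cancel_left₀ _ hj]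
  simp

/-- The value is the distribution function of the maximum of `j` independent standard exponentials,
in agreement with Rényi's representation. The induction convolves with the next term and uses
`integral_exp_mul_sub_pow`. -/
theorem measure_sum_div_le {X : ℕ → Ω → ℝ} (hm : ∀ l, Measurable (X l))
    (hX : ∀ l, HasLaw (X l) (expMeasure 1) μ) (hind : iIndepFun X μ) (j : ℕ) {x : ℝ}
    (hx : 0 ≤ x) :
    μ {ω | ∑ l ∈ Finset.range j, X l ω / (l + 1) ≤ x} =
      ENNReal.ofReal ((1 - Real.exp (-x)) ^ j) := by
  induction j generalizing x with
  | zero => simp [hx]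
  | succ j ih =>
    have hnn : ∀ᵐ ω ∂μ, ∀ l, 0 ≤ X l ω := ae_all_iff.2 fun l => by
      have h := ae_nonneg_expMeasure 1
      rw [← (hX l).map_eq] at h
      exact ae_of_ae_map (hX l).aemeasurable h
    have hneg : ∀ z < 0, μ {ω | ∑ l ∈ Finset.range j, X l ω / (l + 1) ≤ z} = 0 := fun z hz => by
      refine measure_mono_null ?_ (ae_iff.1 hnn)
      intro ω hω h
      have : 0 ≤ ∑ l ∈ Finset.range j, X l ω / (l + 1) :=
        Finset.sum_nonneg fun l _ => div_nonneg (h l) (by positivity)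
      exact absurd (this.trans hω) (not_le.2 hz)
    have hind' : IndepFun (fun ω => ∑ l ∈ Finset.range j, X l ω / (l + 1)) (X j) μ := by
      have h := hind.indepFun_finset (Finset.range j) {j} (by simp) hm
      exact h.comp (φ := fun f : Finset.range j → ℝ => ∑ l : Finset.range j, f l / ((l : ℕ) + 1 : ℝ))
        (ψ := fun f : ({j} : Finset ℕ) → ℝ => f ⟨j, by simp⟩) (by fun_prop) (by fun_prop) |>.congr
        (ae_of_all _ fun ω => by
          simp only [Function.comp]
          exact Finset.sum_coe_sort (Finset.range j) fun l => X l ω / ((l : ℝ) + 1))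
        (ae_of_all _ fun ω => rfl)
    have hj : (0 : ℝ) < j + 1 := by positivity
    have hjx : 0 ≤ (j + 1) * x := by positivity
    simp only [Finset.sum_range_succ]
    rw [measure_add_div_le (by fun_prop) (hm j) (hX j) hind']
    have hmeas : Measurable fun y => μ {ω | ∑ l ∈ Finset.range j, X l ω / (l + 1) ≤
        x - y / (j + 1)} := by
      refine Antitone.measurable fun y y' hy => measure_mono fun ω hω => ?_
      refine le_trans (Set.mem_ofPred_eq ▸ hω) ?_
      gcongr
    rw [lintegral_expMeasure 1 hmeas]
    have hval : (fun y => exponentialPDF 1 y * μ {ω | ∑ l ∈ Finset.range j, X l ω / (l + 1) ≤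
        x - y / (j + 1)}) = (Set.Icc 0 ((j + 1) * x)).indicator fun y =>
        ENNReal.ofReal (Real.exp (-y) * (1 - Real.exp (-(x - y / (j + 1)))) ^ j) := by
      funext y
      by_cases hy : y ∈ Set.Icc 0 ((j + 1) * x)
      · have hy' : 0 ≤ x - y / (j + 1) := by
          rw [sub_nonneg, div_le_iff₀ hj, mul_comm]; exact hy.2
        rw [Set.indicator_of_mem hy, ih hy', exponentialPDF_of_nonneg hy.1,
          ← ENNReal.ofReal_mul (by positivity)]
        simp
      · rw [Set.indicator_of_notMem hy]
        rcases lt_or_ge y 0 with h0 | h0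
        · rw [exponentialPDF_of_neg h0, zero_mul]
        · rw [hneg, mul_zero]
          rw [sub_neg, lt_div_iff₀ hj, mul_comm]
          by_contra h
          exact hy ⟨h0, not_lt.1 h⟩
    rw [hval, lintegral_indicator measurableSet_Icc, ← integral_exp_mul_sub_pow,
      intervalIntegral.integral_of_le hjx, ← integral_Icc_eq_integral_Ioc,
      ofReal_integral_eq_lintegral_ofReal]
    · exact (Continuous.continuousOn (by fun_prop)).integrableOn_compact isCompact_Icc
    · filter_upwards [ae_restrict_mem measurableSet_Icc] with y hy
      have hy' : 0 ≤ x - y / (j + 1) := by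
        rw [sub_nonneg, div_le_iff₀ hj, mul_comm]; exact hy.2
      have : 0 ≤ 1 - Real.exp (-(x - y / (j + 1))) := by
        rw [sub_nonneg, Real.exp_le_one_iff]; linarith
      exact mul_nonneg (Real.exp_nonneg _) (pow_nonneg this _)

theorem tendsto_measure_sum_div_sub_log_le {X : ℕ → Ω → ℝ} (hm : ∀ l, Measurable (X l))
    (hX : ∀ l, HasLaw (X l) (expMeasure 1) μ) (hind : iIndepFun X μ) (x : ℝ) :
    Tendsto (fun j : ℕ =>
      μ {ω | ∑ l ∈ Finset.range j, X l ω / (l + 1) - Real.log (j + 1) ≤ x}) atTop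
      (𝓝 (ENNReal.ofReal (Real.exp (-Real.exp (-x))))) := by
  have hlog : Tendsto (fun j : ℕ => Real.log (j + 1 : ℝ)) atTop atTop :=
    Real.tendsto_log_atTop.comp (tendsto_atTop_add_const_right _ _ tendsto_natCast_atTop_atTop)
  -- The exponent is `j` but the denominator is `j + 1`, so one factor is added to reach the
  -- standard limit for `exp` and divided out again.
  have hlim : Tendsto (fun j : ℕ => (1 + -Real.exp (-x) / ((j + 1 : ℕ) : ℝ)) ^ (j + 1) *
      (1 + -Real.exp (-x) / ((j + 1 : ℕ) : ℝ))⁻¹) atTop (𝓝 (Real.exp (-Real.exp (-x)) *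
      (1 + 0)⁻¹)) := by
    refine Tendsto.mul ?_ ?_
    · exact (tendsto_add_atTop_iff_nat 1).2 (Real.tendsto_one_add_div_pow_exp (-Real.exp (-x)))
    · refine Tendsto.inv₀ (tendsto_const_nhds.add ?_) (by norm_num)
      exact (tendsto_add_atTop_iff_nat 1).2 (tendsto_const_div_atTop_nhds_zero_nat _)
  rw [add_zero, inv_one, mul_one] at hlim
  refine (ENNReal.tendsto_ofReal hlim).congr' ?_
  filter_upwards [hlog.eventually_gt_atTop (-x)] with j hj
  have h0 : 0 < x + Real.log (j + 1) := by linarith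
  have hset : {ω | ∑ l ∈ Finset.range j, X l ω / (l + 1) - Real.log (j + 1) ≤ x} =
      {ω | ∑ l ∈ Finset.range j, X l ω / (l + 1) ≤ x + Real.log (j + 1)} := by
    ext ω; exact sub_le_iff_le_add (α := ℝ)
  rw [hset, measure_sum_div_le hm hX hind j h0.le]
  have he : Real.exp (-(x + Real.log (j + 1))) = Real.exp (-x) / ((j + 1 : ℕ) : ℝ) := by
    rw [neg_add, Real.exp_add, Real.exp_neg (Real.log _), Real.exp_log (by positivity)]
    push_cast; rfl
  have h1 : 1 + -Real.exp (-x) / ((j + 1 : ℕ) : ℝ) = 1 - Real.exp (-(x + Real.log (j + 1))) := by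
    rw [he]; ring
  have h2 : 1 - Real.exp (-(x + Real.log (j + 1))) ≠ 0 := by
    have := Real.exp_lt_one_iff.2 (neg_lt_zero.2 h0)
    linarith
  rw [h1, pow_succ, mul_assoc, mul_inv_cancel₀ h2, mul_one]

/-- Portmanteau bounds the limit law on open and closed half-lines; continuity of `F` closes the gap
between them. -/
theorem measure_le_of_ae_tendsto_gumbel {T : ℕ → Ω → ℝ} {G : Ω → ℝ} (hT : ∀ j, Measurable (T j))
    (hG : Measurable G) (hlim : ∀ᵐ ω ∂μ, Tendsto (fun j => T j ω) atTop (𝓝 (G ω)))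
    {F : ℝ → ℝ} (hF : Continuous F)
    (hcdf : ∀ x, Tendsto (fun j => μ {ω | T j ω ≤ x}) atTop (𝓝 (ENNReal.ofReal (F x)))) (x : ℝ) :
    μ {ω | G ω ≤ x} = ENNReal.ofReal (F x) := by
  have hd := (tendstoInDistribution_of_ae_tendsto (fun j => (hT j).aemeasurable)
    hG.aemeasurable hlim)
  have hupper : ∀ y, μ {ω | G ω < y} ≤ ENNReal.ofReal (F y) := fun y => by
    have h := ProbabilityMeasure.le_liminf_measure_open_of_tendsto hd.tendsto (isOpen_Iio (a := y))
    simp only [ProbabilityMeasure.coe_mk] at h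
    rw [Measure.map_apply hG measurableSet_Iio] at h
    refine h.trans ?_
    rw [← (hcdf y).liminf_eq]
    refine liminf_le_liminf (Eventually.of_forall fun j => ?_)
    rw [Measure.map_apply (hT j) measurableSet_Iio]
    exact measure_mono fun ω (hω : T j ω < y) => hω.le
  refine le_antisymm ?_ ?_
  · have hright : Tendsto (fun y => ENNReal.ofReal (F y)) (𝓝[>] x) (𝓝 (ENNReal.ofReal (F x))) :=
      (ENNReal.tendsto_ofReal (hF.tendsto x)).mono_left nhdsWithin_le_nhds
    refine ge_of_tendsto hright ?_
    filter_upwards [self_mem_nhdsWithin] with y hy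
    exact (measure_mono fun ω (hω : G ω ≤ x) => hω.trans_lt hy : _ ≤ μ {ω | G ω < y}).trans (hupper y)
  · have h := ProbabilityMeasure.limsup_measure_closed_le_of_tendsto hd.tendsto
      (isClosed_Iic (a := x))
    simp only [ProbabilityMeasure.coe_mk] at h
    rw [Measure.map_apply hG measurableSet_Iic] at h
    refine le_trans ?_ h
    rw [← (hcdf x).limsup_eq]
    refine limsup_le_limsup (Eventually.of_forall fun j => ?_)
    dsimp only
    rw [Measure.map_apply (hT j) measurableSet_Iic]
    rfl

end YuleDistribution

/-! ### The independent Gumbel limits of the explorations. -/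

section GumbelLimit

open scoped Topology

/-- The limit of the centred reach times of the `γ`-th ball. -/
noncomputable def gumbelLimit (ξ : ℕ × ℕ → ℝ) (γ : ℕ) : ℝ :=
  limsup (fun j : ℕ => yuleTime ξ γ j - Real.log (j + 1)) atTop

/-- The limit of the centred reach times, as a function of one sequence of waiting times. -/
noncomputable def rowLimit (η : ℕ → ℝ) : ℝ :=
  limsup (fun j : ℕ => ∑ l ∈ Finset.range j, η l / (l + 1) - Real.log (j + 1)) atTop

theorem measurable_rowLimit : Measurable rowLimit :=
  Measurable.limsup fun j => by fun_prop

theorem gumbelLimit_eq_rowLimit (γ : ℕ) :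
    (fun ξ => gumbelLimit ξ γ) = rowLimit ∘ fun ξ l => ξ (γ, l) := rfl

theorem measurable_gumbelLimit (γ : ℕ) : Measurable fun ξ => gumbelLimit ξ γ := by
  rw [gumbelLimit_eq_rowLimit]
  exact measurable_rowLimit.comp (by fun_prop)

theorem hasLaw_eval_expSeqLaw (p : ℕ × ℕ) : HasLaw (fun ξ => ξ p) (expMeasure 1) expSeqLaw :=
  (measurePreserving_eval_infinitePi (fun _ : ℕ × ℕ => expMeasure 1) p).hasLaw

theorem iIndepFun_eval_expSeqLaw : iIndepFun (fun p (ξ : ℕ × ℕ → ℝ) => ξ p) expSeqLaw :=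
  iIndepFun_infinitePi (P := fun _ : ℕ × ℕ => expMeasure 1) (X := fun _ x => x)
    fun _ => measurable_id

theorem iIndepFun_row_expSeqLaw (γ : ℕ) :
    iIndepFun (fun l (ξ : ℕ × ℕ → ℝ) => ξ (γ, l)) expSeqLaw :=
  iIndepFun_eval_expSeqLaw.precomp (Prod.mk_right_injective γ)

theorem ae_nonneg_expSeqLaw : ∀ᵐ ξ ∂expSeqLaw, ∀ p, 0 ≤ ξ p := ae_all_iff.2 fun p => by
  have h := ae_nonneg_expMeasure 1
  rw [← (hasLaw_eval_expSeqLaw p).map_eq] at h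
  exact ae_of_ae_map (hasLaw_eval_expSeqLaw p).aemeasurable h

theorem ae_tendsto_gumbelLimit : ∀ᵐ ξ ∂expSeqLaw, ∀ γ,
    Tendsto (fun j : ℕ => yuleTime ξ γ j - Real.log (j + 1)) atTop (𝓝 (gumbelLimit ξ γ)) := by
  refine ae_all_iff.2 fun γ => ?_
  filter_upwards [ae_exists_tendsto_sum_div_sub_log (μ := expSeqLaw)
    (X := fun l ξ => ξ (γ, l)) (fun l => by fun_prop) (fun l => hasLaw_eval_expSeqLaw _)
    (iIndepFun_row_expSeqLaw γ)] with ξ ⟨c, hc⟩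
  have h : gumbelLimit ξ γ = c := hc.limsup_eq
  rw [h]
  exact hc

theorem expSeqLaw_gumbelLimit_le (γ : ℕ) (x : ℝ) :
    expSeqLaw {ξ | gumbelLimit ξ γ ≤ x} = ENNReal.ofReal (Real.exp (-Real.exp (-x))) := by
  refine measure_le_of_ae_tendsto_gumbel (μ := expSeqLaw)
    (T := fun j ξ => yuleTime ξ γ j - Real.log (j + 1)) (fun j => ?_)
    (measurable_gumbelLimit γ) ?_ (F := fun x => Real.exp (-Real.exp (-x))) (by fun_prop)
    (fun x => ?_) x
  · unfold yuleTime; fun_prop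
  · filter_upwards [ae_tendsto_gumbelLimit] with ξ hξ using hξ γ
  · exact tendsto_measure_sum_div_sub_log_le (X := fun l (ξ : ℕ × ℕ → ℝ) => ξ (γ, l))
      (fun l => by fun_prop) (fun l => hasLaw_eval_expSeqLaw _) (iIndepFun_row_expSeqLaw γ) x

theorem iIndepFun_gumbelLimit : iIndepFun (fun γ ξ => gumbelLimit ξ γ) expSeqLaw := by
  have hrow : iIndepFun (fun γ (ξ : ℕ × ℕ → ℝ) l => ξ (γ, l)) expSeqLaw := by
    rw [iIndepFun_iff_map_fun_eq_infinitePi_map (fun γ => by fun_prop)]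
    have h1 : expSeqLaw.map (fun (ξ : ℕ × ℕ → ℝ) γ l => ξ (γ, l)) =
        Measure.infinitePi fun _ : ℕ => Measure.infinitePi fun _ : ℕ => expMeasure 1 :=
      Measure.infinitePi_map_curry (fun _ _ : ℕ => expMeasure 1)
    rw [h1]
    congr 1
    funext γ
    exact ((iIndepFun_row_expSeqLaw γ).hasLaw_infinitePi
      (fun l => hasLaw_eval_expSeqLaw (γ, l)) (Measurable.aemeasurable (by fun_prop))).map_eq.symm
  exact hrow.comp (fun _ => rowLimit) fun _ => measurable_rowLimit

end GumbelLimit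

/-! ### Limits of the joint and pairwise survival probabilities. -/

section Survival

open scoped Topology ENNReal

theorem integral_le_toReal_of_lintegral_ofReal_le {Ω : Type*} [MeasurableSpace Ω] {μ : Measure Ω}
    {f : Ω → ℝ} (hf : Measurable f) (h0 : ∀ ω, 0 ≤ f ω) {c : ℝ≥0∞} (hc : c ≠ ∞)
    (h : ∫⁻ ω, ENNReal.ofReal (f ω) ∂μ ≤ c) : ∫ ω, f ω ∂μ ≤ c.toReal := by
  rw [integral_eq_lintegral_of_nonneg_ae (ae_of_all _ h0) hf.aestronglyMeasurable]
  exact ENNReal.toReal_mono hc h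

/-- The rate at which the balls `γ` and `γ'` collide before time `log n + x`. -/
noncomputable def thresholdRate (n m : ℕ) (x : ℝ) (γ γ' : ℕ) (ξ : ℕ × ℕ → ℝ) : ℝ :=
  collisionRate n (steps n) (waiting n m (steps n) ξ) (Real.log n + x) γ γ'

theorem thresholdRate_nonneg (n m : ℕ) (x : ℝ) (γ γ' : ℕ) (ξ : ℕ × ℕ → ℝ) :
    0 ≤ thresholdRate n m x γ γ' ξ := collisionRate_nonneg _ _ _ _ _ _

theorem measurable_thresholdRate (n m : ℕ) (x : ℝ) (γ γ' : ℕ) :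
    Measurable (thresholdRate n m x γ γ') := measurable_collisionRate _ _ _ _ _ _

/-- The limit of the rate at which the balls `γ` and `γ'` collide before time `log n + x`. -/
noncomputable def limitRate (x : ℝ) (γ γ' : ℕ) (ξ : ℕ × ℕ → ℝ) : ℝ :=
  Real.exp (x - gumbelLimit ξ γ - gumbelLimit ξ γ')

theorem measurable_limitRate (x : ℝ) (γ γ' : ℕ) : Measurable (limitRate x γ γ') :=
  Real.measurable_exp.comp
    (((measurable_gumbelLimit γ).const_sub x).sub (measurable_gumbelLimit γ'))

theorem ae_tendsto_thresholdRate (m : ℕ) : ∀ᵐ ξ ∂expSeqLaw, ∀ γ < m, ∀ γ' < m, ∀ x,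
    Tendsto (fun n => thresholdRate n m x γ γ' ξ) atTop (𝓝 (limitRate x γ γ' ξ)) := by
  filter_upwards [ae_nonneg_expSeqLaw, ae_tendsto_gumbelLimit] with ξ h0 h γ hγ γ' hγ' x
  exact tendsto_collisionRate h0 (fun γ _ => h γ) hγ hγ' x

theorem exp_neg_mem_Icc {x : ℝ} (hx : 0 ≤ x) : Real.exp (-x) ∈ Set.Icc 0 1 :=
  ⟨Real.exp_nonneg _, Real.exp_le_one_iff.2 (neg_nonpos.2 hx)⟩

theorem integrable_exp_neg {f : (ℕ × ℕ → ℝ) → ℝ} (hf : Measurable f) (h0 : ∀ ξ, 0 ≤ f ξ) :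
    Integrable (fun ξ => Real.exp (-f ξ)) expSeqLaw :=
  Integrable.of_bound (by fun_prop) 1 (ae_of_all _ fun ξ => by
    rw [Real.norm_of_nonneg (Real.exp_nonneg _)]; exact (exp_neg_mem_Icc (h0 ξ)).2)

theorem tendsto_integral_exp_neg {f : ℕ → (ℕ × ℕ → ℝ) → ℝ} {g : (ℕ × ℕ → ℝ) → ℝ}
    (hf : ∀ n, Measurable (f n)) (h0 : ∀ n ξ, 0 ≤ f n ξ)
    (h : ∀ᵐ ξ ∂expSeqLaw, Tendsto (fun n => f n ξ) atTop (𝓝 (g ξ))) :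
    Tendsto (fun n => ∫ ξ, Real.exp (-f n ξ) ∂expSeqLaw) atTop
      (𝓝 (∫ ξ, Real.exp (-g ξ) ∂expSeqLaw)) := by
  refine tendsto_integral_of_dominated_convergence (fun _ => 1)
    (fun n => (integrable_exp_neg (hf n) (h0 n)).1) (integrable_const _)
    (fun n => ae_of_all _ fun ξ => ?_) ?_
  · rw [Real.norm_of_nonneg (Real.exp_nonneg _)]; exact (exp_neg_mem_Icc (h0 n ξ)).2
  · filter_upwards [h] with ξ hξ
    exact (Real.continuous_exp.tendsto _).comp hξ.neg

section

variable {n m : ℕ} {ρ : ℕ → Fin n}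

theorem weightLaw_real_farApart_le (hn0 : 0 < n) (hn : m + m * steps n ≤ n)
    (hρ : ∀ γ < m, ∀ γ' < m, ρ γ = ρ γ' → γ = γ') (x : OrderedPair m → ℝ) :
    (weightLaw n).real (farApart ρ fun q => Real.log n + x q) ≤
      ∫ ξ, Real.exp (-∑ q : OrderedPair m, thresholdRate n m (x q) q.1.1 q.1.2 ξ) ∂expSeqLaw := by
  have := isProbabilityMeasure_weightLaw hn0
  have hsum : Measurable fun ξ =>
      ∑ q : OrderedPair m, thresholdRate n m (x q) q.1.1 q.1.2 ξ :=
    Finset.measurable_sum _ fun q _ => measurable_thresholdRate _ _ _ _ _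
  have hsum0 : ∀ ξ, 0 ≤ ∑ q : OrderedPair m, thresholdRate n m (x q) q.1.1 q.1.2 ξ := fun ξ =>
    Finset.sum_nonneg fun q _ => thresholdRate_nonneg _ _ _ _ _ _
  have h := integral_le_toReal_of_lintegral_ofReal_le (μ := expSeqLaw)
    (f := fun ξ => 1 - Real.exp (-∑ q : OrderedPair m, thresholdRate n m (x q) q.1.1 q.1.2 ξ))
    (by fun_prop) (fun ξ => sub_nonneg.2 (exp_neg_mem_Icc (hsum0 ξ)).2)
    (measure_ne_top _ _) (lintegral_le_weightLaw_compl_farApart hn0 hn hρ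
      fun q => Real.log n + x q)
  rw [integral_sub (integrable_const _) (integrable_exp_neg hsum hsum0)] at h
  change _ ≤ (weightLaw n).real _ at h
  rw [probReal_compl_eq_one_sub (measurableSet_farApart _ _)] at h
  simp only [integral_const, probReal_univ, one_smul] at h
  linarith

theorem le_weightLaw_real_farApart (hn0 : 0 < n) (hn : m + m * steps n ≤ n)
    (hρ : ∀ γ < m, ∀ γ' < m, ρ γ = ρ γ' → γ = γ') (x : OrderedPair m → ℝ) :
    ∫ ξ, Real.exp (-∑ q : OrderedPair m, thresholdRate n m (x q) q.1.1 q.1.2 ξ) ∂expSeqLaw +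
      ∑ q : OrderedPair m,
        (1 - ∫ ξ, Real.exp (-thresholdRate n m (x q) q.1.1 q.1.2 ξ) ∂expSeqLaw) ≤
      (weightLaw n).real (farApart ρ fun q => Real.log n + x q) + ∑ q : OrderedPair m,
        (1 - (weightLaw n).real
          {w | Real.log n + x q ≤ weightDist w (ρ q.1.1) (ρ q.1.2)}) := by
  have := isProbabilityMeasure_weightLaw hn0
  have hr : ∀ q : OrderedPair m, Measurable (thresholdRate n m (x q) q.1.1 q.1.2) := fun q =>
    measurable_thresholdRate _ _ _ _ _
  have hr0 : ∀ (q : OrderedPair m) ξ, 0 ≤ thresholdRate n m (x q) q.1.1 q.1.2 ξ := fun q ξ =>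
    thresholdRate_nonneg _ _ _ _ _ _
  have hsum : Measurable fun ξ =>
      ∑ q : OrderedPair m, thresholdRate n m (x q) q.1.1 q.1.2 ξ :=
    Finset.measurable_sum _ fun q _ => hr q
  have hsum0 : ∀ ξ, 0 ≤ ∑ q : OrderedPair m, thresholdRate n m (x q) q.1.1 q.1.2 ξ := fun ξ =>
    Finset.sum_nonneg fun q _ => hr0 q ξ
  have hterm0 : ∀ (q : OrderedPair m) ξ,
      0 ≤ 1 - Real.exp (-thresholdRate n m (x q) q.1.1 q.1.2 ξ) := fun q ξ =>
    sub_nonneg.2 (exp_neg_mem_Icc (hr0 q ξ)).2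
  have hint : ∀ q : OrderedPair m, Integrable
      (fun ξ => 1 - Real.exp (-thresholdRate n m (x q) q.1.1 q.1.2 ξ)) expSeqLaw := fun q =>
    (integrable_const _).sub (integrable_exp_neg (hr q) (hr0 q))
  have hfin : ∑ q : OrderedPair m, weightLaw n
      {w | Real.log n + x q ≤ weightDist w (ρ q.1.1) (ρ q.1.2)}ᶜ ≠ ∞ :=
    ENNReal.sum_ne_top.2 fun q _ => measure_ne_top _ _
  have h := integral_le_toReal_of_lintegral_ofReal_le (μ := expSeqLaw)
    (f := fun ξ => Real.exp (-∑ q : OrderedPair m, thresholdRate n m (x q) q.1.1 q.1.2 ξ) +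
      ∑ q : OrderedPair m, (1 - Real.exp (-thresholdRate n m (x q) q.1.1 q.1.2 ξ)))
    (c := weightLaw n (farApart ρ fun q => Real.log n + x q) + ∑ q : OrderedPair m,
      weightLaw n {w | Real.log n + x q ≤ weightDist w (ρ q.1.1) (ρ q.1.2)}ᶜ)
    (by fun_prop)
    (fun ξ => add_nonneg (Real.exp_nonneg _) (Finset.sum_nonneg fun q _ => hterm0 q ξ))
    (ENNReal.add_ne_top.2 ⟨measure_ne_top _ _, hfin⟩) ?_
  · rw [integral_add (integrable_exp_neg hsum hsum0) (integrable_finsetSum _ fun q _ => hint q),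
      integral_finsetSum _ fun q _ => hint q,
      ENNReal.toReal_add (measure_ne_top _ _) hfin,
      ENNReal.toReal_sum fun q _ => measure_ne_top _ _] at h
    have e1 : ∀ q : OrderedPair m,
        ∫ ξ, (1 - Real.exp (-thresholdRate n m (x q) q.1.1 q.1.2 ξ)) ∂expSeqLaw =
        1 - ∫ ξ, Real.exp (-thresholdRate n m (x q) q.1.1 q.1.2 ξ) ∂expSeqLaw := fun q => by
      rw [integral_sub (integrable_const _) (integrable_exp_neg (hr q) (hr0 q))]
      simp
    have e2 : ∀ q : OrderedPair m,
        (weightLaw n {w | Real.log n + x q ≤ weightDist w (ρ q.1.1) (ρ q.1.2)}ᶜ).toReal =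
        1 - (weightLaw n).real
          {w | Real.log n + x q ≤ weightDist w (ρ q.1.1) (ρ q.1.2)} := fun q =>
      probReal_compl_eq_one_sub (measurableSet_le_weightDist _ _ _)
    simp only [e1, e2] at h
    exact h
  · refine le_trans (lintegral_mono fun ξ => ?_) (lintegral_le_weightLaw_farApart_add hn0 hn hρ
      fun q => Real.log n + x q)
    dsimp only
    rw [ENNReal.ofReal_add (Real.exp_nonneg _) (Finset.sum_nonneg fun q _ => hterm0 q ξ),
      ENNReal.ofReal_sum_of_nonneg fun q _ => hterm0 q ξ]
    exact le_rfl

theorem measurableSet_exploredEnough (n a : ℕ) (t : ℝ) : MeasurableSet (exploredEnough n a t) :=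
  (measurableSet_le (measurable_arrival_waiting n 2 a 0 a) measurable_const).inter
    (measurableSet_le measurable_const
      ((measurable_arrival_waiting n 2 a 0 a).add (measurable_arrival_waiting n 2 a 1 a)))

/-- The probability, given the result of the exploration, that two balls do not collide before
time `log n + x`. -/
noncomputable def pairSurvival (n : ℕ) (x : ℝ) : (ℕ × ℕ → ℝ) → ℝ :=
  (exploredEnough n (steps n) (Real.log n + x)).indicator fun ξ =>
    Real.exp (-(thresholdRate n 2 x 0 1 ξ + (steps n + 1) / n * max (Real.log n + x) 0))

theorem measurable_pairSurvival (n : ℕ) (x : ℝ) : Measurable (pairSurvival n x) := by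
  have h := measurable_thresholdRate n 2 x 0 1
  exact Measurable.indicator (by fun_prop) (measurableSet_exploredEnough _ _ _)

theorem pairSurvival_mem_Icc (n : ℕ) (x : ℝ) (ξ : ℕ × ℕ → ℝ) :
    pairSurvival n x ξ ∈ Set.Icc (0 : ℝ) 1 := by
  unfold pairSurvival
  by_cases hξ : ξ ∈ exploredEnough n (steps n) (Real.log n + x)
  · rw [Set.indicator_of_mem hξ]
    exact exp_neg_mem_Icc (add_nonneg (thresholdRate_nonneg _ _ _ _ _ _) (by positivity))
  · rw [Set.indicator_of_notMem hξ]
    exact ⟨le_rfl, zero_le_one⟩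

theorem tendsto_integral_pairSurvival (x : ℝ) :
    Tendsto (fun n => ∫ ξ, pairSurvival n x ξ ∂expSeqLaw) atTop
      (𝓝 (∫ ξ, Real.exp (-limitRate x 0 1 ξ) ∂expSeqLaw)) := by
  refine tendsto_integral_of_dominated_convergence (fun _ => 1)
    (fun n => (measurable_pairSurvival n x).aestronglyMeasurable) (integrable_const _)
    (fun n => ae_of_all _ fun ξ => ?_) ?_
  · rw [Real.norm_of_nonneg (pairSurvival_mem_Icc n x ξ).1]
    exact (pairSurvival_mem_Icc n x ξ).2
  · filter_upwards [ae_nonneg_expSeqLaw, ae_tendsto_gumbelLimit, ae_tendsto_thresholdRate 2]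
      with ξ h0 h hr
    have h1 := (hr 0 (by norm_num) 1 (by norm_num) x).add (tendsto_steps_div_mul_max x)
    rw [add_zero] at h1
    refine ((Real.continuous_exp.tendsto _).comp h1.neg).congr' ?_
    filter_upwards [eventually_mem_exploredEnough h0 (fun γ _ => h γ) x] with n hn
    exact (Set.indicator_of_mem hn (fun ξ => Real.exp (-(thresholdRate n 2 x 0 1 ξ +
      (steps n + 1) / n * max (Real.log n + x) 0)))).symm

theorem integral_pairSurvival_le (hn : 2 + 2 * steps n ≤ n) {u v : Fin n} (huv : u ≠ v) (x : ℝ) :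
    ∫ ξ, pairSurvival n x ξ ∂expSeqLaw ≤
      (weightLaw n).real {w | Real.log n + x ≤ weightDist w u v} := by
  have := isProbabilityMeasure_weightLaw (n := n) (by omega)
  refine integral_le_toReal_of_lintegral_ofReal_le (measurable_pairSurvival n x)
    (fun ξ => (pairSurvival_mem_Icc n x ξ).1) (measure_ne_top _ _) ?_
  have h := lintegral_le_weightLaw_le_weightDist (ρ := fun γ => if γ = 0 then u else v) hn ?_
    (Real.log n + x)
  · refine le_trans (lintegral_mono fun ξ => ?_) h
    unfold pairSurvival
    by_cases hξ : ξ ∈ exploredEnough n (steps n) (Real.log n + x)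
    · rw [Set.indicator_of_mem hξ, Set.indicator_of_mem hξ]
      exact le_rfl
    · rw [Set.indicator_of_notMem hξ, Set.indicator_of_notMem hξ, ENNReal.ofReal_zero]
  · intro γ hγ γ' hγ' h
    interval_cases γ <;> interval_cases γ' <;> simp_all [eq_comm]

end

theorem map_gumbelLimit_eq (γ γ' : ℕ) :
    expSeqLaw.map (fun ξ => gumbelLimit ξ γ) = expSeqLaw.map fun ξ => gumbelLimit ξ γ' := by
  have := Measure.isProbabilityMeasure_map (μ := expSeqLaw) (measurable_gumbelLimit γ).aemeasurable
  refine Measure.ext_of_Iic _ _ fun x => ?_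
  rw [Measure.map_apply (measurable_gumbelLimit γ) measurableSet_Iic,
    Measure.map_apply (measurable_gumbelLimit γ') measurableSet_Iic]
  exact (expSeqLaw_gumbelLimit_le γ x).trans (expSeqLaw_gumbelLimit_le γ' x).symm

/-- The limits `gumbelLimit` are i.i.d., so every pair has the same limiting survival probability.
This identifies the pair terms of the `m`-ball exploration with those of the two-ball exploration.
-/
theorem integral_exp_neg_limitRate_eq {γ γ' : ℕ} (h : γ ≠ γ') (x : ℝ) :
    ∫ ξ, Real.exp (-limitRate x γ γ' ξ) ∂expSeqLaw =
      ∫ ξ, Real.exp (-limitRate x 0 1 ξ) ∂expSeqLaw := by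
  have key : ∀ {γ γ' : ℕ}, γ ≠ γ' → ∫ ξ, Real.exp (-limitRate x γ γ' ξ) ∂expSeqLaw =
      ∫ p : ℝ × ℝ, Real.exp (-Real.exp (x - p.1 - p.2))
        ∂(expSeqLaw.map fun ξ => gumbelLimit ξ 0).prod (expSeqLaw.map fun ξ => gumbelLimit ξ 0) := by
    intro γ γ' h
    have h1 := (iIndepFun_gumbelLimit.indepFun h).map_prod_eq_prod_map_map
      (measurable_gumbelLimit γ).aemeasurable (measurable_gumbelLimit γ').aemeasurable
    rw [map_gumbelLimit_eq γ 0, map_gumbelLimit_eq γ' 0] at h1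
    rw [← h1, integral_map ((measurable_gumbelLimit γ).prodMk (measurable_gumbelLimit γ')).aemeasurable
      (Continuous.aestronglyMeasurable (by fun_prop))]
    rfl
  rw [key h, key zero_ne_one]

theorem tendsto_weightLaw_real_farApart {m : ℕ} (hm : 0 < m) (ρ : (n : Set.Ici m) → ℕ → Fin n)
    (hρ : ∀ n, ∀ γ < m, ∀ γ' < m, ρ n γ = ρ n γ' → γ = γ') (x : OrderedPair m → ℝ) :
    Tendsto (fun n : Set.Ici m =>
        (weightLaw n).real (farApart (ρ n) fun q => Real.log ((n : ℕ) : ℝ) + x q)) atTop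
      (𝓝 (∫ ξ, Real.exp (-∑ q : OrderedPair m, limitRate (x q) q.1.1 q.1.2 ξ) ∂expSeqLaw)) := by
  have hval : Tendsto (fun n : Set.Ici m => (n : ℕ)) atTop atTop := (map_val_Ici_atTop m).le
  have hR : Tendsto (fun n => ∫ ξ, Real.exp (-∑ q : OrderedPair m,
      thresholdRate n m (x q) q.1.1 q.1.2 ξ) ∂expSeqLaw) atTop
      (𝓝 (∫ ξ, Real.exp (-∑ q : OrderedPair m, limitRate (x q) q.1.1 q.1.2 ξ) ∂expSeqLaw)) := by
    refine tendsto_integral_exp_neg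
      (fun n => Finset.measurable_sum _ fun q _ => measurable_thresholdRate _ _ _ _ _)
      (fun n ξ => Finset.sum_nonneg fun q _ => thresholdRate_nonneg _ _ _ _ _ _) ?_
    filter_upwards [ae_tendsto_thresholdRate m] with ξ hξ
    exact tendsto_finsetSum _ fun q _ => hξ _ q.1.1.2 _ q.1.2.2 _
  have hP : ∀ q : OrderedPair m, Tendsto (fun n => ∫ ξ, Real.exp
      (-thresholdRate n m (x q) q.1.1 q.1.2 ξ) ∂expSeqLaw) atTop
      (𝓝 (∫ ξ, Real.exp (-limitRate (x q) 0 1 ξ) ∂expSeqLaw)) := fun q => by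
    have hne : (q.1.1 : ℕ) ≠ q.1.2 := fun h => q.2.ne (Fin.ext h)
    rw [← integral_exp_neg_limitRate_eq hne]
    refine tendsto_integral_exp_neg (fun n => measurable_thresholdRate _ _ _ _ _)
      (fun n ξ => thresholdRate_nonneg _ _ _ _ _ _) ?_
    filter_upwards [ae_tendsto_thresholdRate m] with ξ hξ
    exact hξ _ q.1.1.2 _ q.1.2.2 _
  -- The lower bound is the joint term plus the collision probabilities seen by the `m`-ball
  -- exploration, minus upper bounds for `P(d_q < t_q)` from two-ball explorations. The last two
  -- sums have equal limits and cancel.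
  have hlow := (hR.add (tendsto_finsetSum (Finset.univ : Finset (OrderedPair m)) fun q _ =>
    (hP q).const_sub 1)).sub (tendsto_finsetSum (Finset.univ : Finset (OrderedPair m)) fun q _ =>
    (tendsto_integral_pairSurvival (x q)).const_sub 1)
  rw [add_sub_cancel_right] at hlow
  refine tendsto_of_tendsto_of_tendsto_of_le_of_le' (hlow.comp hval) (hR.comp hval) ?_ ?_
  · filter_upwards [hval.eventually (eventually_add_mul_steps_le m),
      hval.eventually (eventually_add_mul_steps_le 2)] with n hn hn2
    have h1 := le_weightLaw_real_farApart (hm.trans_le n.2) hn (hρ n) x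
    have h2 : ∑ q : OrderedPair m, (1 - (weightLaw n).real
        {w | Real.log ((n : ℕ) : ℝ) + x q ≤ weightDist w (ρ n q.1.1) (ρ n q.1.2)}) ≤
        ∑ q : OrderedPair m, (1 - ∫ ξ, pairSurvival n (x q) ξ ∂expSeqLaw) := by
      refine Finset.sum_le_sum fun q _ => sub_le_sub_left (integral_pairSurvival_le hn2 ?_ _) _
      exact fun h => q.2.ne (Fin.ext (hρ n _ q.1.1.2 _ q.1.2.2 h))
    simp only [Function.comp]
    linarith
  · filter_upwards [hval.eventually (eventually_add_mul_steps_le m)] with n hn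
    exact weightLaw_real_farApart_le (hm.trans_le n.2) hn (hρ n) x

end Survival

/-! ### Weak convergence from the probabilities of closed upper orthants. -/

section Orthants

open scoped Topology

variable {ι κ : Type*}

theorem isPiSystem_range_Ici : IsPiSystem (Set.range (Set.Ici : (ι → ℝ) → Set (ι → ℝ))) := by
  rintro _ ⟨x, rfl⟩ _ ⟨y, rfl⟩ -
  exact ⟨x ⊔ y, Set.Ici_inter_Ici.symm⟩

theorem isPiSystem_range_pi_Ico :
    IsPiSystem (Set.range fun p : (ι → ℝ) × (ι → ℝ) =>
      Set.univ.pi fun i => Set.Ico (p.1 i) (p.2 i)) := by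
  rintro _ ⟨p, rfl⟩ _ ⟨q, rfl⟩ -
  refine ⟨(p.1 ⊔ q.1, p.2 ⊓ q.2), ?_⟩
  simp only [← Set.pi_inter_distrib, Set.Ico_inter_Ico]
  rfl

/-- A half-open box is an orthant minus orthants with one coordinate of the corner raised; the `max`
keeps these inside the first orthant even when the box is empty. The probability of a box is thus
determined by those of orthants through inclusion-exclusion. -/
theorem pi_Ico_eq_Ici_diff [Fintype ι] [DecidableEq ι] (a b : ι → ℝ) :
    (Set.univ.pi fun i => Set.Ico (a i) (b i)) = Set.Ici a \
      ⋃ s ∈ Finset.univ.image fun i => Set.Ici (Function.update a i (max (a i) (b i))), s := by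
  ext x
  simp only [Set.mem_univ_pi, Set.mem_Ico, Set.mem_sdiff, Set.mem_Ici, Finset.mem_image,
    Finset.mem_univ, true_and, Set.iUnion_exists, Set.iUnion_iUnion_eq', Set.mem_iUnion, not_exists]
  constructor
  · intro h
    refine ⟨fun i => (h i).1, fun i hi => ?_⟩
    have := hi i
    rw [Function.update_self] at this
    exact absurd ((le_max_right _ _).trans this) (not_le.2 (h i).2)
  · rintro ⟨h1, h2⟩ i
    refine ⟨h1 i, not_le.1 fun hb => h2 i fun j => ?_⟩
    by_cases hj : j = i
    · subst hj
      rw [Function.update_self]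
      exact max_le (h1 j) hb
    · rw [Function.update_of_ne hj]
      exact h1 j

/-- Laws on a finite-dimensional space converge weakly as soon as the probabilities of all the
closed orthants converge. -/
theorem tendsto_probabilityMeasure_of_tendsto_Ici [Fintype ι] {l : Filter κ} [l.IsCountablyGenerated]
    {μ : κ → ProbabilityMeasure (ι → ℝ)} {ν : ProbabilityMeasure (ι → ℝ)}
    (h : ∀ x, Tendsto (fun k => (μ k : Measure (ι → ℝ)).real (Set.Ici x)) l
      (𝓝 ((ν : Measure (ι → ℝ)).real (Set.Ici x)))) : Tendsto μ l (𝓝 ν) := by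
  classical
  refine isPiSystem_range_pi_Ico.tendsto_probabilityMeasure_of_tendsto_of_mem ?_ ?_ ?_
  · rintro _ ⟨p, rfl⟩
    exact MeasurableSet.univ_pi fun i => measurableSet_Ico
  · intro u hu x hx
    obtain ⟨ε, hε, hball⟩ := Metric.isOpen_iff.1 hu x hx
    refine ⟨_, ⟨(fun i => x i - ε / 2, fun i => x i + ε / 2), rfl⟩, ?_, ?_⟩
    · exact set_pi_mem_nhds Set.finite_univ fun i _ =>
        Ico_mem_nhds (by linarith) (by linarith)
    · refine Set.Subset.trans (fun y hy => ?_) hball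
      rw [Metric.mem_ball]
      refine lt_of_le_of_lt ((dist_pi_le_iff (by positivity)).2 fun i => ?_) (half_lt_self hε)
      have := hy i (Set.mem_univ i)
      rw [Real.dist_eq, abs_le]
      constructor <;> linarith [this.1, this.2]
  · rintro _ ⟨⟨a, b⟩, rfl⟩
    set T : Finset (Set (ι → ℝ)) :=
      Finset.univ.image fun i => Set.Ici (Function.update a i (max (a i) (b i))) with hT
    have hmeas : ∀ s ∈ Set.range (Set.Ici : (ι → ℝ) → Set (ι → ℝ)), MeasurableSet s := by
      rintro _ ⟨x, rfl⟩
      exact measurableSet_Ici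
    have hTmem : ∀ s ∈ T, s ∈ Set.range (Set.Ici : (ι → ℝ) → Set (ι → ℝ)) := fun s hs => by
      obtain ⟨i, -, rfl⟩ := Finset.mem_image.1 hs
      exact ⟨_, rfl⟩
    have hunion := isPiSystem_range_Ici.tendsto_measureReal_biUnion
      (μ := fun k => (μ k : Measure (ι → ℝ))) (ν := (ν : Measure (ι → ℝ))) (l := l) hTmem hmeas
      (by rintro _ ⟨x, rfl⟩; exact h x)
    have hsub : (⋃ s ∈ T, s) ⊆ Set.Ici a := by
      refine Set.iUnion₂_subset fun s hs => ?_
      obtain ⟨i, -, rfl⟩ := Finset.mem_image.1 hs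
      refine Set.Ici_subset_Ici.2 fun j => ?_
      by_cases hj : j = i
      · subst hj; rw [Function.update_self]; exact le_max_left _ _
      · rw [Function.update_of_ne hj]
    have hUmeas : MeasurableSet (⋃ s ∈ T, s) :=
      T.measurableSet_biUnion fun s hs => hmeas s (hTmem s hs)
    have hdiff : ∀ P : ProbabilityMeasure (ι → ℝ),
        ((P (Set.univ.pi fun i => Set.Ico (a i) (b i)) : NNReal) : ℝ) =
          (P : Measure (ι → ℝ)).real (Set.Ici a) - (P : Measure (ι → ℝ)).real (⋃ s ∈ T, s) :=
      fun P => by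
        rw [pi_Ico_eq_Ici_diff a b, ← hT, ← measureReal_sdiff hsub hUmeas]
        rfl
    rw [← NNReal.tendsto_coe]
    simp only [hdiff]
    exact (h a).sub hunion

end Orthants

/-! ### Identification of the limit law, and transfer to arbitrary probability spaces. -/

section Limit

/-- The standard Gumbel law. -/
noncomputable def gumbelLaw : Measure ℝ := expSeqLaw.map fun ξ => gumbelLimit ξ 0

instance : IsProbabilityMeasure gumbelLaw :=
  Measure.isProbabilityMeasure_map (measurable_gumbelLimit 0).aemeasurable

theorem gumbelLaw_Iic (x : ℝ) :
    gumbelLaw (Set.Iic x) = ENNReal.ofReal (Real.exp (-Real.exp (-x))) := by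
  rw [gumbelLaw, Measure.map_apply (measurable_gumbelLimit 0) measurableSet_Iic]
  exact expSeqLaw_gumbelLimit_le 0 x

theorem IsStandardGumbel.map_eq {Ω : Type*} [MeasurableSpace Ω] {X : Ω → ℝ} {P : Measure Ω}
    [IsProbabilityMeasure P] (h : IsStandardGumbel X P) : P.map X = gumbelLaw := by
  have := Measure.isProbabilityMeasure_map h.1
  refine Measure.ext_of_Iic _ _ fun x => ?_
  rw [Measure.map_apply_of_aemeasurable h.1 measurableSet_Iic, gumbelLaw_Iic]
  exact h.2 x

theorem map_gumbelLimit_eq_pi (m : ℕ) :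
    expSeqLaw.map (fun ξ (α : Fin m) => gumbelLimit ξ α) = Measure.pi fun _ => gumbelLaw := by
  have h := iIndepFun_gumbelLimit.precomp (Fin.val_injective (n := m))
  rw [iIndepFun_iff_map_fun_eq_pi_map fun α => (measurable_gumbelLimit _).aemeasurable] at h
  rw [h]
  congr 1
  funext α
  exact map_gumbelLimit_eq _ 0

/-- Given the vertex variables, the condition for each pair is an upper bound on its own pair
variable. By independence the Gumbel distribution functions multiply to `exp (-∑ rates)`. -/
theorem pi_gumbelLaw_orthant {m : ℕ} (x : OrderedPair m → ℝ) :
    (Measure.pi fun _ : Fin m ⊕ OrderedPair m => gumbelLaw).real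
      {z | ∀ q, x q ≤ z (.inl q.1.1) + z (.inl q.1.2) - z (.inr q)} =
    ∫ ξ, Real.exp (-∑ q : OrderedPair m, limitRate (x q) q.1.1 q.1.2 ξ) ∂expSeqLaw := by
  have hs : MeasurableSet {z : (Fin m → ℝ) × (OrderedPair m → ℝ) |
      ∀ q : OrderedPair m, x q ≤ z.1 q.1.1 + z.1 q.1.2 - z.2 q} := by
    rw [Set.ofPred_forall]
    exact MeasurableSet.iInter fun q => measurableSet_le measurable_const (by fun_prop)
  have h1 : (Measure.pi fun _ : Fin m ⊕ OrderedPair m => gumbelLaw)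
      {z | ∀ q, x q ≤ z (.inl q.1.1) + z (.inl q.1.2) - z (.inr q)} =
      ((Measure.pi fun _ : Fin m => gumbelLaw).prod (Measure.pi fun _ : OrderedPair m => gumbelLaw))
        {z | ∀ q : OrderedPair m, x q ≤ z.1 q.1.1 + z.1 q.1.2 - z.2 q} :=
    (measurePreserving_sumPiEquivProdPi
      (fun _ : Fin m ⊕ OrderedPair m => gumbelLaw)).measure_preimage hs.nullMeasurableSet
  have h2 : ∀ z : Fin m → ℝ, (Measure.pi fun _ : OrderedPair m => gumbelLaw)
      (Prod.mk z ⁻¹' {z : (Fin m → ℝ) × (OrderedPair m → ℝ) |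
        ∀ q : OrderedPair m, x q ≤ z.1 q.1.1 + z.1 q.1.2 - z.2 q}) =
      ENNReal.ofReal (Real.exp (-∑ q : OrderedPair m,
        Real.exp (x q - z q.1.1 - z q.1.2))) := fun z => by
    have : Prod.mk z ⁻¹' {z : (Fin m → ℝ) × (OrderedPair m → ℝ) |
        ∀ q : OrderedPair m, x q ≤ z.1 q.1.1 + z.1 q.1.2 - z.2 q} =
        Set.univ.pi fun q => Set.Iic (z q.1.1 + z q.1.2 - x q) := by
      ext y
      simp only [Set.mem_preimage, Set.mem_ofPred_eq, Set.mem_univ_pi, Set.mem_Iic]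
      exact forall_congr' fun q => le_sub_comm
    rw [this, Measure.pi_pi, ← Finset.sum_neg_distrib, Real.exp_sum,
      ENNReal.ofReal_prod_of_nonneg fun q _ => Real.exp_nonneg _]
    refine Finset.prod_congr rfl fun q _ => ?_
    rw [gumbelLaw_Iic]
    congr 4
    ring
  have hcont : Measurable fun z : Fin m → ℝ => ENNReal.ofReal (Real.exp (-∑ q : OrderedPair m,
        Real.exp (x q - z q.1.1 - z q.1.2))) := by fun_prop
  have hG : Measurable fun ξ (α : Fin m) => gumbelLimit ξ α :=
    measurable_pi_lambda _ fun α => measurable_gumbelLimit _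
  rw [measureReal_def, h1, Measure.prod_apply hs]
  simp only [h2]
  rw [← map_gumbelLimit_eq_pi, lintegral_map hcont hG,
    integral_eq_lintegral_of_nonneg_ae (ae_of_all _ fun ξ => Real.exp_nonneg _)]
  · rfl
  · refine Measurable.aestronglyMeasurable (Real.measurable_exp.comp (Measurable.neg ?_))
    exact Finset.measurable_sum _ fun q _ => measurable_limitRate _ _ _

theorem map_eq_pi_gumbelLaw {Ω ι : Type*} [MeasurableSpace Ω] [Fintype ι] {P : Measure Ω}
    [IsProbabilityMeasure P] {X : ι → Ω → ℝ} (hX : ∀ i, IsStandardGumbel (X i) P)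
    (hind : iIndepFun X P) : P.map (fun ω i => X i ω) = Measure.pi fun _ => gumbelLaw := by
  rw [(iIndepFun_iff_map_fun_eq_pi_map fun i => (hX i).1).1 hind]
  congr 1
  funext i
  exact (hX i).map_eq

theorem map_eq_weightLaw {Ω : Type*} [MeasurableSpace Ω] {P : Measure Ω} [IsProbabilityMeasure P]
    {n : ℕ} {E : CompleteEdge n → Ω → ℝ} (hE : ∀ e, HasLaw (E e) (expMeasure (1 / (n : ℝ))) P)
    (hind : iIndepFun E P) : P.map (fun ω e => E e ω) = weightLaw n := by
  rw [(iIndepFun_iff_map_fun_eq_pi_map fun e => (hE e).aemeasurable).1 hind, weightLaw]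
  congr 1
  funext e
  exact (hE e).map_eq

end Limit

theorem proposition4p4
    (m : ℕ) (hm : 2 ≤ m)
    -- for each `n`, independent exponential edge weights with mean `n` on the edges of `K_n`
    {Ω : ℕ → Type*} [∀ n, MeasurableSpace (Ω n)]
    (P : (n : ℕ) → Measure (Ω n)) [∀ n, IsProbabilityMeasure (P n)]
    (E : (n : ℕ) → CompleteEdge n → Ω n → ℝ)
    (hE_law : ∀ n e, HasLaw (E n e) (expMeasure (1 / (n : ℝ))) (P n))
    (hE_indep : ∀ n, iIndepFun (E n) (P n))
    -- independent standard Gumbel variables `Λ_α` and `Λ_αβ`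
    {Ω' : Type*} [MeasurableSpace Ω'] (P' : Measure Ω') [IsProbabilityMeasure P']
    (Λ : Fin m → Ω' → ℝ) (Λ₂ : OrderedPair m → Ω' → ℝ)
    (hΛ : ∀ α, IsStandardGumbel (Λ α) P')
    (hΛ₂ : ∀ q, IsStandardGumbel (Λ₂ q) P')
    (hΛ_indep : iIndepFun (Sum.elim Λ Λ₂) P') :
    -- `n` runs over the integers `n ≥ m`, so that `[m] ⊆ [n]`
    TendstoInDistribution
      (fun (n : Set.Ici m) (ω : Ω n) (q : OrderedPair m) =>
        weightDist (fun e => E n e ω) (Fin.castLE n.2 q.1.1) (Fin.castLE n.2 q.1.2)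
          - Real.log ((n : ℕ) : ℝ))
      atTop
      (fun (ω : Ω') (q : OrderedPair m) => Λ q.1.1 ω + Λ q.1.2 ω - Λ₂ q ω)
      (fun n : Set.Ici m => P n) P' := by
  have hm0 : 0 < m := by omega
  have hE : ∀ n, AEMeasurable (fun ω e => E n e ω) (P n) := fun n =>
    aemeasurable_pi_lambda _ fun e => (hE_law n e).aemeasurable
  have hF : ∀ n : Set.Ici m, Measurable fun (w : CompleteEdge n → ℝ) (q : OrderedPair m) =>
      weightDist w (Fin.castLE n.2 q.1.1) (Fin.castLE n.2 q.1.2) - Real.log ((n : ℕ) : ℝ) :=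
    fun n => measurable_pi_lambda _ fun q => (measurable_weightDist _ _).sub_const _
  have hsum : ∀ s, IsStandardGumbel (Sum.elim Λ Λ₂ s) P' := Sum.rec hΛ hΛ₂
  have hL : AEMeasurable (fun ω s => Sum.elim Λ Λ₂ s ω) P' :=
    aemeasurable_pi_lambda _ fun s => (hsum s).1
  have hH : Measurable fun (z : Fin m ⊕ OrderedPair m → ℝ) (q : OrderedPair m) =>
      z (.inl q.1.1) + z (.inl q.1.2) - z (.inr q) := by fun_prop
  refine ⟨fun n => (hF n).comp_aemeasurable (hE n), hH.comp_aemeasurable hL, ?_⟩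
  refine tendsto_probabilityMeasure_of_tendsto_Ici fun x => ?_
  let ρ : (n : Set.Ici m) → ℕ → Fin n := fun n γ =>
    if h : γ < m then Fin.castLE n.2 ⟨γ, h⟩ else Fin.castLE n.2 ⟨0, hm0⟩
  have hρ : ∀ (n : Set.Ici m) (α : Fin m), ρ n α = Fin.castLE n.2 α := fun n α => dif_pos α.2
  have key := tendsto_weightLaw_real_farApart hm0 ρ (fun n γ hγ γ' hγ' h => by
    have h' := (hρ n ⟨γ, hγ⟩).symm.trans (h.trans (hρ n ⟨γ', hγ'⟩))
    exact congrArg Fin.val (Fin.castLE_injective n.2 h')) x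
  rw [← pi_gumbelLaw_orthant] at key
  have hlimit : (P'.map fun (ω : Ω') (q : OrderedPair m) =>
      Λ q.1.1 ω + Λ q.1.2 ω - Λ₂ q ω).real (Set.Ici x) =
      (Measure.pi fun _ : Fin m ⊕ OrderedPair m => gumbelLaw).real
        {z | ∀ q, x q ≤ z (.inl q.1.1) + z (.inl q.1.2) - z (.inr q)} := by
    rw [← map_eq_pi_gumbelLaw hsum hΛ_indep]
    exact congrArg ENNReal.toReal
      ((Measure.map_apply_of_aemeasurable (hH.comp_aemeasurable hL) measurableSet_Ici).trans
        (Measure.map_apply_of_aemeasurable hL (hH measurableSet_Ici)).symm)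
  have hprelimit : ∀ n : Set.Ici m, ((P n).map fun (ω : Ω n) (q : OrderedPair m) =>
      weightDist (fun e => E n e ω) (Fin.castLE n.2 q.1.1) (Fin.castLE n.2 q.1.2)
        - Real.log ((n : ℕ) : ℝ)).real (Set.Ici x) =
      (weightLaw n).real (farApart (ρ n) fun q => Real.log ((n : ℕ) : ℝ) + x q) := fun n => by
    have hset : (farApart (ρ n) fun q => Real.log ((n : ℕ) : ℝ) + x q) =
        (fun (w : CompleteEdge n → ℝ) (q : OrderedPair m) =>
          weightDist w (Fin.castLE n.2 q.1.1) (Fin.castLE n.2 q.1.2) - Real.log ((n : ℕ) : ℝ)) ⁻¹'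
          Set.Ici x := by
      ext w
      simp only [farApart, hρ, Set.mem_ofPred_eq]
      exact forall_congr' fun q => le_sub_iff_add_le'.symm
    rw [← map_eq_weightLaw (hE_law n) (hE_indep n), hset]
    exact congrArg ENNReal.toReal
      ((Measure.map_apply_of_aemeasurable ((hF n).comp_aemeasurable (hE n)) measurableSet_Ici).trans
        (Measure.map_apply_of_aemeasurable (hE n) (hF n measurableSet_Ici)).symm)
  simp only [ProbabilityMeasure.coe_mk]
  rw [hlimit]
  simp only [hprelimit]
  exact key
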